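/- Let $n\ge 4$, let $p\neq 2$ be a prime, let $\alpha\in\overline{\mathbb F_p}$ have multiplicative order greater than $2n$, and put $\mathbb F_q=\mathbb F_p(\alpha)$. Let $A_{D_n}$ be the Artin group of type $D_n$, with generators $u,s_1,\dots,s_{n-1}$ and relations $s_is_{i+1}s_i=s_{i+1}s_is_{i+1}$, $s_is_j=s_js_i$ for $|i-j|\ge 2$, $us_2u=s_2us_2$ and $us_i=s_iu$ for $i\ne 2$, and let $\mathcal A_{D_n}$ be its derived subgroup. A double-partition $\lambda=(\lambda_1,\lambda_2)$ of $n$ is a pair of partitions of total size $n$. Let $V_\lambda$ be the $\mathbb F_q$-vector space with basis the standard double-tableaux $\mathbb T=(\mathbb T_1,\mathbb T_2)$ of shape $\lambda$ (bijective fillings of the boxes of the two Young diagrams with $1,\dots,n$, increasing to the right and downwards in each diagram). If $j$ lies in row $r$ and column $c$, put $ct(\mathbb T:j)=\alpha^{c-r}$ if $j\in\mathbb T_1$ and $ct(\mathbb T:j)=-\alpha^{c-r}$ if $j\in\mathbb T_2$, and put $m_i(\mathbb T)=\frac{\alpha-1}{1-ct(\mathbb T:i)/ct(\mathbb T:i+1)}$.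 Define operators on $V_\lambda$ by $T\,\mathbb T=\mathbb T$ if $1\in\mathbb T_1$ and $T\,\mathbb T=-\mathbb T$ if $1\in\mathbb T_2$; $S_i\mathbb T=m_i(\mathbb T)\mathbb T+(1+m_i(\mathbb T))\mathbb T_{i\leftrightarrow i+1}$, where $\mathbb T_{i\leftrightarrow i+1}$ (obtained by exchanging the entries $i$ and $i+1$) is replaced by $0$ if it is not standard; and $U=TS_1T$. Then $s_i\mapsto S_i$, $u\mapsto U$ defines a representation $R_\lambda$ of $A_{D_n}$ on $V_\lambda$. If $\gamma=(\gamma_1,\gamma_1)$, the subspaces $V_{\gamma,\pm}$ spanned by the vectors $\mathbb T\pm\sigma(\mathbb T)$, where $\sigma(\mathbb T_1,\mathbb T_2)=(\mathbb T_2,\mathbb T_1)$, are stable under $A_{D_n}$; the corresponding representations are denoted $R_{\gamma,\pm}$. Fix a total order on partitions for which a partition of a larger integer is larger. Write $'$ for the transpose of a partition, and put $\varphi(\lambda)=(\lambda_2',\lambda_1')$ if $\lambda_1$ and $\lambda_2$ have the same size and $\lambda_2'>\lambda_1'$, and $\varphi(\lambda)=(\lambda_1',\lambda_2')$ otherwise.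 Write $R^\star$ for the dual of $R$ and, for a field automorphism $\epsilon$, $\epsilon\circ R$ for the representation obtained by applying $\epsilon$ to the matrix entries. In the following, $\lambda,\mu,\gamma,\delta$ are arbitrary double-partitions of $n$ with $\lambda_1>\lambda_2$, $\dim V_\lambda>1$, $\mu_1>\mu_2$, $\gamma_1=\gamma_2$ and $\delta_1=\delta_2$; in each statement $\pm$ and $\mp$ denote opposite signs, $\pm$ being the same on both sides. All representations are restricted to $\mathcal A_{D_n}$. \begin{enumerate} \item $R_\lambda$, $R_{\gamma,+}$ and $R_{\gamma,-}$ are absolutely irreducible. \item $R_\lambda\simeq R_\mu \Leftrightarrow \lambda=\mu$. \item $R_\lambda\not\simeq R_{\gamma,\pm}$. \item $R_{\gamma,\pm}\simeq R_{\delta,\pm}\Leftrightarrow \gamma=\delta$. \item $R_{\gamma,\pm}\not\simeq R_{\delta,\mp}$. \item $R_\lambda\simeq R_\mu^\star\Leftrightarrow \mu=\varphi(\lambda)$. \item $R_\lambda\not\simeq R_{\gamma,\pm}^\star$. \item If $n\equiv 0\pmod 4$, then $R_{\gamma,\pm}\simeq R_{\delta,\pm}^\star\Leftrightarrow\gamma=\varphi(\delta)$,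 and $R_{\gamma,\pm}\not\simeq R_{\delta,\mp}^\star$. \item If $n\equiv 2\pmod 4$, then $R_{\gamma,\pm}\not\simeq R_{\delta,\pm}^\star$, and $R_{\gamma,\pm}\simeq R_{\delta,\mp}^\star\Leftrightarrow\gamma=\varphi(\delta)$. \item If $\mathbb F_p(\alpha)\ne\mathbb F_p(\alpha+\alpha^{-1})$ and $\epsilon$ is the automorphism of order $2$ of $\mathbb F_q$, then \begin{enumerate} \item $R_\lambda\simeq\epsilon\circ R_\mu^\star\Leftrightarrow\lambda=\mu$; \item $R_\lambda\not\simeq\epsilon\circ R_{\gamma,\pm}$ and $R_\lambda\not\simeq\epsilon\circ R_{\gamma,\pm}^\star$; \item $R_{\gamma,\pm}\simeq\epsilon\circ R_{\delta,\pm}^\star\Leftrightarrow\gamma=\delta$; \item $R_{\gamma,\pm}\not\simeq\epsilon\circ R_{\delta,\mp}^\star$. \end{enumerate} \end{enumerate} -/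

import Mathlib

open scoped TensorProduct IntermediateField

noncomputable section

namespace TypeD

/-! ### Double-partitions -/

/-- A double-partition of `n`: an ordered pair of Young diagrams with `n` boxes in total. -/
@[ext]
structure DoublePartition (n : ℕ) where
  fst : YoungDiagram
  snd : YoungDiagram
  card_add_card : fst.card + snd.card = n

namespace DoublePartition

variable {n : ℕ}

/-- The left component (`false`) and the right component (`true`). -/
def comp (l : DoublePartition n) : Bool → YoungDiagram
  | false => l.fst
  | true => l.snd

/-- The boxes of a double-partition: a component, and a box `(row, column)` of it. -/
def boxes (l : DoublePartition n) : Set (Bool × ℕ × ℕ) :=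
  {b | b.2 ∈ l.comp b.1}

theorem card_transpose (d : YoungDiagram) : d.transpose.card = d.card := by
  simp [YoungDiagram.card, YoungDiagram.transpose]

/-- `(λ₁, λ₂) ↦ (λ₁', λ₂')`. -/
def conj (l : DoublePartition n) : DoublePartition n where
  fst := l.fst.transpose
  snd := l.snd.transpose
  card_add_card := by simp only [card_transpose, l.card_add_card]

/-- The transpose `(λ₁, λ₂) ↦ (λ₂', λ₁')`. -/
def transpose (l : DoublePartition n) : DoublePartition n where
  fst := l.snd.transpose
  snd := l.fst.transpose
  card_add_card := by simp only [card_transpose, add_comm, l.card_add_card]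

open Classical in
/-- The map `φ` on double-partitions, with respect to an order `lt` on Young diagrams:
`φ(λ) = (λ₂', λ₁')` if the two components have the same size and `λ₂' > λ₁'`, and
`φ(λ) = (λ₁', λ₂')` otherwise. -/
def phi (lt : YoungDiagram → YoungDiagram → Prop) (l : DoublePartition n) : DoublePartition n :=
  if l.fst.card = l.snd.card ∧ lt l.fst.transpose l.snd.transpose then l.transpose else l.conj

end DoublePartition

/-! ### Standard double-tableaux -/

section Tableaux

variable {n : ℕ}

/-- A filling of the boxes of `l`, given by the position `pos j` of every entry `j`, is a standard
double-tableau if every box holds exactly one entry and if, in each of the two components, the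
entries increase to the right and to the bottom. The entries `1, …, n` are represented by
`0, …, n - 1`, that is, by the elements of `Fin n`. -/
def IsStandard (l : DoublePartition n) (pos : Fin n → Bool × ℕ × ℕ) : Prop :=
  Set.BijOn pos Set.univ l.boxes ∧
    ∀ j k : Fin n, (pos j).1 = (pos k).1 → (pos j).2 ≤ (pos k).2 → j ≤ k

/-- The standard double-tableaux of shape `l`. -/
def StdTab (l : DoublePartition n) : Type :=
  {pos : Fin n → Bool × ℕ × ℕ // IsStandard l pos}

/-- The exchange of the left and the right component. -/
def flip (b : Bool × ℕ × ℕ) : Bool × ℕ × ℕ := (!b.1, b.2)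

/-- `σ(𝕋₁, 𝕋₂) = (𝕋₂, 𝕋₁)`, for tableaux whose shape has two equal components. -/
def StdTab.sigma {l : DoublePartition n} (hl : l.fst = l.snd) (t : StdTab l) : StdTab l :=
  ⟨fun j => flip (t.1 j), by
    have hc : ∀ b, l.comp (!b) = l.comp b := by
      intro b; cases b <;> simp [DoublePartition.comp, hl]
    obtain ⟨⟨hm, hi, hs⟩, ho⟩ := t.2
    refine ⟨⟨fun j hj => ?_, fun j hj k hk h => ?_, fun b hb => ?_⟩, fun j k h1 h2 => ?_⟩
    · have := hm hj
      simpa [DoublePartition.boxes, flip, hc] using this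
    · refine hi hj hk ?_
      simp only [flip, Prod.mk.injEq, Bool.not_inj_iff] at h
      exact Prod.ext h.1 h.2
    · have hb' : flip b ∈ l.boxes := by simpa [DoublePartition.boxes, flip, hc] using hb
      obtain ⟨j, hj, hjb⟩ := hs hb'
      exact ⟨j, hj, by simp [hjb, flip]⟩
    · exact ho j k (by simpa [flip] using h1) (by simpa [flip] using h2)⟩

end Tableaux

/-! ### The Hoefsmit model -/

section Model

variable {n : ℕ} (K : Type*) [Field K]

/-- The vector space `V_λ`, with basis the standard double-tableaux of shape `λ`. -/
abbrev V (l : DoublePartition n) : Type _ := StdTab l →₀ K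

variable {K} (α β : K)

/-- `ct(𝕋 : j)`: if `j` lies in row `r` and column `c` of a component, it is `α ^ (c - r) * β` for
the left component and `-α ^ (c - r)` for the right one. -/
def ct {l : DoublePartition n} (t : StdTab l) (j : Fin n) : K :=
  if (t.1 j).1 = false then α ^ (((t.1 j).2.2 : ℤ) - ((t.1 j).2.1 : ℤ)) * β
  else -α ^ (((t.1 j).2.2 : ℤ) - ((t.1 j).2.1 : ℤ))

/-- The entry `i` (in the numbering from `1`), for `i = 1, …, n - 1`. -/
def lo (i : Fin (n - 1)) : Fin n := ⟨i, by omega⟩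

/-- The entry `i + 1` (in the numbering from `1`), for `i = 1, …, n - 1`. -/
def hi (i : Fin (n - 1)) : Fin n := ⟨i + 1, by omega⟩

/-- `m_i(𝕋) = (α - 1) / (1 - ct(𝕋 : i) / ct(𝕋 : i + 1))`. -/
def m {l : DoublePartition n} (i : Fin (n - 1)) (t : StdTab l) : K :=
  (α - 1) / (1 - ct α β t (lo i) / ct α β t (hi i))

open Classical in
/-- The basis vector of the tableau obtained from `𝕋` by exchanging the entries `i` and `i + 1` if
that tableau is standard, and `0` otherwise. -/
def exch {l : DoublePartition n} (i : Fin (n - 1)) (t : StdTab l) : V K l :=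
  if h : IsStandard l (t.1 ∘ Equiv.swap (lo i) (hi i)) then Finsupp.single ⟨_, h⟩ 1 else 0

/-- The operator `S_i : 𝕋 ↦ m_i(𝕋) 𝕋 + (1 + m_i(𝕋)) 𝕋_{i ↔ i+1}` on `V_λ`. The index
`i = 1, …, n - 1` is represented by an element of `Fin (n - 1)`, numbered from `0`. -/
def opS (l : DoublePartition n) (i : Fin (n - 1)) : V K l →ₗ[K] V K l :=
  Finsupp.linearCombination K fun t =>
    m α β i t • Finsupp.single t 1 + (1 + m α β i t) • exch i t

/-- The operator `T` on `V_λ`: `T 𝕋 = β 𝕋` if the entry `1` lies in the left component of `𝕋`,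
and `T 𝕋 = -𝕋` otherwise. -/
def opT (hn : 0 < n) (l : DoublePartition n) : V K l →ₗ[K] V K l :=
  Finsupp.linearCombination K fun t =>
    (if (t.1 ⟨0, hn⟩).1 = false then β else -1) • Finsupp.single t 1

/-- The operator `U = T S₁ T` on `V_λ`. -/
def opU (hn : 1 < n) (l : DoublePartition n) : V K l →ₗ[K] V K l :=
  opT β (by omega) l ∘ₗ opS α β l ⟨0, by omega⟩ ∘ₗ opT β (by omega) l

variable (K) in
/-- For `γ = (γ₁, γ₁)` the subspace `V_{γ,±}` of `V_γ`, spanned by the vectors `𝕋 ± σ(𝕋)`. -/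
def Vpm (g : DoublePartition n) (hg : g.fst = g.snd) (s : ℤˣ) : Submodule K (V K g) :=
  Submodule.span K (Set.range fun t : StdTab g =>
    (Finsupp.single t 1 + (s : ℤ) • Finsupp.single (t.sigma hg) 1 : V K g))

end Model

/-! ### The Artin group of type `D_n` -/

/-- The generators `u, s₁, …, s_{n-1}`; the index of `s` is numbered from `0`. -/
inductive ArtinGen (n : ℕ) : Type
  | u : ArtinGen n
  | s (i : Fin (n - 1)) : ArtinGen n

open FreeGroup ArtinGen in
/-- The relations of the Artin group of type `D_n`: the braid relations of type `A_{n-1}` between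
`s₁, …, s_{n-1}`, the relation `u s₂ u = s₂ u s₂`, and `u s_i = s_i u` for `i ≠ 2`. -/
def artinRels (n : ℕ) : Set (FreeGroup (ArtinGen n)) :=
  {r | ∃ i j : Fin (n - 1), (i : ℕ) + 1 = j ∧
      r = of (s i) * of (s j) * of (s i) * (of (s j) * of (s i) * of (s j))⁻¹} ∪
  {r | ∃ i j : Fin (n - 1), (i : ℕ) + 1 < j ∧ r = of (s i) * of (s j) * (of (s j) * of (s i))⁻¹} ∪
  {r | ∃ i : Fin (n - 1), (i : ℕ) = 1 ∧
      r = of u * of (s i) * of u * (of (s i) * of u * of (s i))⁻¹} ∪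
  {r | ∃ i : Fin (n - 1), (i : ℕ) ≠ 1 ∧ r = of u * of (s i) * (of (s i) * of u)⁻¹}

/-- The Artin group `A_{D_n}`. -/
def ArtinD (n : ℕ) : Type := PresentedGroup (artinRels n)

instance (n : ℕ) : Group (ArtinD n) := inferInstanceAs (Group (PresentedGroup (artinRels n)))

/-- The generators of `A_{D_n}`. -/
def gen {n : ℕ} (x : ArtinGen n) : ArtinD n := PresentedGroup.of x

/-! ### Representations -/

section Reps

variable {K G V W : Type*} [Field K] [Group G] [AddCommMonoid V] [Module K V] [AddCommMonoid W]
  [Module K W]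

/-- The restriction of a representation of `G` to the derived subgroup of `G`. -/
def res (ρ : Representation K G V) : Representation K (commutator G) V :=
  ρ.comp (commutator G).subtype

/-- Two representations are isomorphic. -/
def Iso (ρ : Representation K G V) (τ : Representation K G W) : Prop :=
  Nonempty (ρ.Equiv τ)

/-- Extension of the scalars of a representation. -/
def extend (L : Type*) [Field L] [Algebra K L] (ρ : Representation K G V) :
    Representation L G (L ⊗[K] V) :=
  ((Module.End.baseChangeHom K L V : Module.End K V →* Module.End L (L ⊗[K] V))).comp ρ

/-- A representation is absolutely irreducible if it is irreducible over an algebraic closure of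
the base field, that is, nonzero and without proper nonzero subrepresentations there. -/
def IsAbsolutelyIrreducible (ρ : Representation K G V) : Prop :=
  IsSimpleOrder (Subrepresentation (extend (AlgebraicClosure K) ρ))

/-- The additive group of `V`, with the scalar multiplication `(c, v) ↦ ε⁻¹(c) v`. -/
def Twist (_ε : K ≃+* K) (V : Type*) : Type _ := V

instance (ε : K ≃+* K) : AddCommMonoid (Twist ε V) := inferInstanceAs (AddCommMonoid V)

instance (ε : K ≃+* K) : Module K (Twist ε V) := Module.compHom V (ε.symm : K →+* K)

/-- The representation `ε ∘ ρ`: if `g` acts on `V` by the matrix `(a_ij)` in some basis, then it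
acts on `Twist ε V` by the matrix `(ε(a_ij))` in the same basis. -/
def twist (ε : K ≃+* K) (ρ : Representation K G V) : Representation K G (Twist ε V) where
  toFun g :=
    { toFun := fun v => (ρ g (v : V) : V)
      map_add' := fun v w => (ρ g).map_add (v : V) (w : V)
      map_smul' := fun c v => (ρ g).map_smul (ε.symm c) (v : V) }
  map_one' := by
    refine LinearMap.ext fun v => ?_
    exact congrArg (fun f : V →ₗ[K] V => f v) (map_one ρ)
  map_mul' g h := by
    refine LinearMap.ext fun v => ?_
    exact congrArg (fun f : V →ₗ[K] V => f v) (map_mul ρ g h)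

/-- `ρ|_{G'} ≃ τ|_{G'}`, where `G'` is the derived subgroup of `G`. -/
def ResIso (ρ : Representation K G V) (τ : Representation K G W) : Prop :=
  Iso (res ρ) (res τ)

/-- `ρ|_{G'} ≃ (τ|_{G'})^⋆`. -/
def ResIsoDual (ρ : Representation K G V) (τ : Representation K G W) : Prop :=
  Iso (res ρ) (res τ).dual

/-- `ρ|_{G'} ≃ ε ∘ τ|_{G'}`. -/
def ResIsoTwist (ε : K ≃+* K) (ρ : Representation K G V) (τ : Representation K G W) : Prop :=
  Iso (res ρ) (twist ε (res τ))

/-- `ρ|_{G'} ≃ ε ∘ (τ|_{G'})^⋆`. -/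
def ResIsoTwistDual (ε : K ≃+* K) (ρ : Representation K G V) (τ : Representation K G W) : Prop :=
  Iso (res ρ) (twist ε (res τ).dual)

end Reps

end TypeD

end

open scoped TensorProduct IntermediateField

noncomputable section

namespace TypeD

/-! ### Boxes, contents and standard double-tableaux -/

/-! The operators of the model satisfy (X - α)(X + 1) = 0 and the relations of the Artin group,
because they arise from a type B model: T is diagonal, T² = 1, and `opS_mul_opD_mul_opS` is the
recursion of Jucys–Murphy elements. Hence u s₁, s₂ u s₁ s₂, … act diagonally (`hoefsmit_diagElem`),
with eigenvalues that are a power of α times ct(1) ct(j). Contents of standard tableaux are small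
compared with the order of α, so these eigenvalues determine a tableau of any shape up to σ
(`eq_or_eq_flip_of_weight`). The off-diagonal coefficients of the S_i between standard tableaux are
nonzero, and exchanges of consecutive entries connect all tableaux of a shape. A common eigenbasis
with distinct weights and connected coefficients, an `IsWeightBasis`, makes a representation
irreducible, also over every larger field. If both components agree, σ commutes with the group and
its two eigenspaces carry such bases.

All generators agree modulo the derived subgroup. The quadratic relation then gives two descent
results: irreducible representations stay irreducible on the derived subgroup
(`IsHecke.eq_top_of_commutator_stable`), and an isomorphism of restrictions intertwines the
generators up to a scalar c, which must be 1 (`exists_intertwiner_of_resIso`). So isomorphism is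
decided by comparing weights. Only R_{γ,+} and R_{γ,-} share their weights; an intertwiner between
them would be the same scalar on all tableau vectors, which contradicts the opposite signs under σ.

Duals are found by exhibiting forms: a form multiplied by one constant by every generator is
invariant under the derived subgroup. Pairing a tableau with its transpose, with the inversion sign
as coefficient, gives the constant -α. This sign changes by (-1)^(n/2) under σ, whence the
dependence on n modulo 4. Pairing each tableau with itself, with a product of off-diagonal
coefficients, gives an invariant form that is semilinear for α ↦ α⁻¹, and the automorphism of order
2 does send α to α⁻¹ (`ringEquiv_apply_eq_inv`). All statements about duals and twists thus become
statements about isomorphisms. -/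

/-- The content `c - r` of a box in row `r` and column `c`. -/
def content (b : Bool × ℕ × ℕ) : ℤ := (b.2.2 : ℤ) - b.2.1

/-- Two boxes are comparable if they lie in the same component, one weakly north-west of the
other. -/
def Comparable (b b' : Bool × ℕ × ℕ) : Prop := b.1 = b'.1 ∧ (b.2 ≤ b'.2 ∨ b'.2 ≤ b.2)

theorem Comparable.symm {b b' : Bool × ℕ × ℕ} (h : Comparable b b') : Comparable b' b :=
  ⟨h.1.symm, h.2.symm⟩

/-- Of two incomparable boxes of one component, one lies strictly north-east of the other, and then
the contents differ by at least 2. -/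
theorem comparable_of_content {b b' : Bool × ℕ × ℕ} (h : b.1 = b'.1)
    (h1 : content b ≤ content b' + 1) (h2 : content b' ≤ content b + 1) : Comparable b b' := by
  obtain ⟨x, r, c⟩ := b
  obtain ⟨y, r', c'⟩ := b'
  simp only [content] at h1 h2
  refine ⟨h, ?_⟩
  simp only [Prod.mk_le_mk]
  omega

@[simp] theorem flip_flip (b : Bool × ℕ × ℕ) : flip (flip b) = b := by simp [flip]

theorem flip_ne (b : Bool × ℕ × ℕ) : flip b ≠ b := by
  obtain ⟨x, r⟩ := b
  cases x <;> simp [flip]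

namespace DoublePartition

variable {n : ℕ}

/-- The double-partition with the two components exchanged. -/
def swap (l : DoublePartition n) : DoublePartition n where
  fst := l.snd
  snd := l.fst
  card_add_card := by rw [add_comm, l.card_add_card]

theorem comp_swap (l : DoublePartition n) (b : Bool) : l.swap.comp b = l.comp (!b) := by
  cases b <;> rfl

theorem swap_eq_self {l : DoublePartition n} (h : l.fst = l.snd) : l.swap = l := by
  ext1
  · exact h.symm
  · exact h

theorem eq_of_boxes_eq {l l' : DoublePartition n} (h : l.boxes = l'.boxes) : l = l' := by
  have key : ∀ b, l.comp b = l'.comp b := fun b => by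
    refine SetLike.ext fun x => ?_
    have := Set.ext_iff.mp h (b, x)
    simpa [boxes] using this
  ext1
  · exact key false
  · exact key true

theorem boxes_mem_of_le {l : DoublePartition n} {b : Bool} {x y : ℕ × ℕ} (h : x ≤ y)
    (hy : (b, y) ∈ l.boxes) : (b, x) ∈ l.boxes :=
  (l.comp b).isLowerSet h hy

/-- The boxes of a double-partition, as a finite set. -/
def boxFinset (l : DoublePartition n) : Finset (Bool × ℕ × ℕ) :=
  ({false} ×ˢ l.fst.cells) ∪ ({true} ×ˢ l.snd.cells)

theorem coe_boxFinset (l : DoublePartition n) : (l.boxFinset : Set (Bool × ℕ × ℕ)) = l.boxes := by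
  ext ⟨b, x⟩
  cases b <;> simp [boxFinset, boxes, comp]

theorem card_boxFinset (l : DoublePartition n) : l.boxFinset.card = n := by
  rw [boxFinset, Finset.card_union_of_disjoint]
  · simp [l.card_add_card]
  · rw [Finset.disjoint_left]
    rintro ⟨b, x⟩ h h'
    simp only [Finset.mem_product, Finset.mem_singleton] at h h'
    exact absurd (h.1.symm.trans h'.1) (by simp)

end DoublePartition

section Standard

variable {n : ℕ} {l l' : DoublePartition n} {pos pos' : Fin n → Bool × ℕ × ℕ}

theorem IsStandard.injective (h : IsStandard l pos) : Function.Injective pos :=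
  Set.injOn_univ.mp h.1.injOn

theorem IsStandard.mem (h : IsStandard l pos) (j : Fin n) : pos j ∈ l.boxes :=
  h.1.mapsTo (Set.mem_univ j)

theorem IsStandard.exists_pos (h : IsStandard l pos) {b : Bool × ℕ × ℕ} (hb : b ∈ l.boxes) :
    ∃ j, pos j = b := by
  obtain ⟨j, -, hj⟩ := h.1.surjOn hb
  exact ⟨j, hj⟩

theorem IsStandard.shape_eq (h : IsStandard l pos) (h' : IsStandard l' pos) : l = l' :=
  DoublePartition.eq_of_boxes_eq (by rw [← h.1.image_eq, ← h'.1.image_eq])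

theorem IsStandard.flip (h : IsStandard l pos) : IsStandard l.swap (flip ∘ pos) := by
  refine ⟨⟨fun j _ => ?_, fun j _ k _ hjk => ?_, fun b hb => ?_⟩, fun j k h1 h2 => ?_⟩
  · have := h.mem j
    simpa [DoublePartition.boxes, TypeD.flip, DoublePartition.comp_swap] using this
  · refine h.injective ?_
    simpa using congrArg TypeD.flip hjk
  · have hb' : TypeD.flip b ∈ l.boxes := by
      simpa [DoublePartition.boxes, TypeD.flip, DoublePartition.comp_swap] using hb
    obtain ⟨j, hj⟩ := h.exists_pos hb'
    exact ⟨j, trivial, by simp [hj]⟩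
  · exact h.2 j k (by simpa [TypeD.flip] using h1) h2

/-- A box weakly north-west of the box of `j` holds an entry that is at most `j`. -/
theorem IsStandard.exists_le (h : IsStandard l pos) {j : Fin n} {x : ℕ × ℕ} (hx : x ≤ (pos j).2) :
    ∃ k, k ≤ j ∧ pos k = ((pos j).1, x) := by
  obtain ⟨k, hk⟩ := h.exists_pos (b := ((pos j).1, x))
    (DoublePartition.boxes_mem_of_le hx (by simpa using h.mem j))
  exact ⟨k, h.2 k j (by simp [hk]) (by simpa [hk] using hx), hk⟩

/-- The number of entries less than `j` in the component `b`. -/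
def countLT (pos : Fin n → Bool × ℕ × ℕ) (b : Bool) (j : Fin n) : ℕ :=
  (Finset.univ.filter fun k => k < j ∧ (pos k).1 = b).card

/-- The boxes to the left in the row of `j` hold distinct smaller entries of the same component. -/
theorem IsStandard.col_le_countLT (h : IsStandard l pos) (j : Fin n) :
    (pos j).2.2 ≤ countLT pos (pos j).1 j := by
  have hx : ∀ c : ℕ, ∃ k : Fin n, c < (pos j).2.2 →
      k < j ∧ pos k = ((pos j).1, (pos j).2.1, c) := by
    intro c
    by_cases hc : c < (pos j).2.2
    · obtain ⟨k, hk, hk'⟩ := h.exists_le (j := j) (x := ((pos j).2.1, c))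
        (Prod.mk_le_mk.mpr ⟨le_rfl, hc.le⟩)
      refine ⟨k, fun _ => ⟨lt_of_le_of_ne hk ?_, hk'⟩⟩
      rintro rfl
      have := congrArg (fun b => b.2.2) hk'
      simp at this
      omega
    · exact ⟨j, fun h => absurd h hc⟩
  choose f hf using hx
  rw [countLT, ← Finset.card_range (pos j).2.2]
  refine Finset.card_le_card_of_injOn f (fun c hc => ?_) fun c hc d hd hcd => ?_
  · have := hf c (by simpa using hc)
    simp [this]
  · have h1 := (hf c (by simpa using hc)).2
    have h2 := (hf d (by simpa using hd)).2
    rw [hcd, h2] at h1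
    simpa using h1.symm

theorem IsStandard.row_le_countLT (h : IsStandard l pos) (j : Fin n) :
    (pos j).2.1 ≤ countLT pos (pos j).1 j := by
  have hx : ∀ c : ℕ, ∃ k : Fin n, c < (pos j).2.1 →
      k < j ∧ pos k = ((pos j).1, c, (pos j).2.2) := by
    intro c
    by_cases hc : c < (pos j).2.1
    · obtain ⟨k, hk, hk'⟩ := h.exists_le (j := j) (x := (c, (pos j).2.2))
        (Prod.mk_le_mk.mpr ⟨hc.le, le_rfl⟩)
      refine ⟨k, fun _ => ⟨lt_of_le_of_ne hk ?_, hk'⟩⟩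
      rintro rfl
      have := congrArg (fun b => b.2.1) hk'
      simp at this
      omega
    · exact ⟨j, fun h => absurd h hc⟩
  choose f hf using hx
  rw [countLT, ← Finset.card_range (pos j).2.1]
  refine Finset.card_le_card_of_injOn f (fun c hc => ?_) fun c hc d hd hcd => ?_
  · have := hf c (by simpa using hc)
    simp [this]
  · have h1 := (hf c (by simpa using hc)).2
    have h2 := (hf d (by simpa using hd)).2
    rw [hcd, h2] at h1
    simpa using h1.symm

theorem IsStandard.content_le (h : IsStandard l pos) (j : Fin n) :
    |content (pos j)| ≤ countLT pos (pos j).1 j := by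
  have h1 := h.col_le_countLT j
  have h2 := h.row_le_countLT j
  rw [abs_le, content]
  omega

theorem countLT_add_countLT (pos : Fin n → Bool × ℕ × ℕ) (b : Bool) (j : Fin n) :
    countLT pos b j + countLT pos (!b) j = j := by
  have : (Finset.univ.filter fun k : Fin n => k < j).card = j := by
    rw [show (Finset.univ.filter fun k : Fin n => k < j) = Finset.Iio j by ext; simp]
    simp
  rw [← this, ← Finset.card_filter_add_card_filter_not (fun k => (pos k).1 = b),
    Finset.filter_filter, Finset.filter_filter, countLT, countLT]
  congr! 4 with k
  cases (pos k).1 <;> cases b <;> simp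

theorem countLT_mono (pos : Fin n → Bool × ℕ × ℕ) (b : Bool) {j k : Fin n} (h : j ≤ k) :
    countLT pos b j ≤ countLT pos b k := by
  refine Finset.card_le_card fun x => ?_
  simp only [Finset.mem_filter, Finset.mem_univ, true_and]
  exact fun hx => ⟨hx.1.trans_le h, hx.2⟩

/-- Each content is bounded by the number of earlier entries in its own component. For different
components these two counts, taken at the later entry, add up to at most `n - 1`. The bound is `n`,
not `2 * n`, because a sign has to be excluded by squaring in `zpow_ne_neg_one`. -/
theorem IsStandard.content_sub_le (h : IsStandard l pos) {i k : Fin n}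
    (hc : (pos i).1 ≠ (pos k).1) : |content (pos i) - content (pos k)| + 1 ≤ n := by
  wlog hik : i ≤ k generalizing i k
  · rw [abs_sub_comm]
    exact this hc.symm (le_of_not_ge hik)
  have h1 := h.content_le i
  have h2 := h.content_le k
  have h3 := countLT_mono pos (pos i).1 hik
  have h4 := countLT_add_countLT pos (pos k).1 k
  have h5 : (!(pos k).1) = (pos i).1 := by
    revert hc; cases (pos i).1 <;> cases (pos k).1 <;> simp
  rw [h5] at h4
  have := k.2
  have h6 := abs_sub (content (pos i)) (content (pos k))
  omega

theorem IsStandard.abs_content_lt (h : IsStandard l pos) (j : Fin n) :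
    |content (pos j)| + 1 ≤ n := by
  have h1 := h.content_le j
  have h4 := countLT_add_countLT pos (pos j).1 j
  have := j.2
  omega

theorem IsStandard.pos_zero (h : IsStandard l pos) (hn : 0 < n) :
    (pos ⟨0, hn⟩).2 = (0, 0) := by
  have h1 := h.col_le_countLT ⟨0, hn⟩
  have h2 := h.row_le_countLT ⟨0, hn⟩
  have h4 := countLT_add_countLT pos (pos ⟨0, hn⟩).1 ⟨0, hn⟩
  simp only at h4
  ext1 <;> simp <;> omega

theorem IsStandard.not_snd_le (h : IsStandard l pos) {i k : Fin n} (hik : i < k)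
    (hc : (pos i).1 = (pos k).1) : ¬ (pos k).2 ≤ (pos i).2 := fun hle =>
  absurd (h.2 k i hc.symm hle) (not_le.mpr hik)

/-- Two entries on the same diagonal of a component differ by at least `3`. -/
theorem IsStandard.add_three_le (h : IsStandard l pos) {i k : Fin n} (hik : i < k)
    (hc : (pos i).1 = (pos k).1) (hct : content (pos i) = content (pos k)) :
    (i : ℕ) + 3 ≤ k := by
  have hle := h.not_snd_le hik hc
  simp only [content] at hct
  have hrc : (pos i).2.1 < (pos k).2.1 ∧ (pos i).2.2 < (pos k).2.2 := by
    rw [Prod.le_def] at hle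
    omega
  -- The boxes right of and below that of `i` both precede the box of `k`, so their two entries lie
  -- strictly between `i` and `k`.
  obtain ⟨x, hxk, hx⟩ := h.exists_le (j := k) (x := ((pos i).2.1, (pos i).2.2 + 1))
    (Prod.mk_le_mk.mpr ⟨hrc.1.le, hrc.2⟩)
  obtain ⟨y, hyk, hy⟩ := h.exists_le (j := k) (x := ((pos i).2.1 + 1, (pos i).2.2))
    (Prod.mk_le_mk.mpr ⟨hrc.1, hrc.2.le⟩)
  have hix : i ≤ x := h.2 i x (by simp [hx, hc]) (by rw [hx, Prod.le_def]; simp)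
  have hiy : i ≤ y := h.2 i y (by simp [hy, hc]) (by rw [hy, Prod.le_def]; simp)
  have n1 : i ≠ x := by
    rintro rfl
    have := congrArg (fun b => b.2.2) hx
    simp at this
  have n2 : i ≠ y := by
    rintro rfl
    have := congrArg (fun b => b.2.1) hy
    simp at this
  have n3 : x ≠ y := by
    rintro rfl
    rw [hx] at hy
    simp at hy
  have n4 : x ≠ k := by
    rintro rfl
    have := congrArg (fun b => b.2.1) hx
    simp at this
    omega
  have n5 : y ≠ k := by
    rintro rfl
    have := congrArg (fun b => b.2.2) hy
    simp at this
    omega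
  omega

/-- Consecutive entries in comparable boxes have contents that differ by `1`. -/
theorem IsStandard.content_of_comparable (h : IsStandard l pos) {i k : Fin n}
    (hik : (i : ℕ) + 1 = k) (hc : Comparable (pos i) (pos k)) :
    content (pos i) = content (pos k) + 1 ∨ content (pos k) = content (pos i) + 1 := by
  have hlt : i < k := by rw [Fin.lt_def]; omega
  obtain ⟨hc, hle⟩ := hc
  have hle : (pos i).2 ≤ (pos k).2 := hle.resolve_right (h.not_snd_le hlt hc)
  -- No entry lies strictly between `i` and `k`, hence no box lies strictly between theirs; the two
  -- boxes are adjacent.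
  have hbt : ∀ x, (pos i).2 ≤ x → x ≤ (pos k).2 → x = (pos i).2 ∨ x = (pos k).2 := by
    intro x h1 h2
    obtain ⟨y, hyk, hy⟩ := h.exists_le h2
    have hiy : i ≤ y := h.2 i y (by simp [hy, hc]) (by simpa [hy] using h1)
    have : y = i ∨ y = k := by
      simp only [Fin.ext_iff, Fin.le_def] at *
      omega
    rcases this with rfl | rfl
    · exact Or.inl (by simp [hy])
    · exact Or.inr (by rw [hy])
  rw [Prod.le_def] at hle
  have hne : (pos i).2 ≠ (pos k).2 := fun he => hlt.ne (h.injective (Prod.ext hc he))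
  simp only [content]
  by_cases h2 : (pos i).2.2 < (pos k).2.2
  · have := hbt ((pos i).2.1, (pos i).2.2 + 1) (by rw [Prod.le_def]; simp)
      (Prod.mk_le_mk.mpr ⟨hle.1, h2⟩)
    simp only [Prod.ext_iff] at this
    omega
  · have h1 : (pos i).2.1 < (pos k).2.1 := by
      rw [Ne, Prod.ext_iff] at hne
      omega
    have := hbt ((pos i).2.1 + 1, (pos i).2.2) (by rw [Prod.le_def]; simp)
      (Prod.mk_le_mk.mpr ⟨h1, hle.2⟩)
    simp only [Prod.ext_iff] at this
    omega

theorem lo_lt_hi (i : Fin (n - 1)) : lo i < hi i := by simp [lo, hi, Fin.lt_def]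

theorem lo_ne_hi (i : Fin (n - 1)) : lo i ≠ hi i := (lo_lt_hi i).ne

theorem swap_le_swap {i : Fin (n - 1)} {j k : Fin n} (h : j ≤ k)
    (hne : ¬ (j = lo i ∧ k = hi i)) :
    Equiv.swap (lo i) (hi i) j ≤ Equiv.swap (lo i) (hi i) k := by
  have h1 : (lo i : ℕ) = i := rfl
  have h2 : (hi i : ℕ) = i + 1 := rfl
  simp only [Equiv.swap_apply_def]
  split_ifs <;> simp only [Fin.ext_iff, Fin.le_def] at * <;> omega

/-- Exchanging the entries `i` and `i + 1` of a standard double-tableau gives a standard one if and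
only if they lie in incomparable boxes. -/
theorem IsStandard.swap_iff (h : IsStandard l pos) (i : Fin (n - 1)) :
    IsStandard l (pos ∘ Equiv.swap (lo i) (hi i)) ↔ ¬ Comparable (pos (lo i)) (pos (hi i)) := by
  constructor
  · rintro h' ⟨hc, hle⟩
    rcases hle with hle | hle
    · have := h'.2 (hi i) (lo i) (by simpa using hc) (by simpa using hle)
      exact absurd this (not_le.mpr (lo_lt_hi i))
    · exact h.not_snd_le (lo_lt_hi i) hc hle
  · intro hc
    refine ⟨h.1.comp (Equiv.bijective _).bijOn_univ, fun j k h1 h2 => ?_⟩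
    have := h.2 _ _ h1 h2
    have h3 := swap_le_swap (i := i) this ?_
    · simpa using h3
    · rintro ⟨e1, e2⟩
      refine hc ⟨?_, Or.inl ?_⟩
      · simpa [e1, e2] using h1
      · simpa [e1, e2] using h2

end Standard

/-! ### Contents as powers of α, and how they separate tableaux -/

section Scalar

variable {K : Type*} [Field K] {α : K} {n : ℕ}

/-- The value `± α ^ content` attached to a box. -/
def ctb (α : K) (b : Bool × ℕ × ℕ) : K :=
  if b.1 = false then α ^ content b else -α ^ content b

theorem ct_eq_ctb {l : DoublePartition n} (t : StdTab l) (j : Fin n) :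
    ct α 1 t j = ctb α (t.1 j) := by
  simp [ct, ctb, content]

@[simp] theorem ctb_flip (b : Bool × ℕ × ℕ) : ctb α (flip b) = -ctb α b := by
  obtain ⟨x, r, c⟩ := b
  cases x <;> simp [ctb, flip, content]

theorem ne_zero_of_orderOf (hα : 2 * n < orderOf α) : α ≠ 0 := by
  rintro rfl
  have h : 0 < orderOf (0 : K) := by omega
  have := pow_orderOf_eq_one (0 : K)
  rw [zero_pow h.ne'] at this
  exact zero_ne_one this

theorem ctb_ne_zero (h0 : α ≠ 0) (b : Bool × ℕ × ℕ) : ctb α b ≠ 0 := by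
  unfold ctb
  split_ifs <;> simp [zpow_ne_zero, h0]

theorem eq_zero_of_zpow_eq_one (hα : 2 * n < orderOf α) {d : ℤ} (hd : |d| ≤ 2 * n)
    (h : α ^ d = 1) : d = 0 := by
  have hu : (Units.mk0 α (ne_zero_of_orderOf hα)) ^ d = 1 := Units.ext (by simpa using h)
  have h1 := orderOf_dvd_iff_zpow_eq_one.mpr hu
  rw [← orderOf_units, Units.val_mk0] at h1
  refine Int.eq_zero_of_abs_lt_dvd h1 ?_
  omega

theorem zpow_ne_neg_one (h2 : (2 : K) ≠ 0) (hα : 2 * n < orderOf α) {d : ℤ} (hd : |d| ≤ n) :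
    α ^ d ≠ -1 := by
  intro h
  have h1 : α ^ (2 * d) = 1 := by rw [mul_comm, zpow_mul, h]; norm_num
  have h3 := eq_zero_of_zpow_eq_one hα (by rw [abs_mul]; simp; omega) h1
  have h4 : d = 0 := by omega
  rw [h4, zpow_zero] at h
  exact h2 (by linear_combination h)

/-- In one component the quotient of the two values is a power of `α`, trivial only for exponent 0.
In different components the quotient is minus such a power, and `-1` is not a power of `α` with a
small exponent. -/
theorem zpow_eq_iff_of_comp (h2 : (2 : K) ≠ 0) (hα : 2 * n < orderOf α) {b b' : Bool × ℕ × ℕ}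
    {e : ℤ} (hs : b.1 = b'.1 → |content b - content b' - e| ≤ 2 * n)
    (hd : b.1 ≠ b'.1 → |content b - content b' - e| ≤ n)
    (h : ctb α b = α ^ e * ctb α b') : b.1 = b'.1 ∧ content b = content b' + e := by
  have h0 := ne_zero_of_orderOf hα
  have key : α ^ (content b - content b' - e) = α ^ content b / (α ^ e * α ^ content b') := by
    rw [zpow_sub₀ h0, zpow_sub₀ h0]
    field_simp
  have hne : α ^ e * α ^ content b' ≠ 0 := mul_ne_zero (zpow_ne_zero _ h0) (zpow_ne_zero _ h0)
  by_cases hb : b.1 = b'.1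
  · refine ⟨hb, ?_⟩
    have : α ^ content b = α ^ e * α ^ content b' := by
      unfold ctb at h
      rw [hb] at h
      split_ifs at h
      · exact h
      · linear_combination -h
    rw [this, div_self hne] at key
    have := eq_zero_of_zpow_eq_one hα (hs hb) key
    omega
  · exfalso
    have : α ^ content b = -(α ^ e * α ^ content b') := by
      unfold ctb at h
      split_ifs at h with h1 h2
      · exact absurd (h1.trans h2.symm) hb
      · linear_combination h
      · linear_combination -h
      · simp only [Bool.not_eq_false] at *
        exact absurd (h1.trans (by assumption : b'.1 = true).symm) hb
    rw [this, neg_div, div_self hne] at key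
    exact zpow_ne_neg_one h2 hα (hd hb) key

variable {l l' : DoublePartition n} {pos pos' : Fin n → Bool × ℕ × ℕ}

/-- The content bounds leave room for a shift `e` of size one: `2 * (n - 1) + 1 ≤ 2 * n` in one
component, `(n - 1) + 1 = n` across components. -/
theorem IsStandard.content_of_ctb (h : IsStandard l pos) (h2 : (2 : K) ≠ 0)
    (hα : 2 * n < orderOf α) {i k : Fin n} {e : ℤ} (he : |e| ≤ 1)
    (hik : ctb α (pos i) = α ^ e * ctb α (pos k)) :
    (pos i).1 = (pos k).1 ∧ content (pos i) = content (pos k) + e := by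
  refine zpow_eq_iff_of_comp h2 hα (fun _ => ?_) (fun hc => ?_) hik
  · have h1 := h.abs_content_lt i
    have h3 := h.abs_content_lt k
    rw [abs_le] at *
    constructor <;> [skip; skip] <;> rw [← Int.lt_iff_add_one_le, abs_lt] at h1 h3 <;> omega
  · have := h.content_sub_le hc
    have h6 := abs_sub (content (pos i) - content (pos k)) e
    omega

/-- This keeps the denominators of `mb` nonzero. The distance 2 is allowed because a braid relation
involves three consecutive entries. -/
theorem IsStandard.ctb_ne (h : IsStandard l pos) (h2 : (2 : K) ≠ 0)
    (hα : 2 * n < orderOf α) {i k : Fin n} (hik : i < k) (hk : (k : ℕ) ≤ i + 2) :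
    ctb α (pos i) ≠ ctb α (pos k) := by
  intro he
  have := h.content_of_ctb h2 hα (e := 0) (by simp) (by simpa using he)
  have := h.add_three_le hik this.1 (by simpa using this.2)
  omega

theorem IsStandard.comparable_of_ctb (h : IsStandard l pos) (h2 : (2 : K) ≠ 0)
    (hα : 2 * n < orderOf α) {i k : Fin n} (hik : ctb α (pos i) = α * ctb α (pos k)) :
    Comparable (pos i) (pos k) := by
  obtain ⟨h1, h3⟩ := h.content_of_ctb h2 hα (e := 1) (by simp) (by simpa using hik)
  exact comparable_of_content h1 (by omega) (by omega)

theorem IsStandard.ctb_of_comparable (h : IsStandard l pos) (h0 : α ≠ 0) {i k : Fin n}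
    (hik : (i : ℕ) + 1 = k) (hc : Comparable (pos i) (pos k)) :
    ctb α (pos i) = α * ctb α (pos k) ∨ ctb α (pos k) = α * ctb α (pos i) := by
  rcases h.content_of_comparable hik hc with h1 | h1
  · left
    unfold ctb
    rw [hc.1, h1, zpow_add_one₀ h0]
    split_ifs <;> ring
  · right
    unfold ctb
    rw [hc.1, h1, zpow_add_one₀ h0]
    split_ifs <;> ring

/-- A standard double-tableau is determined by its contents, whatever its shape. -/
theorem IsStandard.eq_of_ctb (h : IsStandard l pos) (h' : IsStandard l' pos') (h2 : (2 : K) ≠ 0)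
    (hα : 2 * n < orderOf α) (he : ∀ j, ctb α (pos j) = ctb α (pos' j)) : pos = pos' := by
  funext j
  induction j using WellFoundedLT.induction with
  | ind j ih =>
  -- By induction the smaller entries have the same positions, so both contents at `j` are bounded
  -- by counts in the same tableau.
  have hcount : ∀ b, countLT pos b j = countLT pos' b j := fun b => by
    unfold countLT
    congr 1
    ext k
    simp only [Finset.mem_filter, Finset.mem_univ, true_and, and_congr_right_iff]
    intro hk
    rw [ih k hk]
  have c1 := h.content_le j
  have c2 := h'.content_le j
  have c3 := countLT_add_countLT pos (pos j).1 j
  have hj := j.2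
  have c4 : |content (pos j) - content (pos' j)| ≤ |content (pos j)| + |content (pos' j)| :=
    abs_sub _ _
  rw [← hcount] at c2
  obtain ⟨hb, hc⟩ := zpow_eq_iff_of_comp (e := 0) (b := pos j) (b' := pos' j) h2 hα
    (fun hb => by rw [← hb] at c2; rw [sub_zero]; omega)
    (fun hb => by
      have : (!(pos j).1) = (pos' j).1 := by
        revert hb; cases (pos j).1 <;> cases (pos' j).1 <;> simp
      rw [this] at c3
      rw [sub_zero]; omega) (by simpa using he j)
  -- Both boxes lie on one diagonal. Were one strictly north-west of the other, it would already
  -- hold a smaller entry, at the same place in both tableaux.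
  have hle : (pos j).2 ≤ (pos' j).2 ∨ (pos' j).2 ≤ (pos j).2 :=
    (comparable_of_content hb (by omega) (by omega)).2
  rcases hle with hle | hle
  · obtain ⟨k, hk, hk'⟩ := h'.exists_le hle
    rw [← hb] at hk'
    rcases hk.lt_or_eq with hlt | rfl
    · rw [← ih k hlt] at hk'
      exact absurd (h.injective hk') hlt.ne
    · exact hk'.symm
  · obtain ⟨k, hk, hk'⟩ := h.exists_le hle
    rw [hb] at hk'
    rcases hk.lt_or_eq with hlt | rfl
    · rw [ih k hlt] at hk'
      exact absurd (h'.injective hk') hlt.ne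
    · exact hk'

theorem IsStandard.ctb_zero (h : IsStandard l pos) (hn : 0 < n) :
    ctb α (pos ⟨0, hn⟩) = if (pos ⟨0, hn⟩).1 = false then 1 else -1 := by
  have := h.pos_zero hn
  simp [ctb, content, this]

/-- The products of the first content with the others determine a standard double-tableau up to the
exchange of the components. -/
theorem IsStandard.eq_or_eq_flip (h : IsStandard l pos) (h' : IsStandard l' pos')
    (h2 : (2 : K) ≠ 0) (hα : 2 * n < orderOf α) (hn : 0 < n)
    (he : ∀ j, j ≠ ⟨0, hn⟩ → ctb α (pos ⟨0, hn⟩) * ctb α (pos j) =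
      ctb α (pos' ⟨0, hn⟩) * ctb α (pos' j)) :
    pos = pos' ∨ pos = TypeD.flip ∘ pos' := by
  have z := h.ctb_zero (α := α) hn
  have z' := h'.ctb_zero (α := α) hn
  have hcase : ctb α (pos ⟨0, hn⟩) = ctb α (pos' ⟨0, hn⟩) ∨
      ctb α (pos ⟨0, hn⟩) = -ctb α (pos' ⟨0, hn⟩) := by
    rw [z, z']; split_ifs <;> simp
  have hne : ctb α (pos' ⟨0, hn⟩) ≠ 0 := ctb_ne_zero (ne_zero_of_orderOf hα) _
  rcases hcase with hc | hc
  · left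
    refine h.eq_of_ctb h' h2 hα fun j => ?_
    by_cases hj : j = ⟨0, hn⟩
    · rw [hj, hc]
    · have := he j hj
      rw [hc] at this
      exact mul_left_cancel₀ hne this
  · right
    refine h.eq_of_ctb h'.flip h2 hα fun j => ?_
    rw [Function.comp_apply, ctb_flip]
    by_cases hj : j = ⟨0, hn⟩
    · rw [hj, hc]
    · have := he j hj
      rw [hc] at this
      refine mul_left_cancel₀ hne ?_
      linear_combination -this

end Scalar

/-! ### Existence and connectedness of standard tableaux -/

section Tableaux

variable {n : ℕ} {l : DoublePartition n}

instance : Finite (StdTab l) := by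
  have : Finite l.boxes := by
    rw [← l.coe_boxFinset]
    exact Finset.finite_toSet _
  refine Finite.of_injective (fun (t : StdTab l) (j : Fin n) => (⟨t.1 j, t.2.mem j⟩ : l.boxes)) ?_
  intro t t' h
  refine Subtype.ext (funext fun j => ?_)
  simpa using congrFun h j

/-- Filling the boxes in lexicographic order is standard, since that order refines the product order
in each component. -/
instance : Nonempty (StdTab l) := by
  let f : Bool × ℕ × ℕ ≃ Bool ×ₗ (ℕ ×ₗ ℕ) := (Equiv.prodCongr (Equiv.refl _) toLex).trans toLex
  have hcard : (l.boxFinset.map f.toEmbedding).card = n := by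
    rw [Finset.card_map, l.card_boxFinset]
  let g := (l.boxFinset.map f.toEmbedding).orderEmbOfFin hcard
  refine ⟨⟨fun j => f.symm (g j), ⟨fun j _ => ?_, fun j _ k _ h => ?_, fun b hb => ?_⟩,
    fun j k h1 h2 => ?_⟩⟩
  · have := Finset.orderEmbOfFin_mem (l.boxFinset.map f.toEmbedding) hcard j
    rw [Finset.mem_map_equiv, ← Finset.mem_coe, l.coe_boxFinset] at this
    exact this
  · exact g.injective (f.symm.injective h)
  · have hb' : f b ∈ Set.range g := by
      rw [Finset.range_orderEmbOfFin]
      rw [← l.coe_boxFinset] at hb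
      simpa using hb
    obtain ⟨j, hj⟩ := hb'
    exact ⟨j, trivial, by simp [hj]⟩
  · rw [← g.le_iff_le, ← f.apply_symm_apply (g j), ← f.apply_symm_apply (g k)]
    set b := f.symm (g j)
    set b' := f.symm (g k)
    have h3 : toLex b.2 ≤ toLex b'.2 := Prod.Lex.toLex_mono h2
    change toLex (b.1, toLex b.2) ≤ toLex (b'.1, toLex b'.2)
    rw [Prod.Lex.toLex_le_toLex]
    exact Or.inr ⟨h1, h3⟩

/-- Any two standard double-tableaux of the same shape are connected by exchanges of consecutive
entries that stay among the standard double-tableaux. -/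
theorem StdTab.induction_swap {P : StdTab l → Prop}
    (hP : ∀ (t : StdTab l) (i : Fin (n - 1))
      (h : IsStandard l (t.1 ∘ Equiv.swap (lo i) (hi i))), P t → P ⟨_, h⟩)
    {t : StdTab l} (ht : P t) (t' : StdTab l) : P t' := by
  have hw : ∀ (t : StdTab l) (j : Fin n), ∃ k, t'.1 k = t.1 j := fun t j =>
    t'.2.exists_pos (t.2.mem j)
  choose w hw using hw
  have : Nonempty {t : StdTab l // P t} := ⟨⟨t, ht⟩⟩
  -- Here `w s j` is the entry of `t'` in the box where `s` has `j`. By rearrangement, exchanging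
  -- `i` and `i + 1` at a descent of `w s` increases the sum, so at a maximum `w s` is increasing,
  -- hence the identity.
  obtain ⟨⟨s, hs⟩, hmax⟩ := Finite.exists_max
    (fun s : {t : StdTab l // P t} => ∑ j : Fin n, ((j : ℕ) : ℤ) * ((w s.1 j : ℕ) : ℤ))
  have hstep : ∀ i : Fin (n - 1), w s (lo i) < w s (hi i) := by
    intro i
    by_contra hle
    have hne : w s (lo i) ≠ w s (hi i) := fun he => by
      have := hw s (lo i)
      rw [he, hw s (hi i)] at this
      exact lo_ne_hi i (s.2.injective this.symm)
    have hlt : w s (hi i) < w s (lo i) := lt_of_le_of_ne (not_lt.mp hle) hne.symm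
    -- At a descent of `w s` the two boxes are incomparable: `t'` excludes one order, `s` the other.
    have hstd : IsStandard l (s.1 ∘ Equiv.swap (lo i) (hi i)) := by
      rw [s.2.swap_iff]
      rintro ⟨hc, h | h⟩
      · exact not_lt.mpr (t'.2.2 (w s (lo i)) (w s (hi i)) (by rw [hw, hw, hc])
          (by rw [hw, hw]; exact h)) hlt
      · exact s.2.not_snd_le (lo_lt_hi i) hc h
    have hw' : ∀ j, w ⟨_, hstd⟩ j = w s (Equiv.swap (lo i) (hi i) j) := fun j =>
      t'.2.injective ((hw ⟨_, hstd⟩ j).trans (hw s _).symm)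
    have h1 := hmax ⟨⟨_, hstd⟩, hP s i hstd hs⟩
    simp only [hw'] at h1
    rw [← Equiv.sum_comp (Equiv.swap (lo i) (hi i))] at h1
    simp only [Equiv.swap_apply_self] at h1
    rw [← sub_nonpos, ← Finset.sum_sub_distrib, Fintype.sum_eq_add (lo i) (hi i) (lo_ne_hi i)] at h1
    · rw [Equiv.swap_apply_left, Equiv.swap_apply_right] at h1
      have e1 : ((lo i : ℕ) : ℤ) = i := rfl
      have e2 : ((hi i : ℕ) : ℤ) = i + 1 := rfl
      rw [e1, e2] at h1
      have h3 : ((w s (hi i) : ℕ) : ℤ) < (w s (lo i) : ℕ) := by exact_mod_cast hlt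
      linarith
    · rintro x ⟨h3, h4⟩
      rw [Equiv.swap_apply_of_ne_of_ne h3 h4, sub_self]
  have hmono : StrictMono (w s) := by
    cases n with
    | zero => exact fun a => a.elim0
    | succ n => exact Fin.strictMono_iff_lt_succ.mpr hstep
  have hid : ∀ j, w s j = j := fun j => le_antisymm (hmono.apply_le) (hmono.le_apply)
  have : t' = s := Subtype.ext (funext fun j => by rw [← hw s j, hid])
  rw [this]
  exact hs

end Tableaux

/-! ### Quadratic, braid and Jucys–Murphy relations of the operators -/

section Operators

variable {K : Type*} [Field K] {n : ℕ} (α : K) (l : DoublePartition n)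

open Classical in
/-- The basis vector of `pos` if `pos` is a standard double-tableau of shape `l`, and `0`
otherwise. -/
def vec (K : Type*) [Field K] (l : DoublePartition n) (pos : Fin n → Bool × ℕ × ℕ) : V K l :=
  if h : IsStandard l pos then Finsupp.single ⟨pos, h⟩ 1 else 0

variable {l} in
theorem vec_coe (t : StdTab l) : vec K l t.1 = Finsupp.single t 1 := dif_pos t.2

variable {l} in
theorem vec_of_not {pos : Fin n → Bool × ℕ × ℕ} (h : ¬ IsStandard l pos) : vec K l pos = 0 :=
  dif_neg h

variable {l} in
theorem linearMap_ext_vec {M : Type*} [AddCommMonoid M] [Module K M] {f g : V K l →ₗ[K] M}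
    (h : ∀ pos, IsStandard l pos → f (vec K l pos) = g (vec K l pos)) : f = g := by
  refine Finsupp.lhom_ext' fun t => LinearMap.ext_ring ?_
  simpa [vec_coe] using h t.1 t.2

/-- The diagonal coefficient of `S_i`, in terms of the boxes of `i` and `i + 1`. -/
def mb (b b' : Bool × ℕ × ℕ) : K := (α - 1) / (1 - ctb α b / ctb α b')

open Classical in
/-- The off-diagonal coefficient of `S_i`, in terms of the boxes of `i` and `i + 1`. -/
def gb (b b' : Bool × ℕ × ℕ) : K := if Comparable b b' then 0 else 1 + mb α b b'

/-- The formula holds for arbitrary `pos`: nonstandard fillings have `vec = 0`, and `gb` vanishes on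
comparable boxes. Relations can then be checked by expanding without splitting according to
standardness. -/
theorem opS_vec (i : Fin (n - 1)) (pos : Fin n → Bool × ℕ × ℕ) :
    opS α 1 l i (vec K l pos) = mb α (pos (lo i)) (pos (hi i)) • vec K l pos +
      gb α (pos (lo i)) (pos (hi i)) • vec K l (pos ∘ Equiv.swap (lo i) (hi i)) := by
  by_cases h : IsStandard l pos
  · obtain ⟨t, rfl⟩ : ∃ t : StdTab l, t.1 = pos := ⟨⟨pos, h⟩, rfl⟩
    have hm : m α 1 i t = mb α (t.1 (lo i)) (t.1 (hi i)) := by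
      simp [m, mb, ct_eq_ctb]
    rw [vec_coe, opS, Finsupp.linearCombination_single, one_smul, hm]
    congr 1
    have hx : (exch i t : V K l) = vec K l (t.1 ∘ Equiv.swap (lo i) (hi i)) := rfl
    rw [hx, gb]
    split_ifs with hc
    · rw [vec_of_not (by rw [h.swap_iff]; exact not_not.mpr hc), smul_zero, smul_zero]
    · rfl
  · rw [vec_of_not h, map_zero, smul_zero, zero_add]
    by_cases h' : IsStandard l (pos ∘ Equiv.swap (lo i) (hi i))
    · have hc : Comparable (pos (lo i)) (pos (hi i)) := by
        by_contra hc
        refine h ?_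
        have := (h'.swap_iff i).mpr (fun hc' => hc (by simpa using hc'.symm))
        simpa [Function.comp_assoc, ← Equiv.coe_trans] using this
      rw [gb, if_pos hc, zero_smul]
    · rw [vec_of_not h', smul_zero]

/-- The diagonal operator that multiplies a tableau by the content of `j`. -/
def opD (j : Fin n) : V K l →ₗ[K] V K l :=
  Finsupp.linearCombination K fun t => ctb α (t.1 j) • Finsupp.single t 1

theorem opD_vec (j : Fin n) (pos : Fin n → Bool × ℕ × ℕ) :
    opD α l j (vec K l pos) = ctb α (pos j) • vec K l pos := by
  by_cases h : IsStandard l pos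
  · obtain ⟨t, rfl⟩ : ∃ t : StdTab l, t.1 = pos := ⟨⟨pos, h⟩, rfl⟩
    rw [vec_coe, opD, Finsupp.linearCombination_single, one_smul]
  · rw [vec_of_not h, map_zero, smul_zero]

/-- The entry `0` sits in a corner, where the content exponent is 0 and only the sign of the
component remains. -/
theorem opT_eq_opD (hn : 0 < n) : opT (1 : K) hn l = opD α l ⟨0, hn⟩ := by
  refine Finsupp.lhom_ext' fun t => LinearMap.ext_ring ?_
  simp only [LinearMap.comp_apply, Finsupp.lsingle_apply, opT, opD,
    Finsupp.linearCombination_single]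
  rw [t.2.ctb_zero hn]

variable {α}

theorem mb_add_mb {b b' : Bool × ℕ × ℕ} (h0 : α ≠ 0) (h : ctb α b ≠ ctb α b') :
    mb α b b' + mb α b' b = α - 1 := by
  have h1 := ctb_ne_zero h0 b
  have h2 := ctb_ne_zero h0 b'
  have h3 : ctb α b' - ctb α b ≠ 0 := sub_ne_zero.mpr h.symm
  have h4 : ctb α b - ctb α b' ≠ 0 := sub_ne_zero.mpr h
  have e1 : mb α b b' = (α - 1) * ctb α b' / (ctb α b' - ctb α b) := by
    unfold mb; field_simp
  have e2 : mb α b' b = -((α - 1) * ctb α b / (ctb α b' - ctb α b)) := by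
    unfold mb
    rw [← neg_sub (ctb α b) (ctb α b')]
    field_simp
  rw [e1, e2]
  field_simp
  ring

theorem mb_eq {b b' : Bool × ℕ × ℕ} (h0 : α ≠ 0) (h : ctb α b ≠ ctb α b') :
    mb α b b' * (ctb α b' - ctb α b) = (α - 1) * ctb α b' := by
  have h2 := ctb_ne_zero h0 b'
  have h3 : ctb α b' - ctb α b ≠ 0 := sub_ne_zero.mpr h.symm
  unfold mb
  field_simp

theorem one_add_mb_eq {b b' : Bool × ℕ × ℕ} (h0 : α ≠ 0) (h : ctb α b ≠ ctb α b') :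
    (1 + mb α b b') * (ctb α b' - ctb α b) = α * ctb α b' - ctb α b := by
  linear_combination mb_eq h0 h

variable {l} {pos : Fin n → Bool × ℕ × ℕ}

/-- If the boxes are comparable, their values have ratio `α` or `α⁻¹`, so one of the factors `1 +
mb` vanishes and the right side is 0 like the left. The truncation in `gb` is thus invisible in this
product. -/
theorem gb_mul_gb (h : IsStandard l pos) (h2 : (2 : K) ≠ 0) (hα : 2 * n < orderOf α) {i k : Fin n}
    (hik : (i : ℕ) + 1 = k) :
    gb α (pos i) (pos k) * gb α (pos k) (pos i) =
      (1 + mb α (pos i) (pos k)) * (1 + mb α (pos k) (pos i)) := by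
  have h0 := ne_zero_of_orderOf hα
  have hne := h.ctb_ne h2 hα (i := i) (k := k) (by rw [Fin.lt_def]; omega) (by omega)
  by_cases hc : Comparable (pos i) (pos k)
  · rw [gb, if_pos hc, zero_mul]
    have e1 := one_add_mb_eq h0 hne
    have e2 := one_add_mb_eq h0 hne.symm
    rcases h.ctb_of_comparable h0 hik hc with h1 | h1
    · rw [← h1, sub_self] at e1
      rw [(mul_eq_zero.mp e1).resolve_right (sub_ne_zero.mpr hne.symm), zero_mul]
    · rw [← h1, sub_self] at e2
      rw [(mul_eq_zero.mp e2).resolve_right (sub_ne_zero.mpr hne), mul_zero]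
  · rw [gb, if_neg hc, gb, if_neg fun h => hc h.symm]

/-- `1 + mb` vanishes only if the values have ratio `α`. Then the boxes lie on neighbouring
diagonals of one component, so they are comparable and the exchange is not standard. -/
theorem gb_ne_zero (h : IsStandard l pos) (h2 : (2 : K) ≠ 0) (hα : 2 * n < orderOf α)
    {i : Fin (n - 1)} (hi' : IsStandard l (pos ∘ Equiv.swap (lo i) (hi i))) :
    gb α (pos (lo i)) (pos (hi i)) ≠ 0 := by
  have h0 := ne_zero_of_orderOf hα
  have hne := h.ctb_ne h2 hα (lo_lt_hi i) (by simp [lo, hi])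
  have hc := (h.swap_iff i).mp hi'
  rw [gb, if_neg hc]
  intro hz
  have e1 := one_add_mb_eq h0 hne
  rw [hz, zero_mul] at e1
  exact hc (h.comparable_of_ctb h2 hα (by linear_combination e1))

theorem swap_swap_comp (pos : Fin n → Bool × ℕ × ℕ) (x y : Fin n) :
    (pos ∘ Equiv.swap x y) ∘ Equiv.swap x y = pos := by
  funext j
  simp

variable (l)

theorem opS_mul_self (h2 : (2 : K) ≠ 0) (hα : 2 * n < orderOf α) (i : Fin (n - 1)) :
    (opS α 1 l i : Module.End K (V K l)) * opS α 1 l i = (α - 1) • opS α 1 l i + α • 1 := by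
  have h0 := ne_zero_of_orderOf hα
  refine linearMap_ext_vec fun pos h => ?_
  have hne := h.ctb_ne h2 hα (lo_lt_hi i) (by simp [lo, hi])
  have hm := mb_add_mb h0 hne
  have hg := gb_mul_gb h h2 hα (i := lo i) (k := hi i) rfl
  simp only [Module.End.mul_apply, LinearMap.add_apply, LinearMap.smul_apply, Module.End.one_apply,
    opS_vec, map_add, map_smul, swap_swap_comp, Function.comp_apply, Equiv.swap_apply_left,
    Equiv.swap_apply_right]
  set m1 := mb α (pos (lo i)) (pos (hi i))
  set m2 := mb α (pos (hi i)) (pos (lo i))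
  set g1 := gb α (pos (lo i)) (pos (hi i))
  set g2 := gb α (pos (hi i)) (pos (lo i))
  -- The claim concerns the block of `pos` and its exchange; `e1` is the diagonal entry, and the
  -- off-diagonal one is the trace relation `hm`.
  have e1 : m1 * m1 + g1 * g2 = (α - 1) * m1 + α := by linear_combination hg + (1 + m1) * hm
  linear_combination (norm := module) e1 • vec K l pos +
    (g1 * hm) • vec K l (pos ∘ Equiv.swap (lo i) (hi i))

/-- The recursion of Jucys–Murphy elements: it turns words in the generators into diagonal
operators. -/
theorem opS_mul_opD_mul_opS (h2 : (2 : K) ≠ 0) (hα : 2 * n < orderOf α) (i : Fin (n - 1)) :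
    (opS α 1 l i : Module.End K (V K l)) * opD α l (lo i) * opS α 1 l i = α • opD α l (hi i) := by
  have h0 := ne_zero_of_orderOf hα
  refine linearMap_ext_vec fun pos h => ?_
  have hne := h.ctb_ne h2 hα (lo_lt_hi i) (by simp [lo, hi])
  have hm := mb_add_mb h0 hne
  have hg := gb_mul_gb h h2 hα (i := lo i) (k := hi i) rfl
  simp only [Module.End.mul_apply, LinearMap.smul_apply, opD_vec,
    opS_vec, map_add, map_smul, swap_swap_comp, Function.comp_apply, Equiv.swap_apply_left,
    Equiv.swap_apply_right]
  have e3 := mb_eq h0 hne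
  set m1 := mb α (pos (lo i)) (pos (hi i))
  set m2 := mb α (pos (hi i)) (pos (lo i))
  set g1 := gb α (pos (lo i)) (pos (hi i))
  set g2 := gb α (pos (hi i)) (pos (lo i))
  set a := ctb α (pos (lo i))
  set b := ctb α (pos (hi i))
  have e1 : m1 * a * m1 + g1 * b * g2 = α * b := by
    linear_combination b * hg - m1 * e3 + (1 + m1) * b * hm
  have e2 : m1 * a + b * m2 = 0 := by linear_combination -e3 + b * hm
  linear_combination (norm := module) e1 • vec K l pos +
    (g1 * e2) • vec K l (pos ∘ Equiv.swap (lo i) (hi i))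

theorem opS_mul_opD_comm (i : Fin (n - 1)) {j : Fin n} (h1 : j ≠ lo i) (h2 : j ≠ hi i) :
    (opS α 1 l i : Module.End K (V K l)) * opD α l j = opD α l j * opS α 1 l i := by
  refine linearMap_ext_vec fun pos h => ?_
  simp only [Module.End.mul_apply, opD_vec, opS_vec, map_add, map_smul, Function.comp_apply,
    Equiv.swap_apply_of_ne_of_ne h1 h2]
  module

theorem opD_mul_comm (j k : Fin n) :
    (opD α l j : Module.End K (V K l)) * opD α l k = opD α l k * opD α l j := by
  refine linearMap_ext_vec fun pos h => ?_
  simp only [Module.End.mul_apply, opD_vec, map_smul]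
  module

theorem opS_comm {i j : Fin (n - 1)} (hij : (i : ℕ) + 1 < j) :
    (opS α 1 l i : Module.End K (V K l)) * opS α 1 l j = opS α 1 l j * opS α 1 l i := by
  have n1 : lo i ≠ lo j := by simp [lo, Fin.ext_iff]; omega
  have n2 : lo i ≠ hi j := by simp [lo, hi, Fin.ext_iff]; omega
  have n3 : hi i ≠ lo j := by simp [lo, hi, Fin.ext_iff]; omega
  have n4 : hi i ≠ hi j := by simp [hi, Fin.ext_iff]; omega
  refine linearMap_ext_vec fun pos h => ?_
  simp only [Module.End.mul_apply, opS_vec, map_add, map_smul, Function.comp_apply,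
    Equiv.swap_apply_of_ne_of_ne n1 n2, Equiv.swap_apply_of_ne_of_ne n3 n4,
    Equiv.swap_apply_of_ne_of_ne n1.symm n3.symm, Equiv.swap_apply_of_ne_of_ne n2.symm n4.symm]
  have hs : (pos ∘ Equiv.swap (lo j) (hi j)) ∘ Equiv.swap (lo i) (hi i) =
      (pos ∘ Equiv.swap (lo i) (hi i)) ∘ Equiv.swap (lo j) (hi j) := by
    have hd : Equiv.swap (lo i) (hi i) * Equiv.swap (lo j) (hi j) =
        Equiv.swap (lo j) (hi j) * Equiv.swap (lo i) (hi i) := by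
      refine Equiv.Perm.Disjoint.commute ?_
      intro x
      by_cases hx : x = lo i ∨ x = hi i
      · right
        rcases hx with rfl | rfl
        · exact Equiv.swap_apply_of_ne_of_ne n1 n2
        · exact Equiv.swap_apply_of_ne_of_ne n3 n4
      · left
        push Not at hx
        exact Equiv.swap_apply_of_ne_of_ne hx.1 hx.2
    funext x
    exact congrArg pos (DFunLike.congr_fun hd x).symm
  rw [hs]
  module

/-- A partial fraction identity in three contents, the Yang–Baxter equation behind the braid
relation. -/
theorem mb_braid {a b c : Bool × ℕ × ℕ} (h0 : α ≠ 0) (hab : ctb α a ≠ ctb α b)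
    (hbc : ctb α b ≠ ctb α c) (hac : ctb α a ≠ ctb α c) :
    mb α a b * mb α b c + mb α a c * mb α b a = mb α b c * mb α a c := by
  have n1 := sub_ne_zero.mpr hab.symm
  have n2 := sub_ne_zero.mpr hbc.symm
  have n3 := sub_ne_zero.mpr hac.symm
  have e1 := mb_eq h0 hab
  have e1' := mb_eq h0 hab.symm
  have e2 := mb_eq h0 hbc
  have e3 := mb_eq h0 hac
  have e1 : mb α a b = _ := eq_div_of_mul_eq n1 e1
  have e1' : mb α b a = _ := eq_div_of_mul_eq (sub_ne_zero.mpr hab) e1'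
  have e2 : mb α b c = _ := eq_div_of_mul_eq n2 e2
  have e3 : mb α a c = _ := eq_div_of_mul_eq n3 e3
  rw [e1, e1', e2, e3, ← neg_sub (ctb α b) (ctb α a), div_neg]
  field_simp
  ring

theorem opS_braid (h2 : (2 : K) ≠ 0) (hα : 2 * n < orderOf α) {i j : Fin (n - 1)}
    (hij : (i : ℕ) + 1 = j) :
    (opS α 1 l i : Module.End K (V K l)) * opS α 1 l j * opS α 1 l i =
      opS α 1 l j * opS α 1 l i * opS α 1 l j := by
  have h0 := ne_zero_of_orderOf hα
  refine linearMap_ext_vec fun pos h => ?_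
  have hbj : lo j = hi i := Fin.ext hij.symm
  have fS := opS_vec α l i
  have fT := opS_vec α l j
  rw [hbj] at fT
  have lt1 : lo i < hi i := lo_lt_hi i
  have lt2 : hi i < hi j := by rw [← hbj]; exact lo_lt_hi j
  have v1 : (hi i : ℕ) = lo i + 1 := rfl
  have v2 : (hi j : ℕ) = lo i + 2 := by simp [hi, lo, ← hij]
  generalize opS α 1 l i = S at *
  generalize opS α 1 l j = T at *
  generalize lo i = a at *
  generalize hi i = b at *
  generalize hi j = c at *
  have hab := lt1.ne
  have hbc := lt2.ne
  have hac := (lt1.trans lt2).ne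
  have cab := h.ctb_ne h2 hα lt1 (by omega)
  have cbc := h.ctb_ne h2 hα lt2 (by omega)
  have cac := h.ctb_ne h2 hα (lt1.trans lt2) (by omega)
  have sa : Equiv.swap b c a = a := Equiv.swap_apply_of_ne_of_ne hab hac
  have sc : Equiv.swap a b c = c := Equiv.swap_apply_of_ne_of_ne hac.symm hbc.symm
  have f0 : ((pos ∘ Equiv.swap b c) ∘ Equiv.swap a b) ∘ Equiv.swap b c =
      ((pos ∘ Equiv.swap a b) ∘ Equiv.swap b c) ∘ Equiv.swap a b := by
    have e1 := Equiv.swap_mul_swap_mul_swap (x := a) (y := b) (z := c) hab hac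
    have e2 := Equiv.swap_mul_swap_mul_swap (x := c) (y := b) (z := a) hbc.symm hac.symm
    rw [Equiv.swap_comm c b, Equiv.swap_comm b a, Equiv.swap_comm a c] at e2
    have e3 := e1.trans e2.symm
    funext x
    exact congrArg pos (DFunLike.congr_fun e3 x)
  simp only [Module.End.mul_apply, fS, fT, map_add, map_smul, swap_swap_comp,
    Function.comp_apply, Equiv.swap_apply_left, Equiv.swap_apply_right, sa, sc, f0]
  have g1 := gb_mul_gb h h2 hα (i := a) (k := b) v1.symm
  have g2 := gb_mul_gb h h2 hα (i := b) (k := c) (by omega)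
  have m1 := mb_add_mb h0 cab
  have m2 := mb_add_mb h0 cbc
  have b1 := mb_braid h0 cab cbc cac
  generalize pos a = A at *
  generalize pos b = B at *
  generalize pos c = C at *
  have c1 : mb α A B * mb α A C = mb α B C * mb α A B + mb α A C * mb α C B := by
    linear_combination -b1 + mb α A C * m1 - mb α A C * m2
  have c0 : mb α A B * mb α A B * mb α B C + gb α A B * gb α B A * mb α A C =
      mb α B C * mb α B C * mb α A B + gb α B C * gb α C B * mb α A C := by
    rw [g1, g2]
    have x1 : mb α B A = α - 1 - mb α A B := by linear_combination m1
    have x2 : mb α C B = α - 1 - mb α B C := by linear_combination m2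
    rw [x1] at b1 ⊢
    rw [x2]
    linear_combination (mb α A B - mb α B C) * b1
  -- Of the six rearrangements of three entries, only the identity and the two simple exchanges need
  -- an identity between coefficients; for the other three both sides agree term by term.
  linear_combination (norm := module) c0 • vec K l pos +
    (gb α A B * b1) • vec K l (pos ∘ Equiv.swap a b) +
    (gb α B C * c1) • vec K l (pos ∘ Equiv.swap b c)

end Operators

/-! ### The representations of the Artin group -/

section ArtinGroup

variable {n : ℕ}

theorem gen_s_braid {i j : Fin (n - 1)} (hij : (i : ℕ) + 1 = j) :
    (gen (.s i) : ArtinD n) * gen (.s j) * gen (.s i) = gen (.s j) * gen (.s i) * gen (.s j) := by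
  have : PresentedGroup.mk (artinRels n) _ = 1 := PresentedGroup.one_of_mem (rels := artinRels n)
    (Or.inl (Or.inl (Or.inl ⟨i, j, hij, rfl⟩)))
  rw [map_mul, map_inv, mul_inv_eq_one] at this
  exact this

theorem gen_u_braid {i : Fin (n - 1)} (hi : (i : ℕ) = 1) :
    (gen .u : ArtinD n) * gen (.s i) * gen .u = gen (.s i) * gen .u * gen (.s i) := by
  have : PresentedGroup.mk (artinRels n) _ = 1 := PresentedGroup.one_of_mem (rels := artinRels n)
    (Or.inl (Or.inr ⟨i, hi, rfl⟩))
  rw [map_mul, map_inv, mul_inv_eq_one] at this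
  exact this

theorem closure_gen : Subgroup.closure (Set.range (gen : ArtinGen n → ArtinD n)) = ⊤ :=
  PresentedGroup.closure_range_of _

theorem abelianization_eq_of_braid {G : Type*} [Group G] {a b : G} (h : a * b * a = b * a * b) :
    Abelianization.of a = Abelianization.of b := by
  have := congrArg Abelianization.of h
  simp only [map_mul] at this
  rw [mul_comm (Abelianization.of b) (Abelianization.of a)] at this
  exact mul_left_cancel this

/-- The generators of the Artin group agree modulo its derived subgroup. -/
theorem gen_mul_inv_mem (hn : 4 ≤ n) (x y : ArtinGen n) :
    gen x * (gen y)⁻¹ ∈ commutator (ArtinD n) := by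
  have hs : ∀ (k : ℕ) (hk : k < n - 1), Abelianization.of (gen (.s ⟨k, hk⟩) : ArtinD n) =
      Abelianization.of (gen .u) := by
    have h1 : Abelianization.of (gen (.s ⟨1, by omega⟩) : ArtinD n) =
        Abelianization.of (gen .u) :=
      (abelianization_eq_of_braid (gen_u_braid (i := ⟨1, by omega⟩) rfl)).symm
    have hstep : ∀ (k : ℕ) (hk : k + 1 < n - 1),
        Abelianization.of (gen (.s ⟨k, by omega⟩) : ArtinD n) =
          Abelianization.of (gen (.s ⟨k + 1, hk⟩)) := fun k hk =>
      abelianization_eq_of_braid (gen_s_braid (i := ⟨k, by omega⟩) (j := ⟨k + 1, hk⟩) rfl)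
    intro k
    induction k with
    | zero => exact fun hk => (hstep 0 (by omega)).trans h1
    | succ k ih => exact fun hk => (hstep k hk).symm.trans (ih (by omega))
  have hall : ∀ x : ArtinGen n, Abelianization.of (gen x : ArtinD n) =
      Abelianization.of (gen .u) := by
    rintro (_ | ⟨k, hk⟩)
    · rfl
    · exact hs k hk
  rw [← Abelianization.ker_of, MonoidHom.mem_ker, map_mul, map_inv, hall x, hall y,
    mul_inv_cancel]

/-- The elements `u s₁`, `s₂ u s₁ s₂`, …, whose images are diagonal. -/
def diagElem (hn : 1 < n) : ℕ → ArtinD n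
  | 0 => gen .u * gen (.s ⟨0, by omega⟩)
  | k + 1 => if h : k + 1 < n - 1 then gen (.s ⟨k + 1, h⟩) * diagElem hn k * gen (.s ⟨k + 1, h⟩)
      else 1

end ArtinGroup

/-! ### Conjugating Hecke relations by an involution -/

section Quadratic

variable {K A : Type*} [Field K] [Semiring A] [Algebra K A]

/-- An element with `x² = (q - 1) x + q` is invertible. -/
def unitOfQuadratic {q : K} (hq : q ≠ 0) (x : A) (h : x * x = (q - 1) • x + q • (1 : A)) : Aˣ where
  val := x
  inv := q⁻¹ • x + (-(q⁻¹ * (q - 1))) • (1 : A)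
  val_inv := by
    rw [mul_add, mul_smul_comm, mul_smul_comm, h, mul_one, smul_add, smul_smul, smul_smul,
      add_right_comm, ← add_smul, add_neg_cancel, zero_smul, zero_add, inv_mul_cancel₀ hq, one_smul]
  inv_val := by
    rw [add_mul, smul_mul_assoc, smul_mul_assoc, h, one_mul, smul_add, smul_smul, smul_smul,
      add_right_comm, ← add_smul, add_neg_cancel, zero_smul, zero_add, inv_mul_cancel₀ hq, one_smul]

theorem quadratic_conj {q : K} {T S : A} (hT : T * T = 1)
    (hS : S * S = (q - 1) • S + q • (1 : A)) :
    T * S * T * (T * S * T) = (q - 1) • (T * S * T) + q • (1 : A) := by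
  calc T * S * T * (T * S * T) = T * S * (T * T) * S * T := by simp only [mul_assoc]
    _ = T * (S * S) * T := by rw [hT, mul_one, mul_assoc T S S]
    _ = (q - 1) • (T * S * T) + q • (T * T) := by
      rw [hS, mul_add, add_mul, mul_smul_comm, smul_mul_assoc, mul_smul_comm, smul_mul_assoc,
        mul_one]
    _ = _ := by rw [hT]

/-- This is the braid relation of `S` and `S'` conjugated by the involution `T`, which fixes `S'`.
-/
theorem braid_conj {A : Type*} [Monoid A] {T S S' : A} (hT : T * T = 1)
    (hS : S * S' * S = S' * S * S') (hTS : S' * T = T * S') :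
    T * S * T * S' * (T * S * T) = S' * (T * S * T) * S' := by
  calc T * S * T * S' * (T * S * T) = T * S * T * (S' * T) * S * T := by simp only [mul_assoc]
    _ = T * S * (T * T) * S' * S * T := by rw [hTS]; simp only [mul_assoc]
    _ = T * (S * S' * S) * T := by rw [hT]; simp only [mul_assoc, one_mul]
    _ = (T * S') * S * (S' * T) := by rw [hS]; simp only [mul_assoc]
    _ = (S' * T) * S * (T * S') := by rw [hTS]
    _ = S' * (T * S * T) * S' := by simp only [mul_assoc]

theorem comm_conj {A : Type*} [Monoid A] {T S S' : A} (hS : S * S' = S' * S)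
    (hTS : S' * T = T * S') : T * S * T * S' = S' * (T * S * T) := by
  calc T * S * T * S' = T * S * (S' * T) := by rw [hTS, mul_assoc]
    _ = T * (S * S') * T := by simp only [mul_assoc]
    _ = (T * S') * S * T := by rw [hS]; simp only [mul_assoc]
    _ = S' * (T * S * T) := by rw [← hTS]; simp only [mul_assoc]

end Quadratic

/-! ### Construction of the representations and of their diagonal elements -/

section Hoefsmit

variable {K : Type*} [Field K] {n : ℕ} {α : K} (l : DoublePartition n)

theorem opT_mul_self (hn : 0 < n) : (opT (1 : K) hn l : Module.End K (V K l)) * opT 1 hn l = 1 := by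
  rw [opT_eq_opD 1]
  refine linearMap_ext_vec fun pos h => ?_
  simp only [Module.End.mul_apply, opD_vec, map_smul, smul_smul, h.ctb_zero hn,
    Module.End.one_apply]
  split_ifs <;> simp

theorem opU_eq (hn : 1 < n) : (opU α 1 hn l : Module.End K (V K l)) =
    opT 1 (by omega) l * opS α 1 l ⟨0, by omega⟩ * opT 1 (by omega) l := by
  rw [opU, ← LinearMap.comp_assoc, Module.End.mul_eq_comp, Module.End.mul_eq_comp]

/-- Since U S₁ = T (S₁ T S₁) with `T` the first diagonal operator, the recursion applies. The
opposite order gives the same diagonal operator, which proves that u and s₁ commute. -/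
theorem opU_mul_opS (h2 : (2 : K) ≠ 0) (hα : 2 * n < orderOf α) (hn : 1 < n) :
    (opU α 1 hn l : Module.End K (V K l)) * opS α 1 l ⟨0, by omega⟩ =
      α • (opD α l ⟨0, by omega⟩ * opD α l ⟨1, hn⟩) := by
  rw [opU_eq, opT_eq_opD α, mul_assoc, mul_assoc, ← mul_assoc (opS _ _ _ _)]
  have := opS_mul_opD_mul_opS l h2 hα ⟨0, by omega⟩
  rw [show lo (n := n) ⟨0, by omega⟩ = ⟨0, by omega⟩ from rfl,
    show hi (n := n) ⟨0, by omega⟩ = ⟨1, hn⟩ from rfl] at this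
  rw [this, mul_smul_comm]

theorem opS_mul_opU (h2 : (2 : K) ≠ 0) (hα : 2 * n < orderOf α) (hn : 1 < n) :
    (opS α 1 l ⟨0, by omega⟩ : Module.End K (V K l)) * opU α 1 hn l =
      α • (opD α l ⟨0, by omega⟩ * opD α l ⟨1, hn⟩) := by
  rw [opU_eq, opT_eq_opD α, ← mul_assoc, ← mul_assoc]
  have := opS_mul_opD_mul_opS l h2 hα ⟨0, by omega⟩
  rw [show lo (n := n) ⟨0, by omega⟩ = ⟨0, by omega⟩ from rfl,
    show hi (n := n) ⟨0, by omega⟩ = ⟨1, hn⟩ from rfl] at this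
  rw [this, smul_mul_assoc, opD_mul_comm]

theorem opT_opS_comm (hn : 0 < n) {i : Fin (n - 1)} (hi' : (i : ℕ) ≠ 0) :
    (opS α 1 l i : Module.End K (V K l)) * opT 1 hn l = opT 1 hn l * opS α 1 l i := by
  rw [opT_eq_opD α]
  exact opS_mul_opD_comm l i (by simp [lo, Fin.ext_iff]; omega) (by simp [hi, Fin.ext_iff])

/-- The operator attached to a generator of the Artin group. -/
def opGen (α : K) (hn : 1 < n) : ArtinGen n → Module.End K (V K l)
  | .u => opU α 1 hn l
  | .s i => opS α 1 l i

theorem opGen_mul_self (h2 : (2 : K) ≠ 0) (hα : 2 * n < orderOf α) (hn : 1 < n) (x : ArtinGen n) :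
    opGen l α hn x * opGen l α hn x = (α - 1) • opGen l α hn x + α • 1 := by
  cases x with
  | s i => exact opS_mul_self l h2 hα i
  | u =>
    have h := quadratic_conj (A := Module.End K (V K l)) (opT_mul_self l (show 0 < n by omega))
      (opS_mul_self l h2 hα ⟨0, by omega⟩)
    rw [← opU_eq l hn] at h
    exact h

/-- The operator attached to a generator, as an invertible operator. -/
def genUnit (h2 : (2 : K) ≠ 0) (hα : 2 * n < orderOf α) (hn : 1 < n) (x : ArtinGen n) :
    (Module.End K (V K l))ˣ :=
  unitOfQuadratic (ne_zero_of_orderOf hα) (opGen l α hn x) (opGen_mul_self l h2 hα hn x)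

theorem genUnit_rels (h2 : (2 : K) ≠ 0) (hα : 2 * n < orderOf α) (hn : 1 < n) :
    ∀ r ∈ artinRels n, FreeGroup.lift (genUnit l h2 hα hn) r = 1 := by
  rintro r (((⟨i, j, hij, rfl⟩ | ⟨i, j, hij, rfl⟩) | ⟨i, hi', rfl⟩) | ⟨i, hi', rfl⟩)
  all_goals
    simp only [map_mul, map_inv, FreeGroup.lift_apply_of]
    rw [mul_inv_eq_one]
    refine Units.ext ?_
    simp only [Units.val_mul, genUnit, unitOfQuadratic, opGen]
  · exact opS_braid l h2 hα hij
  · exact opS_comm l hij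
  · rw [opU_eq]
    exact braid_conj (A := Module.End K (V K l)) (opT_mul_self l (by omega))
      (opS_braid l h2 hα (i := ⟨0, by omega⟩) (j := i) (by simp [hi']))
      (opT_opS_comm l (by omega) (by rw [hi']; exact one_ne_zero))
  · by_cases h0 : (i : ℕ) = 0
    · have hi0 : i = ⟨0, by omega⟩ := Fin.ext h0
      rw [hi0, opU_mul_opS l h2 hα, opS_mul_opU l h2 hα]
    · rw [opU_eq]
      exact comm_conj (A := Module.End K (V K l))
        (opS_comm l (i := ⟨0, by omega⟩) (j := i) (by simp; omega))
        (opT_opS_comm l (by omega) h0)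

/-- The representation `R_λ` of the Artin group. -/
def hoefsmit (h2 : (2 : K) ≠ 0) (hα : 2 * n < orderOf α) (hn : 1 < n) :
    Representation K (ArtinD n) (V K l) :=
  (Units.coeHom _).comp (PresentedGroup.toGroup (genUnit_rels l h2 hα hn) :
    PresentedGroup (artinRels n) →* (Module.End K (V K l))ˣ)

theorem hoefsmit_gen (h2 : (2 : K) ≠ 0) (hα : 2 * n < orderOf α) (hn : 1 < n) (x : ArtinGen n) :
    hoefsmit l h2 hα hn (gen x) = opGen l α hn x :=
  congrArg Units.val (PresentedGroup.toGroup.of (genUnit_rels l h2 hα hn))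

theorem hoefsmit_diagElem (h2 : (2 : K) ≠ 0) (hα : 2 * n < orderOf α) (hn : 1 < n) (k : ℕ)
    (hk : k + 1 < n) : hoefsmit l h2 hα hn (diagElem hn k) =
      α ^ (k + 1) • (opD α l ⟨0, by omega⟩ * opD α l ⟨k + 1, hk⟩) := by
  induction k with
  | zero =>
    rw [diagElem, map_mul, hoefsmit_gen, hoefsmit_gen, opGen, opGen, opU_mul_opS l h2 hα]
    simp
  | succ k ih =>
    rw [diagElem, dif_pos (by omega), map_mul, map_mul, hoefsmit_gen, opGen, ih (by omega)]
    have h1 := opS_mul_opD_comm (α := α) l (⟨k + 1, by omega⟩ : Fin (n - 1)) (j := ⟨0, by omega⟩)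
      (by simp [lo]) (by simp [hi])
    have h3 := opS_mul_opD_mul_opS l h2 hα (⟨k + 1, by omega⟩ : Fin (n - 1))
    rw [show lo (n := n) ⟨k + 1, by omega⟩ = ⟨k + 1, by omega⟩ from rfl,
      show hi (n := n) ⟨k + 1, by omega⟩ = ⟨k + 1 + 1, hk⟩ from rfl] at h3
    rw [mul_smul_comm, smul_mul_assoc, ← mul_assoc, h1, mul_assoc, mul_assoc,
      ← mul_assoc (opS _ _ _ _),
      h3, mul_smul_comm, smul_smul, ← pow_succ]

theorem hoefsmit_diagElem_vec (h2 : (2 : K) ≠ 0) (hα : 2 * n < orderOf α) (hn : 1 < n) (k : ℕ)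
    (hk : k + 1 < n) (pos : Fin n → Bool × ℕ × ℕ) :
    hoefsmit l h2 hα hn (diagElem hn k) (vec K l pos) =
      (α ^ (k + 1) * (ctb α (pos ⟨0, by omega⟩) * ctb α (pos ⟨k + 1, hk⟩))) • vec K l pos := by
  rw [hoefsmit_diagElem l h2 hα hn k hk]
  simp only [LinearMap.smul_apply, Module.End.mul_apply, opD_vec, map_smul, smul_smul]
  ring_nf

end Hoefsmit

/-! ### Weight bases and irreducibility -/

section WeightBasis

variable {K : Type*} [Field K] {G : Type*} [Group G] {M : Type*} [AddCommGroup M] [Module K M]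
  {ι Y : Type*}

/-- A basis of common eigenvectors of the elements `y j`, with pairwise different systems of
eigenvalues, any two of which are linked by nonzero matrix coefficients. -/
structure IsWeightBasis (ρ : Representation K G M) (y : Y → G) (χ : ι → Y → K)
    (b : Module.Basis ι K M) : Prop where
  apply : ∀ k j, ρ (y j) (b k) = χ k j • b k
  injective : Function.Injective χ
  linked : ∀ k l, Relation.ReflTransGen (fun k l => ∃ g, b.repr (ρ g (b k)) l ≠ 0) k l

variable {ρ : Representation K G M} {y : Y → G} {χ : ι → Y → K} {b : Module.Basis ι K M}

theorem IsWeightBasis.repr_apply (h : IsWeightBasis ρ y χ b) (j : Y) (w : M) (i : ι) :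
    b.repr (ρ (y j) w) i = χ i j * b.repr w i := by
  have : (Finsupp.lapply i ∘ₗ b.repr.toLinearMap) ∘ₗ ρ (y j) =
      χ i j • (Finsupp.lapply i ∘ₗ b.repr.toLinearMap) := by
    refine b.ext fun k => ?_
    simp only [LinearMap.comp_apply, h.apply, map_smul, LinearMap.smul_apply,
      LinearEquiv.coe_coe, Module.Basis.repr_self, Finsupp.lapply_apply, smul_eq_mul]
    by_cases hik : k = i
    · rw [hik]
    · simp [hik]
  exact LinearMap.congr_fun this w

/-- As long as another basis vector `b k` occurs in `w`, an element `y j` separating the weights of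
`k` and `l` lets one pass to `ρ (y j) w - χ k j • w`, which loses `b k` and keeps `b l`. -/
theorem IsWeightBasis.mem_of_repr_ne_zero (h : IsWeightBasis ρ y χ b) {W : Submodule K M}
    (hW : ∀ g, ∀ w ∈ W, ρ g w ∈ W) {w : M} (hw : w ∈ W) {l : ι} (hl : b.repr w l ≠ 0) :
    b l ∈ W := by
  induction hN : (b.repr w).support.card using Nat.strong_induction_on generalizing w with
  | _ N ih =>
  by_cases hk : ∃ k, k ≠ l ∧ b.repr w k ≠ 0
  · obtain ⟨k, hkl, hk⟩ := hk
    obtain ⟨j, hj⟩ : ∃ j, χ k j ≠ χ l j := by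
      by_contra hcon
      push Not at hcon
      exact hkl (h.injective (funext hcon))
    have hrep : ∀ i, b.repr (ρ (y j) w - χ k j • w) i = (χ i j - χ k j) * b.repr w i := by
      intro i
      rw [map_sub, Finsupp.sub_apply, h.repr_apply, map_smul, Finsupp.smul_apply, smul_eq_mul]
      ring
    refine ih _ ?_ (W.sub_mem (hW _ _ hw) (W.smul_mem _ hw)) (w := ρ (y j) w - χ k j • w) ?_ rfl
    · rw [← hN]
      refine Finset.card_lt_card ⟨fun i hi => ?_, fun hsub => ?_⟩
      · rw [Finsupp.mem_support_iff, hrep] at hi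
        exact Finsupp.mem_support_iff.mpr (right_ne_zero_of_mul hi)
      · have := hsub (Finsupp.mem_support_iff.mpr hk)
        rw [Finsupp.mem_support_iff, hrep, sub_self, zero_mul] at this
        exact this rfl
    · rw [hrep]
      exact mul_ne_zero (sub_ne_zero.mpr hj.symm) hl
  · push Not at hk
    have hw' : w = b.repr w l • b l := by
      classical
      apply b.repr.injective
      ext i
      rw [map_smul, Module.Basis.repr_self, Finsupp.smul_apply, Finsupp.single_apply, smul_eq_mul]
      by_cases hi : l = i
      · rw [← hi]; simp
      · rw [hk i (Ne.symm hi)]; simp [hi]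
    rw [hw'] at hw
    exact (W.smul_mem_iff hl).mp hw

theorem IsWeightBasis.eq_top (h : IsWeightBasis ρ y χ b) {W : Submodule K M}
    (hW : ∀ g, ∀ w ∈ W, ρ g w ∈ W) (hne : W ≠ ⊥) : W = ⊤ := by
  obtain ⟨w, hw, hw0⟩ := W.ne_bot_iff.mp hne
  obtain ⟨k, hk⟩ : ∃ k, b.repr w k ≠ 0 := by
    by_contra hcon
    push Not at hcon
    exact hw0 (b.repr.map_eq_zero_iff.mp (Finsupp.ext hcon))
  have hbk := h.mem_of_repr_ne_zero hW hw hk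
  rw [eq_top_iff, ← b.span_eq, Submodule.span_le]
  rintro _ ⟨l, rfl⟩
  refine Relation.ReflTransGen.rec (motive := fun l _ => b l ∈ W) hbk ?_ (h.linked k l)
  rintro l l' - ⟨g, hg⟩ hl
  exact h.mem_of_repr_ne_zero hW (hW g _ hl) hg

theorem extend_tmul {L : Type*} [Field L] [Algebra K L] (g : G) (c : L) (v : M) :
    extend L ρ g (c ⊗ₜ v) = c ⊗ₜ ρ g v := by
  exact LinearMap.baseChange_tmul _ _ _

/-- Distinct weights and nonzero coefficients survive the injective map of scalars; irreducibility
becomes absolute for this reason. -/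
theorem IsWeightBasis.extend {L : Type*} [Field L] [Algebra K L] (h : IsWeightBasis ρ y χ b) :
    IsWeightBasis (extend L ρ) y (fun k j => algebraMap K L (χ k j)) (b.baseChange L) where
  apply k j := by
    rw [Module.Basis.baseChange_apply, extend_tmul, h.apply, TensorProduct.tmul_smul,
      algebraMap_smul]
  injective k l hkl := h.injective (funext fun j => (algebraMap K L).injective (congrFun hkl j))
  linked k l := by
    refine Relation.ReflTransGen.mono ?_ _ _ (h.linked k l)
    rintro k l ⟨g, hg⟩
    refine ⟨g, ?_⟩
    rw [Module.Basis.baseChange_apply, extend_tmul, Module.Basis.baseChange_repr_tmul]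
    rw [Algebra.smul_def, mul_one]
    exact (map_ne_zero _).mpr hg

/-- If a vector of the weight basis has a nonzero image under an intertwiner, its weight occurs in
the target. -/
theorem IsWeightBasis.exists_weight_eq {M' ι' : Type*} [AddCommGroup M'] [Module K M']
    {ρ' : Representation K G M'} {χ' : ι' → Y → K} {b' : Module.Basis ι' K M'}
    (h : IsWeightBasis ρ y χ b) (h' : IsWeightBasis ρ' y χ' b') {F : M →ₗ[K] M'}
    (hF : ∀ g v, F (ρ g v) = ρ' g (F v)) {k : ι} {l : ι'} (hl : b'.repr (F (b k)) l ≠ 0) :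
    χ k = χ' l := by
  funext j
  have h1 := h'.repr_apply j (F (b k)) l
  rw [← hF, h.apply, map_smul, map_smul, Finsupp.smul_apply, smul_eq_mul] at h1
  exact mul_right_cancel₀ hl h1

end WeightBasis

/-! ### Irreducibility on the derived subgroup -/

section Hecke

variable {K : Type*} [Field K] {n : ℕ} {M : Type*} [AddCommGroup M] [Module K M]

/-- The generators of the Artin group satisfy the quadratic relation of the Hecke algebra with
parameter `q`. -/
def IsHecke (q : K) (ρ : Representation K (ArtinD n) M) : Prop :=
  ∀ x v, ρ (gen x) (ρ (gen x) v) = (q - 1) • ρ (gen x) v + q • v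

variable {q : K} {ρ : Representation K (ArtinD n) M}

theorem IsHecke.apply_inv (h : IsHecke q ρ) (hq : q ≠ 0) (x : ArtinGen n) (v : M) :
    ρ (gen x)⁻¹ v = q⁻¹ • (ρ (gen x) v - (q - 1) • v) := by
  have := congrArg (ρ (gen x)⁻¹) (h x v)
  simp only [map_add, map_smul, Representation.inv_self_apply] at this
  rw [this, add_sub_cancel_left, smul_smul, inv_mul_cancel₀ hq, one_smul]

/-- By the quadratic relation the inverse of a generator is a linear polynomial in it, so stability
under generators suffices. -/
theorem IsHecke.stable_of_gen (h : IsHecke q ρ) (hq : q ≠ 0) {W : Submodule K M}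
    (hW : ∀ x, ∀ w ∈ W, ρ (gen x) w ∈ W) (g : ArtinD n) : ∀ w ∈ W, ρ g w ∈ W := by
  have hg : g ∈ Subgroup.closure (Set.range (gen : ArtinGen n → ArtinD n)) := by
    rw [closure_gen]; trivial
  induction hg using Subgroup.closure_induction_left with
  | one => simp
  | mul_left x hx g hg ih =>
    obtain ⟨x, rfl⟩ := hx
    intro w hw
    rw [map_mul]
    exact hW x _ (ih w hw)
  | inv_mul_cancel x hx g hg ih =>
    obtain ⟨x, rfl⟩ := hx
    intro w hw
    rw [map_mul, Module.End.mul_apply, h.apply_inv hq]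
    exact W.smul_mem _ (W.sub_mem (hW x _ (ih w hw)) (W.smul_mem _ (ih w hw)))

/-- An irreducible representation of the Hecke algebra remains irreducible on the derived subgroup
of the Artin group. -/
theorem IsHecke.eq_top_of_commutator_stable [FiniteDimensional K M] (h : IsHecke q ρ) (hn : 4 ≤ n)
    (hq : q ≠ 0) (hq1 : q ≠ 1)
    (hirr : ∀ W : Submodule K M, (∀ g, ∀ w ∈ W, ρ g w ∈ W) → W ≠ ⊥ → W = ⊤)
    {W : Submodule K M} (hW : ∀ g ∈ commutator (ArtinD n), ∀ w ∈ W, ρ g w ∈ W) (hne : W ≠ ⊥) :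
    W = ⊤ := by
  classical
  -- A nonzero stable subspace `W0` of least dimension is compared with its image under one
  -- generator `x`.
  let P : ℕ → Prop := fun d => ∃ W : Submodule K M,
    (∀ g ∈ commutator (ArtinD n), ∀ w ∈ W, ρ g w ∈ W) ∧ W ≠ ⊥ ∧ Module.finrank K W = d
  have hP : ∃ d, P d := ⟨_, W, hW, hne, rfl⟩
  obtain ⟨W0, hW0, hne0, hd⟩ := Nat.find_spec hP
  have hmin : ∀ W' : Submodule K M, (∀ g ∈ commutator (ArtinD n), ∀ w ∈ W', ρ g w ∈ W') →
      W' ≠ ⊥ → Module.finrank K W0 ≤ Module.finrank K W' := fun W' h1 h2 => by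
    rw [hd]
    exact Nat.find_min' hP ⟨W', h1, h2, rfl⟩
  suffices htop : W0 = ⊤ by
    refine Submodule.eq_top_of_finrank_eq (le_antisymm (Submodule.finrank_le _) ?_)
    have := hmin W hW hne
    rwa [htop, finrank_top] at this
  set x : ArtinD n := gen .u with hx
  have hcm : ∀ y, gen y * x⁻¹ ∈ commutator (ArtinD n) := fun y => gen_mul_inv_mem hn y .u
  have hnorm : (commutator (ArtinD n)).Normal := inferInstance
  have hcm' : ∀ y, x⁻¹ * gen y ∈ commutator (ArtinD n) := fun y => by
    have := hnorm.conj_mem _ (hcm y) x⁻¹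
    simpa [mul_assoc] using this
  have hxinj : Function.Injective (ρ x) := fun v w hvw => by
    simpa using congrArg (ρ x⁻¹) hvw
  by_cases hcap : W0 ⊓ W0.map (ρ x) = ⊥
  · exfalso
    have hdisj : ∀ v ∈ W0, ∀ w ∈ W0, v = ρ x w → w = 0 := by
      intro v hv w hw hvw
      have : v ∈ W0 ⊓ W0.map (ρ x) := ⟨hv, hvw ▸ Submodule.mem_map_of_mem hw⟩
      rw [hcap, Submodule.mem_bot] at this
      rw [this] at hvw
      exact hxinj (by rw [← hvw, map_zero])
    -- Evaluating y² w in two ways gives an equation between a vector of `W0` and one of `x W0`. As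
    -- these meet trivially, both sides vanish, and `q ≠ 1` gives that `y` acts on `W0` as `x` does.
    have key : ∀ y, ∀ w ∈ W0, ρ (gen y) w = ρ x w ∧ ρ (gen y * x⁻¹) w = w := by
      intro y w hw
      set a := ρ (x⁻¹ * gen y) w with ha
      have haW : a ∈ W0 := hW0 _ (hcm' y) w hw
      have e1 : ρ (gen y) w = ρ x a := by simp [ha]
      set a2 := ρ (x⁻¹ * gen y) a with ha2
      have ha2W : a2 ∈ W0 := hW0 _ (hcm' y) a haW
      have e2 : ρ (gen y) a = ρ x a2 := by simp [ha2]
      set c := ρ (gen y * x⁻¹) a with hc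
      have hcW : c ∈ W0 := hW0 _ (hcm y) a haW
      have e3 : ρ (gen y) (ρ x a) = (q - 1) • ρ x a2 + q • c := by
        have : ρ (gen y) (ρ x a) = ρ (gen y * x⁻¹) (ρ x (ρ x a)) := by simp
        have e4 : ρ (gen y * x⁻¹) (ρ x a) = ρ (gen y) a := by simp
        rw [this, h, map_add, map_smul, map_smul, ← hc, e4, e2]
      have e4 := h y w
      rw [e1, e3] at e4
      have e5 : q • (w - c) = ρ x ((q - 1) • (a2 - a)) := by
        rw [map_smul, map_sub]
        linear_combination (norm := module) -e4
      have e6 := hdisj _ (W0.smul_mem _ (W0.sub_mem hw hcW)) _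
        (W0.smul_mem _ (W0.sub_mem ha2W haW)) e5
      rw [e6, map_zero] at e5
      have e7 : a2 = a := sub_eq_zero.mp ((smul_eq_zero.mp e6).resolve_left (sub_ne_zero.mpr hq1))
      have e8 : w = c := sub_eq_zero.mp ((smul_eq_zero.mp e5).resolve_left hq)
      have e9 : a = w := by
        have := congrArg (ρ (x⁻¹ * gen y)⁻¹) (ha2.symm.trans (e7.trans ha))
        simpa only [Representation.inv_self_apply] using this
      exact ⟨by rw [e1, e9], by rw [e9] at hc; rw [← hc, ← e8]⟩
    obtain ⟨w, hw, hw0⟩ := W0.ne_bot_iff.mp hne0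
    -- This vector lies in the eigenspace of -1 of every generator, so irreducibility makes the
    -- whole space a line, in which `W0` and `x W0` cannot meet trivially.
    set v := ρ x w - q • w with hv
    have hyv : ∀ y, ρ (gen y) v = -v := by
      intro y
      have e1 : ρ (gen y) (ρ x w) = (q - 1) • ρ x w + q • w := by
        have : ρ (gen y) (ρ x w) = ρ (gen y * x⁻¹) (ρ x (ρ x w)) := by simp
        have e4 : ρ (gen y * x⁻¹) (ρ x w) = ρ (gen y) w := by simp
        rw [this, h, map_add, map_smul, map_smul, (key y w hw).2, e4, (key y w hw).1]
      rw [hv, map_sub, map_smul, e1, (key y w hw).1]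
      module
    have hspan : K ∙ v = ⊤ := by
      refine hirr _ (h.stable_of_gen hq fun y z hz => ?_) ?_
      · obtain ⟨c, rfl⟩ := Submodule.mem_span_singleton.mp hz
        rw [map_smul, hyv]
        exact Submodule.smul_mem _ _ (Submodule.neg_mem _ (Submodule.mem_span_singleton_self v))
      · rw [Ne, Submodule.span_singleton_eq_bot]
        intro hv0
        refine hw0 (hdisj (q • w) (W0.smul_mem _ hw) w hw ?_)
        rw [hv, sub_eq_zero] at hv0
        exact hv0.symm
    have hwv : w ∈ K ∙ v := by rw [hspan]; trivial
    obtain ⟨c, hc⟩ := Submodule.mem_span_singleton.mp hwv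
    have e1 : w + (c * q) • w = ρ x (c • w) := by
      rw [map_smul]
      rw [hv] at hc
      linear_combination (norm := module) -hc
    have e2 := hdisj _ (W0.add_mem hw (W0.smul_mem _ hw)) _ (W0.smul_mem _ hw) e1
    have e3 : c = 0 := (smul_eq_zero.mp e2).resolve_right hw0
    rw [e3, zero_smul] at hc
    exact hw0 hc.symm
  -- The intersection is stable because the derived subgroup is normal; by minimality it is `W0`,
  -- which is therefore stable under `x` and so under all generators.
  · have hstab : ∀ g ∈ commutator (ArtinD n), ∀ w ∈ W0 ⊓ W0.map (ρ x),
        ρ g w ∈ W0 ⊓ W0.map (ρ x) := by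
      rintro g hg _ ⟨h1, v, hv, rfl⟩
      refine ⟨hW0 g hg _ h1, ρ (x⁻¹ * g * x) v, hW0 _ ?_ v hv, by simp⟩
      have := hnorm.conj_mem g hg x⁻¹
      simpa using this
    have h1 := hmin _ hstab hcap
    have h2 : W0 ⊓ W0.map (ρ x) = W0 := Submodule.eq_of_le_of_finrank_le inf_le_left h1
    have h3 : W0 = W0.map (ρ x) := by
      refine Submodule.eq_of_le_of_finrank_le (inf_eq_left.mp h2) ?_
      exact Submodule.finrank_map_le _ _
    refine hirr W0 (h.stable_of_gen hq fun y w hw => ?_) hne0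
    have : ρ (gen y) w = ρ (gen y * x⁻¹) (ρ x w) := by simp
    rw [this]
    refine hW0 _ (hcm y) _ ?_
    rw [h3]
    exact Submodule.mem_map_of_mem hw

theorem IsHecke.extend {L : Type*} [Field L] [Algebra K L] (h : IsHecke q ρ) :
    IsHecke (algebraMap K L q) (extend L ρ) := by
  intro x v
  induction v with
  | zero => simp
  | add v w hv hw =>
    simp only [map_add, hv, hw, smul_add]
    abel
  | tmul c v =>
    rw [extend_tmul, extend_tmul, h, TensorProduct.tmul_add, TensorProduct.tmul_smul,
      TensorProduct.tmul_smul]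
    rw [← map_one (algebraMap K L), ← map_sub, algebraMap_smul, algebraMap_smul]

variable {ι Y : Type*} {y : Y → ArtinD n} {χ : ι → Y → K} {b : Module.Basis ι K M}

theorem IsWeightBasis.isAbsolutelyIrreducible [Finite ι] [Nonempty ι]
    (hb : IsWeightBasis ρ y χ b) (h : IsHecke q ρ) (hn : 4 ≤ n) (hq : q ≠ 0) (hq1 : q ≠ 1) :
    IsAbsolutelyIrreducible (res ρ) := by
  have : FiniteDimensional K M := b.finiteDimensional_of_finite
  have hirr := fun W hW hne => (hb.extend (L := AlgebraicClosure K)).eq_top (W := W) hW hne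
  have hnt : Nontrivial M := ⟨b (Classical.arbitrary ι), 0, b.ne_zero _⟩
  have key := fun W hW hne => (h.extend (L := AlgebraicClosure K)).eq_top_of_commutator_stable hn
    (by simpa using hq) (fun h1 => hq1 (by simpa using h1))
    hirr (W := W) hW hne
  refine { exists_pair_ne := ⟨⊥, ⊤, fun hbt => ?_⟩, eq_bot_or_eq_top := fun W => ?_ }
  · have := congrArg Subrepresentation.toSubmodule hbt
    exact bot_ne_top (α := Submodule (AlgebraicClosure K) (AlgebraicClosure K ⊗[K] M)) this
  · by_cases hW : W.toSubmodule = ⊥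
    · exact Or.inl (Subrepresentation.toSubmodule_injective hW)
    · refine Or.inr (Subrepresentation.toSubmodule_injective (key _ (fun g hg w hw => ?_) hW))
      exact W.apply_mem_toSubmodule ⟨g, hg⟩ hw

end Hecke

/-! ### Schur's lemma -/

section Schur

variable {K : Type*} [Field K] {G : Type*} [Group G] {M : Type*} [AddCommGroup M] [Module K M]
  [FiniteDimensional K M] [Nontrivial M]

/-- Schur's lemma for absolutely irreducible representations. -/
theorem IsAbsolutelyIrreducible.exists_eq_smul {τ : Representation K G M}
    (h : IsAbsolutelyIrreducible τ) {f : Module.End K M} (hf : ∀ g v, f (τ g v) = τ g (f v)) :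
    ∃ c : K, ∀ v, f v = c • v := by
  let L := AlgebraicClosure K
  let fL : Module.End L (L ⊗[K] M) := f.baseChange L
  have hcomm : ∀ g v, fL (extend L τ g v) = extend L τ g (fL v) := by
    intro g v
    induction v with
    | zero => simp
    | add v w hv hw => simp only [map_add, hv, hw]
    | tmul c v => rw [extend_tmul, LinearMap.baseChange_tmul, LinearMap.baseChange_tmul,
        extend_tmul, hf]
  obtain ⟨c, hc⟩ := Module.End.exists_eigenvalue fL
  let W : Subrepresentation (extend L τ) :=
    { toSubmodule := Module.End.eigenspace fL c
      apply_mem_toSubmodule := fun g v hv => by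
        rw [Module.End.mem_eigenspace_iff] at hv ⊢
        rw [hcomm, hv, map_smul] }
  have := h
  unfold IsAbsolutelyIrreducible at this
  have htop : W = ⊤ := by
    refine (eq_bot_or_eq_top W).resolve_left fun hbot => hc ?_
    exact congrArg Subrepresentation.toSubmodule hbot
  have hall : ∀ v, fL v = c • v := fun v => by
    have hv : v ∈ W.toSubmodule := by
      rw [htop]; exact Submodule.mem_top
    exact Module.End.mem_eigenspace_iff.mp hv
  let b := Module.finBasis K M
  have hpos : 0 < Module.finrank K M := Module.finrank_pos
  have hcoef : ∀ v i, algebraMap K L (b.repr (f v) i) = c * algebraMap K L (b.repr v i) := by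
    intro v i
    have h1 := congrArg (fun z => (b.baseChange L).repr z i) (hall (1 ⊗ₜ v))
    simp only [fL, LinearMap.baseChange_tmul, map_smul, Finsupp.smul_apply,
      Module.Basis.baseChange_repr_tmul, smul_eq_mul, Algebra.smul_def, mul_one] at h1
    exact h1
  -- The eigenvalue lives in the algebraic closure, but it equals a diagonal matrix entry of `f`,
  -- hence comes from `K`.
  let i0 : Fin (Module.finrank K M) := ⟨0, hpos⟩
  refine ⟨b.repr (f (b i0)) i0, fun v => b.repr.injective (Finsupp.ext fun i => ?_)⟩
  apply (algebraMap K L).injective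
  have hc0 := hcoef (b i0) i0
  rw [Module.Basis.repr_self, Finsupp.single_eq_same, map_one, mul_one] at hc0
  rw [hcoef, map_smul, Finsupp.smul_apply, smul_eq_mul, map_mul, hc0]

end Schur

/-! ### From the derived subgroup back to the Artin group -/

section Intertwiner

variable {K : Type*} [Field K] {n : ℕ} {M M' : Type*} [AddCommGroup M] [Module K M]
  [AddCommGroup M'] [Module K M'] {q : K} {ρ : Representation K (ArtinD n) M}
  {ρ' : Representation K (ArtinD n) M'}

theorem intertwines_of_gen {F : M →ₗ[K] M'} (hF : ∀ x v, F (ρ (gen x) v) = ρ' (gen x) (F v))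
    (g : ArtinD n) : ∀ v, F (ρ g v) = ρ' g (F v) := by
  have hg : g ∈ Subgroup.closure (Set.range (gen : ArtinGen n → ArtinD n)) := by
    rw [closure_gen]; trivial
  induction hg using Subgroup.closure_induction_left with
  | one => simp
  | mul_left x hx g hg ih =>
    obtain ⟨x, rfl⟩ := hx
    intro v
    rw [map_mul, map_mul, Module.End.mul_apply, Module.End.mul_apply, hF, ih]
  | inv_mul_cancel x hx g hg ih =>
    obtain ⟨x, rfl⟩ := hx
    intro v
    rw [map_mul, map_mul, Module.End.mul_apply, Module.End.mul_apply, ← ih]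
    have h1 := hF x (ρ (gen x)⁻¹ (ρ g v))
    rw [Representation.self_inv_apply] at h1
    rw [h1, Representation.inv_self_apply]

/-- Isomorphic restrictions to the derived subgroup come from isomorphic representations of the
Artin group, unless the latter acts by scalars. -/
theorem exists_intertwiner_of_resIso [FiniteDimensional K M] [Nontrivial M] (hn : 4 ≤ n)
    (hq1 : q ≠ 1) (h : IsHecke q ρ) (h' : IsHecke q ρ')
    (habs : IsAbsolutelyIrreducible (res ρ)) (hns : ¬ ∀ x, ∃ c : K, ∀ v, ρ (gen x) v = c • v)
    (hiso : ResIso ρ ρ') : ∃ F : M ≃ₗ[K] M', ∀ g v, F (ρ g v) = ρ' g (F v) := by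
  obtain ⟨φ⟩ := hiso
  let F : M ≃ₗ[K] M' := φ.toLinearEquiv
  have hF : ∀ g ∈ commutator (ArtinD n), ∀ v, F (ρ g v) = ρ' g (F v) := fun g hg v =>
    φ.toIntertwiningMap.isIntertwining _ _ ⟨g, hg⟩ v
  have hFs : ∀ g ∈ commutator (ArtinD n), ∀ v, F.symm (ρ' g v) = ρ g (F.symm v) := by
    intro g hg v
    rw [LinearEquiv.symm_apply_eq, hF g hg, LinearEquiv.apply_symm_apply]
  set x : ArtinD n := gen .u with hx
  have hcm : ∀ y, gen y * x⁻¹ ∈ commutator (ArtinD n) := fun y => gen_mul_inv_mem hn y .u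
  have hnorm : (commutator (ArtinD n)).Normal := inferInstance
  -- The generator `x` normalizes the derived subgroup, so comparing its actions on both sides
  -- through `F` gives an endomorphism commuting with that subgroup.
  obtain ⟨c, hc⟩ := habs.exists_eq_smul
    (f := ρ x⁻¹ ∘ₗ F.symm.toLinearMap ∘ₗ ρ' x ∘ₗ F.toLinearMap) (by
      rintro ⟨g, hg⟩ v
      change ρ x⁻¹ (F.symm (ρ' x (F (ρ g v)))) = ρ g (ρ x⁻¹ (F.symm (ρ' x (F v))))
      have e1 : ρ' x (ρ' g (F v)) = ρ' (x * g * x⁻¹) (ρ' x (F v)) := by simp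
      have e2 := hnorm.conj_mem g hg x
      rw [hF g hg, e1, hFs _ e2]
      simp)
  have hc' : ∀ v, ρ' x (F v) = c • F (ρ x v) := by
    intro v
    have h1 : ρ x⁻¹ (F.symm (ρ' x (F v))) = c • v := hc v
    have h3 := congrArg (fun z => F (ρ x z)) h1
    simp only [Representation.self_inv_apply, LinearEquiv.apply_symm_apply, map_smul] at h3
    exact h3
  have hcy : ∀ y v, ρ' (gen y) (F v) = c • F (ρ (gen y) v) := by
    intro y v
    have e1 : ρ' (gen y) (F v) = ρ' (gen y * x⁻¹) (ρ' x (F v)) := by simp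
    rw [e1, hc', map_smul, ← hF _ (hcm y)]
    simp
  have hc0 : c ≠ 0 := by
    rintro rfl
    obtain ⟨v, hv⟩ := exists_ne (0 : M)
    have h1 := hc' v
    rw [zero_smul] at h1
    have h3 := congrArg (ρ' x⁻¹) h1
    rw [Representation.inv_self_apply, map_zero] at h3
    exact hv (F.map_eq_zero_iff.mp h3)
  -- Both `ρ (gen y)` and `c` times it satisfy the same quadratic relation. Subtracting expresses `ρ
  -- (gen y)` as a scalar unless `c = 1`.
  have hc1 : c = 1 := by
    by_contra hc1
    refine hns fun y => ⟨-((q * (1 + c)) / ((q - 1) * c)), fun v => ?_⟩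
    have e1 := h' y (F v)
    rw [hcy, map_smul, hcy, h y v, map_add, map_smul, map_smul] at e1
    have e2 : ((q - 1) * c * (c - 1)) • F (ρ (gen y) v) = (-(q * (1 + c)) * (c - 1)) • F v := by
      linear_combination (norm := module) e1
    have hcc : (q - 1) * c * (c - 1) ≠ 0 :=
      mul_ne_zero (mul_ne_zero (sub_ne_zero.mpr hq1) hc0) (sub_ne_zero.mpr hc1)
    apply F.injective
    rw [map_smul]
    apply smul_right_injective M' hcc
    change ((q - 1) * c * (c - 1)) • F (ρ (gen y) v) = ((q - 1) * c * (c - 1)) • _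
    rw [e2, smul_smul]
    congr 1
    have h1 := sub_ne_zero.mpr hq1
    field_simp
  refine ⟨F, fun g v => intertwines_of_gen (F := F.toLinearMap) (fun y v => ?_) g v⟩
  have := hcy y v
  rw [hc1, one_smul] at this
  exact this.symm

end Intertwiner

/-! ### The exchange σ of the two components -/

section Flip

variable {K : Type*} [Field K] {n : ℕ} {α : K}

/-- The exchange of the two components, from tableaux of shape `l` to tableaux of shape `l'`;
it is meaningful if `l'` is `l` with its components exchanged. -/
def opFlip (K : Type*) [Field K] (l l' : DoublePartition n) : V K l →ₗ[K] V K l' :=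
  Finsupp.linearCombination K fun t => vec K l' (flip ∘ t.1)

theorem flip_comp_flip_comp (pos : Fin n → Bool × ℕ × ℕ) : flip ∘ flip ∘ pos = pos := by
  funext j
  simp

theorem isStandard_flip_iff {l : DoublePartition n} {pos : Fin n → Bool × ℕ × ℕ} :
    IsStandard l.swap (flip ∘ pos) ↔ IsStandard l pos := by
  refine ⟨fun h => ?_, fun h => h.flip⟩
  have := h.flip
  rwa [flip_comp_flip_comp] at this

theorem opFlip_vec {l l' : DoublePartition n} (hl : l' = l.swap) (pos : Fin n → Bool × ℕ × ℕ) :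
    opFlip K l l' (vec K l pos) = vec K l' (flip ∘ pos) := by
  by_cases h : IsStandard l pos
  · obtain ⟨t, rfl⟩ : ∃ t : StdTab l, t.1 = pos := ⟨⟨pos, h⟩, rfl⟩
    rw [vec_coe, opFlip, Finsupp.linearCombination_single, one_smul]
  · rw [vec_of_not h, map_zero, vec_of_not]
    rw [hl, isStandard_flip_iff]
    exact h

theorem mb_flip (b b' : Bool × ℕ × ℕ) : mb α (flip b) (flip b') = mb α b b' := by
  simp [mb]

theorem comparable_flip (b b' : Bool × ℕ × ℕ) :
    Comparable (flip b) (flip b') ↔ Comparable b b' := by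
  simp [Comparable, flip]

theorem gb_flip (b b' : Bool × ℕ × ℕ) : gb α (flip b) (flip b') = gb α b b' := by
  by_cases hc : Comparable b b'
  · rw [gb, gb, if_pos hc, if_pos ((comparable_flip b b').mpr hc)]
  · rw [gb, gb, if_neg hc, if_neg (mt (comparable_flip b b').mp hc), mb_flip]

variable {l l' : DoublePartition n}

theorem opFlip_opS (hl : l' = l.swap) (i : Fin (n - 1)) (v : V K l) :
    opFlip K l l' (opS α 1 l i v) = opS α 1 l' i (opFlip K l l' v) := by
  have : opFlip K l l' ∘ₗ opS α 1 l i = opS α 1 l' i ∘ₗ opFlip K l l' := by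
    refine linearMap_ext_vec fun pos h => ?_
    simp only [LinearMap.comp_apply, opS_vec, opFlip_vec hl, map_add, map_smul, Function.comp_apply,
      mb_flip, gb_flip, Function.comp_assoc]
  exact LinearMap.congr_fun this v

theorem opFlip_opT (hl : l' = l.swap) (hn : 0 < n) (v : V K l) :
    opFlip K l l' (opT 1 hn l v) = -opT 1 hn l' (opFlip K l l' v) := by
  have : opFlip K l l' ∘ₗ opT 1 hn l = -(opT 1 hn l' ∘ₗ opFlip K l l') := by
    refine linearMap_ext_vec fun pos h => ?_
    simp only [LinearMap.comp_apply, LinearMap.neg_apply, opT_eq_opD (1 : K), opD_vec,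
      opFlip_vec hl, map_smul, Function.comp_apply, ctb_flip, neg_smul, neg_neg]
  exact LinearMap.congr_fun this v

/-- The exchange anticommutes with `T`, but U contains `T` twice, so the signs cancel. This fails
for the type B group generated with `T` itself. -/
theorem opFlip_hoefsmit (hl : l' = l.swap) (h2 : (2 : K) ≠ 0) (hα : 2 * n < orderOf α)
    (hn : 1 < n) (g : ArtinD n) (v : V K l) :
    opFlip K l l' (hoefsmit l h2 hα hn g v) = hoefsmit l' h2 hα hn g (opFlip K l l' v) := by
  refine intertwines_of_gen (fun x v => ?_) g v
  rw [hoefsmit_gen, hoefsmit_gen]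
  cases x with
  | s i => exact opFlip_opS hl i v
  | u =>
    simp only [opGen, opU_eq, Module.End.mul_apply]
    rw [opFlip_opT hl, opFlip_opS hl, opFlip_opT hl, map_neg, map_neg, neg_neg]

end Flip

/-! ### Weight basis for unequal components -/

section Weights

variable {K : Type*} [Field K] {n : ℕ} {α : K}

theorem basisSingleOne_eq_vec {l : DoublePartition n} (t : StdTab l) :
    (Finsupp.basisSingleOne t : V K l) = vec K l t.1 := by
  rw [vec_coe, Finsupp.coe_basisSingleOne]

theorem isHecke_hoefsmit (l : DoublePartition n) (h2 : (2 : K) ≠ 0) (hα : 2 * n < orderOf α)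
    (hn : 1 < n) : IsHecke α (hoefsmit l h2 hα hn) := by
  intro x v
  rw [hoefsmit_gen]
  exact LinearMap.congr_fun (opGen_mul_self l h2 hα hn x) v

/-- The eigenvalues of the diagonal elements on a tableau. -/
def weight (α : K) (hn : 1 < n) (pos : Fin n → Bool × ℕ × ℕ) (k : {k : ℕ // k + 1 < n}) : K :=
  α ^ (k.1 + 1) * (ctb α (pos ⟨0, by omega⟩) * ctb α (pos ⟨k.1 + 1, k.2⟩))

theorem eq_or_eq_flip_of_weight {l l' : DoublePartition n} {pos pos' : Fin n → Bool × ℕ × ℕ}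
    (h : IsStandard l pos) (h' : IsStandard l' pos') (h2 : (2 : K) ≠ 0)
    (hα : 2 * n < orderOf α) (hn : 1 < n) (hw : weight α hn pos = weight α hn pos') :
    pos = pos' ∨ pos = flip ∘ pos' := by
  refine h.eq_or_eq_flip h' h2 hα (by omega) fun j hj => ?_
  obtain ⟨_ | k, hk⟩ := j
  · exact absurd rfl hj
  · have := congrFun hw ⟨k, hk⟩
    exact mul_left_cancel₀ (pow_ne_zero _ (ne_zero_of_orderOf hα)) this

theorem comp_swap_ne {l : DoublePartition n} {pos : Fin n → Bool × ℕ × ℕ} (h : IsStandard l pos)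
    (i : Fin (n - 1)) : pos ∘ Equiv.swap (lo i) (hi i) ≠ pos := by
  intro he
  have := congrFun he (lo i)
  rw [Function.comp_apply, Equiv.swap_apply_left] at this
  exact lo_ne_hi i (h.injective this).symm

/-- A third entry is fixed by the exchange of two entries but moved by `flip`. -/
theorem comp_swap_ne_flip (hn : 3 ≤ n) (pos : Fin n → Bool × ℕ × ℕ) (i : Fin (n - 1)) :
    pos ∘ Equiv.swap (lo i) (hi i) ≠ flip ∘ pos := by
  intro he
  obtain ⟨j, h1, h2⟩ : ∃ j : Fin n, j ≠ lo i ∧ j ≠ hi i := by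
    by_cases h : (i : ℕ) = 0
    · exact ⟨⟨2, by omega⟩, by simp [lo, Fin.ext_iff, h], by simp [hi, Fin.ext_iff, h]⟩
    · exact ⟨⟨0, by omega⟩, by simp [lo, Fin.ext_iff]; omega, by simp [hi, Fin.ext_iff]⟩
  have := congrFun he j
  rw [Function.comp_apply, Equiv.swap_apply_of_ne_of_ne h1 h2] at this
  exact flip_ne _ this.symm

theorem isWeightBasis_hoefsmit {l : DoublePartition n} (hl : l.fst ≠ l.snd) (h2 : (2 : K) ≠ 0)
    (hα : 2 * n < orderOf α) (hn : 1 < n) :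
    IsWeightBasis (hoefsmit l h2 hα hn) (fun k : {k : ℕ // k + 1 < n} => diagElem hn k.1)
      (fun t : StdTab l => weight α hn t.1) Finsupp.basisSingleOne where
  apply t k := by
    rw [basisSingleOne_eq_vec]
    exact hoefsmit_diagElem_vec l h2 hα hn k.1 k.2 t.1
  injective t t' hw := by
    rcases eq_or_eq_flip_of_weight t.2 t'.2 h2 hα hn hw with h | h
    · exact Subtype.ext h
    -- Tableaux related by `flip` have exchanged shapes, so for unequal components they cannot both
    -- have shape `l`.
    · have h1 := t'.2.flip
      rw [← h] at h1
      exact absurd (congrArg DoublePartition.fst (t.2.shape_eq h1)) hl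
  linked t t' := by
    refine StdTab.induction_swap (P := fun t' => Relation.ReflTransGen _ t t')
      (fun t' i h hp => hp.tail ⟨gen (.s i), ?_⟩) Relation.ReflTransGen.refl t'
    have key : ∀ t'' : StdTab l, t''.1 = t'.1 ∘ Equiv.swap (lo i) (hi i) →
        (hoefsmit l h2 hα hn (gen (.s i)) (vec K l t'.1)) t'' ≠ 0 := by
      intro t'' h''
      have hne : t'' ≠ t' := fun he => comp_swap_ne t'.2 i (by rw [← h'', he])
      rw [hoefsmit_gen, opGen, opS_vec, ← h'', vec_coe, vec_coe, Finsupp.add_apply,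
        Finsupp.smul_apply, Finsupp.smul_apply, Finsupp.single_eq_same,
        Finsupp.single_eq_of_ne hne, smul_zero, zero_add, smul_eq_mul, mul_one]
      exact gb_ne_zero t'.2 h2 hα h
    rw [basisSingleOne_eq_vec]
    exact key ⟨_, h⟩ rfl

end Weights

/-! ### The representations R_{γ,±} and their weight bases -/

section Symmetrized

variable {K : Type*} [Field K] {n : ℕ} {α : K} (g : DoublePartition n)

/-- The map `v ↦ v ± σ(v)`. -/
def symmetrize (K : Type*) [Field K] (g : DoublePartition n) (s : ℤˣ) : V K g →ₗ[K] V K g :=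
  LinearMap.id + (s : ℤ) • opFlip K g g

variable {g}

theorem symmetrize_vec (hg : g.fst = g.snd) (s : ℤˣ) (pos : Fin n → Bool × ℕ × ℕ) :
    symmetrize K g s (vec K g pos) = vec K g pos + (s : ℤ) • vec K g (flip ∘ pos) := by
  simp [symmetrize, opFlip_vec (DoublePartition.swap_eq_self hg).symm]

theorem symmetrize_vec_flip (hg : g.fst = g.snd) (s : ℤˣ) (pos : Fin n → Bool × ℕ × ℕ) :
    symmetrize K g s (vec K g (flip ∘ pos)) = (s : ℤ) • symmetrize K g s (vec K g pos) := by
  rw [symmetrize_vec hg, symmetrize_vec hg, flip_comp_flip_comp, smul_add, smul_smul]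
  rcases Int.units_eq_one_or s with rfl | rfl <;> simp [add_comm]

theorem Vpm_eq_range (hg : g.fst = g.snd) (s : ℤˣ) :
    Vpm K g hg s = LinearMap.range (symmetrize K g s) := by
  rw [LinearMap.range_eq_map, ← (Finsupp.basisSingleOne (R := K) (ι := StdTab g)).span_eq,
    Submodule.map_span, ← Set.range_comp, Vpm]
  congr 2
  funext t
  rw [Function.comp_apply, basisSingleOne_eq_vec, symmetrize_vec hg, vec_coe]
  congr 2
  exact (vec_coe (t.sigma hg)).symm

theorem symmetrize_hoefsmit (hg : g.fst = g.snd) (h2 : (2 : K) ≠ 0) (hα : 2 * n < orderOf α)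
    (hn : 1 < n) (s : ℤˣ) (x : ArtinD n) (v : V K g) :
    symmetrize K g s (hoefsmit g h2 hα hn x v) = hoefsmit g h2 hα hn x (symmetrize K g s v) := by
  simp [symmetrize, opFlip_hoefsmit (DoublePartition.swap_eq_self hg).symm]

/-- The representation `R_{γ,±}` of the Artin group. -/
def hoefsmitPM (h2 : (2 : K) ≠ 0) (hα : 2 * n < orderOf α) (hn : 1 < n) (g : DoublePartition n)
    (hg : g.fst = g.snd) (s : ℤˣ) : Representation K (ArtinD n) (Vpm K g hg s) :=
  Subrepresentation.toRepresentation (ρ := hoefsmit g h2 hα hn) ⟨Vpm K g hg s, fun x v hv => by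
    rw [Vpm_eq_range] at hv ⊢
    obtain ⟨w, rfl⟩ := hv
    exact ⟨_, symmetrize_hoefsmit hg h2 hα hn s x w⟩⟩

/-- The map `v ↦ v ± σ(v)`, with values in `V_{γ,±}`. -/
def toVpm (K : Type*) [Field K] (hg : g.fst = g.snd) (s : ℤˣ) : V K g →ₗ[K] Vpm K g hg s :=
  (symmetrize K g s).codRestrict _ fun v => by rw [Vpm_eq_range]; exact ⟨v, rfl⟩

theorem coe_toVpm (hg : g.fst = g.snd) (s : ℤˣ) (v : V K g) :
    (toVpm K hg s v : V K g) = symmetrize K g s v := rfl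

theorem toVpm_surjective (hg : g.fst = g.snd) (s : ℤˣ) : Function.Surjective (toVpm K hg s) := by
  rintro ⟨v, hv⟩
  have hv' := hv
  rw [Vpm_eq_range] at hv'
  obtain ⟨w, rfl⟩ := hv'
  exact ⟨w, rfl⟩

theorem toVpm_hoefsmit (hg : g.fst = g.snd) (h2 : (2 : K) ≠ 0) (hα : 2 * n < orderOf α)
    (hn : 1 < n) (s : ℤˣ) (x : ArtinD n) (v : V K g) :
    toVpm K hg s (hoefsmit g h2 hα hn x v) = hoefsmitPM h2 hα hn g hg s x (toVpm K hg s v) :=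
  Subtype.ext (symmetrize_hoefsmit hg h2 hα hn s x v)

theorem toVpm_vec_flip (hg : g.fst = g.snd) (s : ℤˣ) (pos : Fin n → Bool × ℕ × ℕ) :
    toVpm K hg s (vec K g (flip ∘ pos)) = ((s : ℤ) : K) • toVpm K hg s (vec K g pos) :=
  Subtype.ext ((symmetrize_vec_flip hg s pos).trans (Int.cast_smul_eq_zsmul K _ _).symm)

theorem isHecke_hoefsmitPM (hg : g.fst = g.snd) (s : ℤˣ) (h2 : (2 : K) ≠ 0)
    (hα : 2 * n < orderOf α) (hn : 1 < n) :
    IsHecke (M := Vpm K g hg s) α (hoefsmitPM h2 hα hn g hg s) := fun x v =>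
  Subtype.ext (isHecke_hoefsmit g h2 hα hn x v)

/-- The tableaux with the first entry in the left component. -/
abbrev LeftTab (hn : 1 < n) (g : DoublePartition n) : Type :=
  {t : StdTab g // (t.1 ⟨0, by omega⟩).1 = false}

/-- The left one of the two tableaux `𝕋` and `σ(𝕋)`. -/
def toLeft (hg : g.fst = g.snd) (hn : 1 < n) (t : StdTab g) : LeftTab hn g :=
  if h : (t.1 ⟨0, by omega⟩).1 = false then ⟨t, h⟩
  else ⟨t.sigma hg, by simpa [StdTab.sigma, flip] using h⟩

theorem toLeft_cases (hg : g.fst = g.snd) (hn : 1 < n) (t : StdTab g) :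
    (toLeft hg hn t).1.1 = t.1 ∨ (toLeft hg hn t).1.1 = flip ∘ t.1 := by
  unfold toLeft
  split_ifs
  · exact Or.inl rfl
  · exact Or.inr rfl

theorem toLeft_coe (hg : g.fst = g.snd) (hn : 1 < n) (t : LeftTab hn g) : toLeft hg hn t.1 = t :=
  dif_pos t.2

theorem LeftTab.eq_of_cases {hn : 1 < n} {t t' : LeftTab hn g}
    (h : t.1.1 = t'.1.1 ∨ t.1.1 = flip ∘ t'.1.1) : t = t' := by
  rcases h with h | h
  · exact Subtype.ext (Subtype.ext h)
  · have h1 := t.2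
    have h2 := t'.2
    rw [h] at h1
    simp [flip, h2] at h1

theorem toLeft_eq_of_flip (hg : g.fst = g.snd) (hn : 1 < n) {t t' : StdTab g}
    (h : t.1 = flip ∘ t'.1) : toLeft hg hn t = toLeft hg hn t' := by
  refine LeftTab.eq_of_cases ?_
  rcases toLeft_cases hg hn t with h1 | h1 <;> rcases toLeft_cases hg hn t' with h3 | h3 <;>
    rw [h1, h3, h] <;> simp [flip_comp_flip_comp]

theorem unit_cast_mul_self (s : ℤˣ) : ((s : ℤ) : K) * ((s : ℤ) : K) = 1 := by
  rcases Int.units_eq_one_or s with rfl | rfl <;> simp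

theorem exists_toVpm_vec (hg : g.fst = g.snd) (hn : 1 < n) (s : ℤˣ) (t : StdTab g) :
    ∃ c : K, c ≠ 0 ∧
      toVpm K hg s (vec K g t.1) = c • toVpm K hg s (vec K g (toLeft hg hn t).1.1) := by
  rcases toLeft_cases hg hn t with h | h
  · exact ⟨1, one_ne_zero, by rw [h, one_smul]⟩
  · refine ⟨((s : ℤ) : K), ?_, ?_⟩
    · rcases Int.units_eq_one_or s with rfl | rfl <;> simp
    · rw [h, toVpm_vec_flip, smul_smul, unit_cast_mul_self, one_smul]

theorem flip_comp_ne (hn : 1 < n) (pos : Fin n → Bool × ℕ × ℕ) : flip ∘ pos ≠ pos := fun h =>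
  flip_ne _ (congrFun h ⟨0, by omega⟩)

theorem linearIndependent_toVpm_vec (hg : g.fst = g.snd) (hn : 1 < n) (s : ℤˣ) :
    LinearIndependent K fun t : LeftTab hn g => toVpm K hg s (vec K g t.1.1) := by
  refine LinearIndependent.of_comp ((Finsupp.lcomapDomain (fun t : LeftTab hn g => t.1)
    Subtype.val_injective) ∘ₗ (Vpm K g hg s).subtype) ?_
  have : (((Finsupp.lcomapDomain (fun t : LeftTab hn g => t.1)
      Subtype.val_injective) ∘ₗ (Vpm K g hg s).subtype) ∘
        fun t : LeftTab hn g => toVpm K hg s (vec K g t.1.1)) =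
      fun t : LeftTab hn g => (Finsupp.single t 1 : LeftTab hn g →₀ K) := by
    funext t
    refine Finsupp.ext fun t' => ?_
    change symmetrize K g s (vec K g t.1.1) t'.1 = Finsupp.single t 1 t'
    have hs : vec K g (flip ∘ t.1.1) = Finsupp.single (t.1.sigma hg) 1 := vec_coe (t.1.sigma hg)
    have hne : t.1.sigma hg ≠ t'.1 := fun he => by
      have h1 := t'.2
      rw [← he] at h1
      have h3 := t.2
      simp [StdTab.sigma, flip, h3] at h1
    rw [symmetrize_vec hg, hs, vec_coe]
    rw [Finsupp.add_apply, Finsupp.smul_apply, Finsupp.single_eq_of_ne hne.symm, smul_zero,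
      add_zero]
    by_cases htt : t = t'
    · rw [htt]; simp
    · rw [Finsupp.single_eq_of_ne (Ne.symm htt), Finsupp.single_eq_of_ne]
      exact fun he => htt (Subtype.ext he.symm)
  rw [this]
  exact Finsupp.linearIndependent_single_one K (LeftTab hn g)

/-- The basis of `V_{γ,±}` indexed by the tableaux with the first entry on the left. -/
def basisVpm (K : Type*) [Field K] (hg : g.fst = g.snd) (hn : 1 < n) (s : ℤˣ) :
    Module.Basis (LeftTab hn g) K (Vpm K g hg s) :=
  Module.Basis.mk (linearIndependent_toVpm_vec hg hn s) (by
    have hr : LinearMap.range (toVpm K hg s) = ⊤ := LinearMap.range_eq_top.mpr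
      (toVpm_surjective hg s)
    rw [← hr, LinearMap.range_eq_map, ← (Finsupp.basisSingleOne (R := K) (ι := StdTab g)).span_eq,
      Submodule.map_span, Submodule.span_le]
    rintro _ ⟨_, ⟨t, rfl⟩, rfl⟩
    rw [basisSingleOne_eq_vec]
    obtain ⟨c, -, hc⟩ := exists_toVpm_vec (K := K) hg hn s t
    rw [hc]
    exact Submodule.smul_mem _ _ (Submodule.subset_span ⟨toLeft hg hn t, rfl⟩))

theorem basisVpm_apply (hg : g.fst = g.snd) (hn : 1 < n) (s : ℤˣ) (t : LeftTab hn g) :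
    basisVpm K hg hn s t = toVpm K hg s (vec K g t.1.1) :=
  Module.Basis.mk_apply _ _ _

theorem toLeft_swap_ne (hg : g.fst = g.snd) (hn : 1 < n) (hn3 : 3 ≤ n) (t : LeftTab hn g)
    (i : Fin (n - 1)) (h : IsStandard g (t.1.1 ∘ Equiv.swap (lo i) (hi i))) :
    toLeft hg hn ⟨_, h⟩ ≠ t := by
  intro he
  have h1 := toLeft_cases hg hn ⟨_, h⟩
  rw [he] at h1
  rcases h1 with h1 | h1
  · exact comp_swap_ne t.1.2 i h1.symm
  · have h3 := congrArg (fun p => flip ∘ p) h1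
    simp only [flip_comp_flip_comp] at h3
    exact comp_swap_ne_flip hn3 _ i h3.symm

theorem isWeightBasis_hoefsmitPM (hg : g.fst = g.snd) (s : ℤˣ) (h2 : (2 : K) ≠ 0)
    (hα : 2 * n < orderOf α) (hn : 1 < n) (hn3 : 3 ≤ n) :
    IsWeightBasis (M := Vpm K g hg s) (hoefsmitPM h2 hα hn g hg s)
      (fun k : {k : ℕ // k + 1 < n} => diagElem hn k.1)
      (fun t : LeftTab hn g => weight α hn t.1.1) (basisVpm K hg hn s) where
  apply t k := by
    rw [basisVpm_apply, ← toVpm_hoefsmit, hoefsmit_diagElem_vec g h2 hα hn k.1 k.2, map_smul]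
    rfl
  injective t t' hw := LeftTab.eq_of_cases (eq_or_eq_flip_of_weight t.1.2 t'.1.2 h2 hα hn hw)
  linked t t' := by
    rw [← toLeft_coe hg hn t']
    refine StdTab.induction_swap (P := fun t' => Relation.ReflTransGen _ t (toLeft hg hn t'))
      (fun t' i h hp => hp.tail ⟨gen (.s i), ?_⟩)
      (by rw [toLeft_coe]) t'.1
    -- Taking the left representative commutes with exchanges of entries up to σ, so the path of
    -- tableaux can be followed among left representatives.
    have hstd : IsStandard g ((toLeft hg hn t').1.1 ∘ Equiv.swap (lo i) (hi i)) := by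
      rcases toLeft_cases hg hn t' with h1 | h1
      · rw [h1]; exact h
      · have hf := h.flip
        rw [DoublePartition.swap_eq_self hg] at hf
        rw [h1]
        exact hf
    have heq : toLeft hg hn ⟨_, h⟩ = toLeft hg hn ⟨_, hstd⟩ := by
      rcases toLeft_cases hg hn t' with h1 | h1
      · congr 2
        rw [h1]
      · exact toLeft_eq_of_flip hg hn (funext fun x =>
          (flip_flip _).symm.trans (congrArg flip (congrFun h1 _).symm))
    rw [heq]
    have hne := toLeft_swap_ne hg hn hn3 _ i hstd
    obtain ⟨c, hc, hcv⟩ := exists_toVpm_vec (K := K) hg hn s ⟨_, hstd⟩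
    rw [basisVpm_apply, ← toVpm_hoefsmit, hoefsmit_gen, opGen, opS_vec, map_add, map_smul, map_smul,
      hcv, ← basisVpm_apply, ← basisVpm_apply]
    have hgb := gb_ne_zero (toLeft hg hn t').1.2 h2 hα hstd
    simp [hne.symm, hgb, hc]

/-- If no exchange were possible, connectedness would leave a single tableau, but σ moves every
tableau. Hence R_{γ,±} is never one-dimensional and needs no dimension hypothesis. -/
theorem exists_ne_leftTab (hg : g.fst = g.snd) (hn : 1 < n) (hn3 : 3 ≤ n) :
    ∃ t t' : LeftTab hn g, t ≠ t' := by
  let t : LeftTab hn g := toLeft hg hn (Classical.arbitrary _)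
  by_cases h : ∃ i : Fin (n - 1), IsStandard g (t.1.1 ∘ Equiv.swap (lo i) (hi i))
  · obtain ⟨i, hi'⟩ := h
    exact ⟨_, _, toLeft_swap_ne hg hn hn3 t i hi'⟩
  · push Not at h
    have h1 : t.1.sigma hg = t.1 := StdTab.induction_swap (P := fun t' => t' = t.1)
      (fun t' i hi' ht' => absurd (by rw [← ht']; exact hi') (h i)) rfl _
    exact absurd (congrArg Subtype.val h1) (flip_comp_ne hn _)

end Symmetrized

/-! ### Comparing weight bases of isomorphic restrictions -/

section Comparison

variable {K : Type*} [Field K] {n : ℕ} {M M' : Type*} [AddCommGroup M] [Module K M]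
  [AddCommGroup M'] [Module K M'] {q : K} {ρ : Representation K (ArtinD n) M}
  {ρ' : Representation K (ArtinD n) M'} {ι ι' Y : Type*} {y : Y → ArtinD n} {χ : ι → Y → K}
  {b : Module.Basis ι K M} {χ' : ι' → Y → K} {b' : Module.Basis ι' K M'}

/-- Scalar generators would make every line stable, in particular that of `b k + b l`, and force the
weights of `k` and `l` to agree. -/
theorem IsWeightBasis.not_scalar (hb : IsWeightBasis ρ y χ b) (h : IsHecke q ρ) (hq : q ≠ 0)
    {k l : ι} (hkl : k ≠ l) : ¬ ∀ x, ∃ c : K, ∀ v, ρ (gen x) v = c • v := by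
  intro hs
  have hmem : ∀ v g, ρ g v ∈ K ∙ v := fun v g =>
    h.stable_of_gen hq (W := K ∙ v) (fun x w hw => by
      obtain ⟨c, hc⟩ := hs x
      rw [hc]
      exact Submodule.smul_mem _ _ hw) g v (Submodule.mem_span_singleton_self v)
  refine hkl (hb.injective (funext fun j => ?_))
  obtain ⟨c, hc⟩ := Submodule.mem_span_singleton.mp (hmem (b k + b l) (y j))
  rw [map_add, hb.apply, hb.apply] at hc
  have h1 := congrArg (fun v => b.repr v k) hc
  have h3 := congrArg (fun v => b.repr v l) hc
  simp [hkl, hkl.symm] at h1 h3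
  rw [← h1, ← h3]

theorem IsWeightBasis.exists_intertwiner [Finite ι] (hb : IsWeightBasis ρ y χ b)
    (h : IsHecke q ρ) (h' : IsHecke q ρ') (hn : 4 ≤ n)
    (hq : q ≠ 0) (hq1 : q ≠ 1) {k l : ι} (hkl : k ≠ l) (hiso : ResIso ρ ρ') :
    ∃ F : M ≃ₗ[K] M', ∀ g v, F (ρ g v) = ρ' g (F v) := by
  have : FiniteDimensional K M := b.finiteDimensional_of_finite
  have : Nontrivial M := ⟨b k, 0, b.ne_zero _⟩
  have : Nonempty ι := ⟨k⟩
  exact exists_intertwiner_of_resIso hn hq1 h h' (hb.isAbsolutelyIrreducible h hn hq hq1)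
    (hb.not_scalar h hq hkl) hiso

theorem IsWeightBasis.exists_weight_eq_of_resIso [Finite ι] (hb : IsWeightBasis ρ y χ b)
    (hb' : IsWeightBasis ρ' y χ' b') (h : IsHecke q ρ) (h' : IsHecke q ρ') (hn : 4 ≤ n)
    (hq : q ≠ 0) (hq1 : q ≠ 1) {k l : ι} (hkl : k ≠ l) (hiso : ResIso ρ ρ') :
    ∃ i, χ k = χ' i := by
  obtain ⟨F, hF⟩ := hb.exists_intertwiner h h' hn hq hq1 hkl hiso
  obtain ⟨i, hi⟩ : ∃ i, b'.repr (F (b k)) i ≠ 0 := by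
    by_contra hcon
    push Not at hcon
    have : F (b k) = 0 := b'.repr.map_eq_zero_iff.mp (Finsupp.ext hcon)
    exact b.ne_zero k (F.map_eq_zero_iff.mp this)
  exact ⟨i, hb.exists_weight_eq hb' (F := F.toLinearMap) hF hi⟩

end Comparison

/-! ### Isomorphisms among the representations -/

section Classification

variable {K : Type*} [Field K] {n : ℕ} {α : K} (h2 : (2 : K) ≠ 0) (hα : 2 * n < orderOf α)
  (hn1 : 1 < n)

theorem ne_one_of_orderOf (hα : 2 * n < orderOf α) (hn : 4 ≤ n) : α ≠ 1 := by
  rintro rfl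
  rw [orderOf_one] at hα
  omega

theorem exists_ne_stdTab {l : DoublePartition n} (hd : 1 < Module.finrank K (V K l)) :
    ∃ t t' : StdTab l, t ≠ t' := by
  have := Fintype.ofFinite (StdTab l)
  rw [Module.finrank_finsupp_self] at hd
  exact Fintype.exists_pair_of_one_lt_card hd

theorem eq_or_eq_swap_of_resIso (hn : 4 ≤ n) {l m : DoublePartition n} (hl : l.fst ≠ l.snd)
    (hm : m.fst ≠ m.snd)
    (hd : 1 < Module.finrank K (V K l))
    (h : ResIso (hoefsmit l h2 hα hn1) (hoefsmit m h2 hα hn1)) : l = m ∨ l = m.swap := by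
  obtain ⟨t, t', htt⟩ := exists_ne_stdTab hd
  obtain ⟨s, hs⟩ := (isWeightBasis_hoefsmit hl h2 hα hn1).exists_weight_eq_of_resIso
    (isWeightBasis_hoefsmit hm h2 hα hn1) (isHecke_hoefsmit l h2 hα hn1)
    (isHecke_hoefsmit m h2 hα hn1) hn (ne_zero_of_orderOf hα) (ne_one_of_orderOf hα hn) htt h
  rcases eq_or_eq_flip_of_weight t.2 s.2 h2 hα hn1 hs with he | he
  · exact Or.inl (t.2.shape_eq (by rw [he]; exact s.2))
  · exact Or.inr (t.2.shape_eq (by rw [he]; exact s.2.flip))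

theorem not_resIso_hoefsmitPM (hn : 4 ≤ n) {l g : DoublePartition n} (hl : l.fst ≠ l.snd)
    (hg : g.fst = g.snd)
    (s : ℤˣ) (hd : 1 < Module.finrank K (V K l)) :
    ¬ ResIso (hoefsmit l h2 hα hn1) (hoefsmitPM h2 hα hn1 g hg s) := by
  intro h
  obtain ⟨t, t', htt⟩ := exists_ne_stdTab hd
  obtain ⟨s, hs⟩ := (isWeightBasis_hoefsmit hl h2 hα hn1).exists_weight_eq_of_resIso
    (M' := Vpm K g hg s)
    (isWeightBasis_hoefsmitPM hg s h2 hα hn1 (by omega)) (isHecke_hoefsmit l h2 hα hn1)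
    (isHecke_hoefsmitPM hg s h2 hα hn1) hn (ne_zero_of_orderOf hα) (ne_one_of_orderOf hα hn) htt h
  have hlg : l = g := by
    rcases eq_or_eq_flip_of_weight t.2 s.1.2 h2 hα hn1 hs with he | he
    · exact t.2.shape_eq (by rw [he]; exact s.1.2)
    · rw [← DoublePartition.swap_eq_self hg]
      exact t.2.shape_eq (by rw [he]; exact s.1.2.flip)
  exact hl (hlg ▸ hg)

theorem exists_intertwinerPM (hn : 4 ≤ n) {g d : DoublePartition n} (hg : g.fst = g.snd)
    (hd : d.fst = d.snd)
    (s s' : ℤˣ) (h : ResIso (hoefsmitPM h2 hα hn1 g hg s) (hoefsmitPM h2 hα hn1 d hd s')) :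
    ∃ F : Vpm K g hg s ≃ₗ[K] Vpm K d hd s', ∀ x v,
      F (hoefsmitPM h2 hα hn1 g hg s x v) = hoefsmitPM h2 hα hn1 d hd s' x (F v) := by
  obtain ⟨t, t', htt⟩ := exists_ne_leftTab hg hn1 (by omega)
  exact (isWeightBasis_hoefsmitPM hg s h2 hα hn1 (by omega)).exists_intertwiner
    (M := Vpm K g hg s) (M' := Vpm K d hd s')
    (isHecke_hoefsmitPM hg s h2 hα hn1) (isHecke_hoefsmitPM hd s' h2 hα hn1) hn
    (ne_zero_of_orderOf hα) (ne_one_of_orderOf hα hn) htt h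

theorem eq_of_resIso_hoefsmitPM (hn : 4 ≤ n) {g d : DoublePartition n} (hg : g.fst = g.snd)
    (hd : d.fst = d.snd)
    (s s' : ℤˣ) (h : ResIso (hoefsmitPM h2 hα hn1 g hg s) (hoefsmitPM h2 hα hn1 d hd s')) :
    g = d := by
  obtain ⟨t, t', htt⟩ := exists_ne_leftTab hg hn1 (by omega)
  obtain ⟨r, hr⟩ := (isWeightBasis_hoefsmitPM hg s h2 hα hn1 (by omega)).exists_weight_eq_of_resIso
    (M := Vpm K g hg s) (M' := Vpm K d hd s')
    (isWeightBasis_hoefsmitPM hd s' h2 hα hn1 (by omega))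
    (isHecke_hoefsmitPM hg s h2 hα hn1) (isHecke_hoefsmitPM hd s' h2 hα hn1) hn
    (ne_zero_of_orderOf hα) (ne_one_of_orderOf hα hn) htt h
  rcases eq_or_eq_flip_of_weight t.1.2 r.1.2 h2 hα hn1 hr with he | he
  · exact t.1.2.shape_eq (by rw [he]; exact r.1.2)
  · rw [← DoublePartition.swap_eq_self hd]
    exact t.1.2.shape_eq (by rw [he]; exact r.1.2.flip)

/-- The weights coincide here. An intertwiner sends a weight vector to `c` times its counterpart,
the same `c` spreads along exchanges to σ of the tableau, and there the opposite signs give `2 * c =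
0`. -/
theorem not_resIso_hoefsmitPM_neg (hn : 4 ≤ n) {g d : DoublePartition n} (hg : g.fst = g.snd)
    (hd : d.fst = d.snd) (s : ℤˣ) :
    ¬ ResIso (hoefsmitPM h2 hα hn1 g hg s) (hoefsmitPM h2 hα hn1 d hd (-s)) := by
  intro h
  obtain rfl := eq_of_resIso_hoefsmitPM h2 hα hn1 hn hg hd s (-s) h
  obtain ⟨F, hF⟩ := exists_intertwinerPM h2 hα hn1 hn hg hd s (-s) h
  have hb := isWeightBasis_hoefsmitPM hg s h2 hα hn1 (by omega)
  have hb' := isWeightBasis_hoefsmitPM hd (-s) h2 hα hn1 (by omega)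
  obtain ⟨t, -, -⟩ := exists_ne_leftTab hg hn1 (by omega)
  set c := (basisVpm K hd hn1 (-s)).repr (F (basisVpm K hg hn1 s t)) t with hc
  have ht : F (toVpm K hg s (vec K g t.1.1)) = c • toVpm K hd (-s) (vec K g t.1.1) := by
    rw [← basisVpm_apply hg hn1, ← basisVpm_apply hd hn1]
    apply (basisVpm K hd hn1 (-s)).repr.injective
    ext i
    rw [map_smul, Module.Basis.repr_self, Finsupp.smul_apply, smul_eq_mul]
    by_cases hi : i = t
    · rw [hi, Finsupp.single_eq_same, mul_one]
    · rw [Finsupp.single_eq_of_ne hi, mul_zero]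
      -- A nonzero coefficient preserves the weight, and the weights of left tableaux are distinct.
      by_contra hne
      exact hi (hb.injective (hb.exists_weight_eq (M := Vpm K g hg s) (M' := Vpm K g hd (-s)) hb'
        (F := F.toLinearMap) hF hne)).symm
  have hall : ∀ t' : StdTab g,
      F (toVpm K hg s (vec K g t'.1)) = c • toVpm K hd (-s) (vec K g t'.1) := by
    refine StdTab.induction_swap (P := fun t' : StdTab g => F (toVpm K hg s (vec K g t'.1)) =
      c • toVpm K hd (-s) (vec K g t'.1)) (fun t' i h' ht' => ?_) ht
    have e := hF (gen (.s i)) (toVpm K hg s (vec K g t'.1))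
    rw [ht', map_smul, ← toVpm_hoefsmit, ← toVpm_hoefsmit, hoefsmit_gen, opGen, opS_vec, map_add,
      map_smul, map_smul, map_add, map_smul, map_smul, ht', map_add, map_smul, map_smul, smul_add,
      smul_comm c (mb _ _ _), add_right_inj, smul_comm c (gb _ _ _)] at e
    exact smul_right_injective _ (gb_ne_zero t'.2 h2 hα h') e
  have e1 : F (toVpm K hg s (vec K g (flip ∘ t.1.1))) =
      c • toVpm K hd (-s) (vec K g (flip ∘ t.1.1)) := hall (t.1.sigma hg)
  rw [toVpm_vec_flip, toVpm_vec_flip, map_smul, ht] at e1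
  have hc0 : c = 0 := by
    rw [smul_smul, smul_smul, ← basisVpm_apply hd hn1] at e1
    have e2 := congrArg (fun v => (basisVpm K hd hn1 (-s)).repr v t) e1
    simp only [map_smul, Module.Basis.repr_self, Finsupp.smul_apply, Finsupp.single_eq_same,
      smul_eq_mul, mul_one, Units.val_neg, Int.cast_neg] at e2
    have e3 : 2 * c = 0 := by
      linear_combination ((s : ℤ) : K) * e2 - 2 * c * unit_cast_mul_self (K := K) s
    exact (mul_eq_zero.mp e3).resolve_left h2
  rw [hc0, zero_smul, ← basisVpm_apply hg hn1] at ht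
  exact (basisVpm K hg hn1 s).ne_zero t (F.map_eq_zero_iff.mp ht)

end Classification

/-! ### Invariant forms -/

section Forms

variable {K : Type*} [Field K] {n : ℕ} {M M' : Type*} [AddCommMonoid M] [Module K M]
  [AddCommMonoid M'] [Module K M'] {ρ : Representation K (ArtinD n) M}
  {ρ' : Representation K (ArtinD n) M'}

/-- A form that the generators of the Artin group multiply by a constant is invariant under the
derived subgroup. -/
theorem form_invariant {B : M → M' → K} {c : K} (hc : c ≠ 0)
    (hB : ∀ x v w, B (ρ (gen x) v) (ρ' (gen x) w) = c * B v w) {g : ArtinD n}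
    (hg : g ∈ commutator (ArtinD n)) (v : M) (w : M') : B (ρ g v) (ρ' g w) = B v w := by
  have key : ∀ g : ArtinD n, ∃ c : K, c ≠ 0 ∧ ∀ v w, B (ρ g v) (ρ' g w) = c * B v w := by
    intro g
    have hg : g ∈ Subgroup.closure (Set.range (gen : ArtinGen n → ArtinD n)) := by
      rw [closure_gen]; trivial
    induction hg using Subgroup.closure_induction with
    | one => exact ⟨1, one_ne_zero, by simp⟩
    | mem x hx =>
      obtain ⟨x, rfl⟩ := hx
      exact ⟨c, hc, hB x⟩
    | mul g h _ _ ihg ihh =>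
      obtain ⟨a, ha, hg⟩ := ihg
      obtain ⟨b, hb, hh⟩ := ihh
      refine ⟨a * b, mul_ne_zero ha hb, fun v w => ?_⟩
      rw [map_mul, map_mul, Module.End.mul_apply, Module.End.mul_apply, hg, hh, mul_assoc]
    | inv g _ ih =>
      obtain ⟨a, ha, hg⟩ := ih
      refine ⟨a⁻¹, inv_ne_zero ha, fun v w => ?_⟩
      have := hg (ρ g⁻¹ v) (ρ' g⁻¹ w)
      rw [Representation.self_inv_apply, Representation.self_inv_apply] at this
      rw [this, inv_mul_cancel_left₀ ha]
  choose χ hχ0 hχ using key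
  let N : Subgroup (ArtinD n) :=
    { carrier := {g | ∀ v w, B (ρ g v) (ρ' g w) = B v w}
      one_mem' := by simp
      mul_mem' := fun {g h} hg hh v w => by
        rw [map_mul, map_mul, Module.End.mul_apply, Module.End.mul_apply, hg, hh]
      inv_mem' := fun {g} hg v w => by
        rw [← hg, Representation.self_inv_apply, Representation.self_inv_apply] }
  have hN : commutator (ArtinD n) ≤ N := by
    rw [commutator_def, Subgroup.commutator_le]
    intro g _ h _ v w
    change B (ρ (g * h * g⁻¹ * h⁻¹) v) (ρ' (g * h * g⁻¹ * h⁻¹) w) = B v w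
    have e1 : ∀ v : M, ρ (g * h * g⁻¹ * h⁻¹) v = ρ g (ρ h (ρ (g⁻¹ * h⁻¹) v)) := by
      intro v; simp [mul_assoc]
    have e1' : ∀ v : M', ρ' (g * h * g⁻¹ * h⁻¹) v = ρ' g (ρ' h (ρ' (g⁻¹ * h⁻¹) v)) := by
      intro v; simp [mul_assoc]
    have e2 : v = ρ h (ρ g (ρ (g⁻¹ * h⁻¹) v)) := by simp
    have e2' : w = ρ' h (ρ' g (ρ' (g⁻¹ * h⁻¹) w)) := by simp
    -- Apply `g h` or `h g` to the same vectors g⁻¹h⁻¹v and g⁻¹h⁻¹w: the first gives the commutator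
    -- applied to v and w, the second v and w themselves, and both multiply `B` by `χ g * χ h`.
    rw [e1, e1', hχ, hχ]
    conv_rhs => rw [e2, e2', hχ, hχ]
    ring
  exact hN hg v w

theorem resIsoDual_of_form {Φ : M →ₗ[K] Module.Dual K M'} (hΦ : Function.Bijective Φ) {c : K}
    (hc : c ≠ 0) (hB : ∀ x v w, Φ (ρ (gen x) v) (ρ' (gen x) w) = c * Φ v w) : ResIsoDual ρ ρ' := by
  refine ⟨Representation.Equiv.mk (LinearEquiv.ofBijective Φ hΦ) fun g => LinearMap.ext fun v =>
    LinearMap.ext fun w => ?_⟩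
  change Φ (ρ g v) w = Φ v (ρ' (g⁻¹ : commutator (ArtinD n)) w)
  have := form_invariant (B := fun v w => Φ v w) hc hB g.2 v (ρ' (g.1)⁻¹ w)
  rw [Representation.self_inv_apply] at this
  exact this

theorem resIsoTwistDual_of_form {ε : K ≃+* K}
    {Φ : M →ₛₗ[(ε.symm : K →+* K)] Module.Dual K M'} (hΦ : Function.Bijective Φ) {c : K}
    (hc : c ≠ 0) (hB : ∀ x v w, Φ (ρ (gen x) v) (ρ' (gen x) w) = c * Φ v w) :
    ResIsoTwistDual ε ρ ρ' := by
  let Ψ : M →ₗ[K] Twist ε (Module.Dual K M') :=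
    { toFun := fun v => Φ v
      map_add' := fun v w => Φ.map_add v w
      map_smul' := fun a v => Φ.map_smulₛₗ a v }
  refine ⟨Representation.Equiv.mk (LinearEquiv.ofBijective Ψ hΦ) fun g => LinearMap.ext fun v =>
    LinearMap.ext (f := Φ (ρ g v)) (g := (res ρ').dual g (Φ v)) fun w => ?_⟩
  change Φ (ρ g v) w = Φ v (ρ' (g⁻¹ : commutator (ArtinD n)) w)
  have := form_invariant (B := fun v w => Φ v w) hc hB g.2 v (ρ' (g.1)⁻¹ w)
  rw [Representation.self_inv_apply] at this
  exact this

/-- A semilinear map into a dual space that is diagonal in suitable bases is bijective. -/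
theorem bijective_of_diagonal {θ : K →+* K} (hθ : Function.Bijective θ)
    {Φ : M →ₛₗ[θ] Module.Dual K M'} {ι ι' : Type*} [Finite ι] (b : Module.Basis ι K M)
    (b' : Module.Basis ι' K M') (e : ι ≃ ι') {d : ι → K} (hd : ∀ i, d i ≠ 0)
    (hdiag : ∀ i, Φ (b i) (b' (e i)) = d i) (hoff : ∀ i j, j ≠ e i → Φ (b i) (b' j) = 0) :
    Function.Bijective Φ := by
  have := Fintype.ofFinite ι
  have hval : ∀ v i, Φ v (b' (e i)) = θ (b.repr v i) * d i := by
    intro v i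
    conv_lhs => rw [← b.sum_repr v]
    rw [map_sum, LinearMap.sum_apply, Finset.sum_eq_single i]
    · rw [map_smulₛₗ, LinearMap.smul_apply, hdiag, smul_eq_mul]
    · intro j _ hj
      rw [map_smulₛₗ, LinearMap.smul_apply, hoff j _ (fun h => hj (e.injective h).symm), smul_zero]
    · simp
  constructor
  · intro v w hvw
    apply b.repr.injective
    ext i
    have h1 := hval v i
    rw [hvw, hval w i] at h1
    exact (hθ.1 (mul_right_cancel₀ (hd i) h1)).symm
  · intro f
    choose a ha using fun i => hθ.2 (f (b' (e i)) / d i)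
    refine ⟨∑ i, a i • b i, b'.ext fun j => ?_⟩
    obtain ⟨i, rfl⟩ := e.surjective j
    rw [hval, b.repr_sum_self, ha, div_mul_cancel₀ _ (hd i)]

end Forms

/-! ### Monomial forms on tableaux -/

section TableauForm

variable {K : Type*} [Field K] {n : ℕ} {α : K}

instance (l : DoublePartition n) : Fintype (StdTab l) := Fintype.ofFinite _

/-- The map on standard tableaux that moves all boxes by `tr`. -/
def mapTab {l l' : DoublePartition n} {tr : Bool × ℕ × ℕ → Bool × ℕ × ℕ}
    (htr : ∀ pos, IsStandard l pos → IsStandard l' (tr ∘ pos)) (t : StdTab l) : StdTab l' :=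
  ⟨tr ∘ t.1, htr _ t.2⟩

/-- The form that pairs a tableau `pos` of shape `l` with the tableau `tr ∘ pos` of shape `l'`, with
the value `D pos`; it is semilinear in the first variable. -/
def tabForm (θ : K →+* K) (D : (Fin n → Bool × ℕ × ℕ) → K) {l l' : DoublePartition n}
    {tr : Bool × ℕ × ℕ → Bool × ℕ × ℕ} (htr : ∀ pos, IsStandard l pos → IsStandard l' (tr ∘ pos)) :
    V K l →ₛₗ[θ] Module.Dual K (V K l') :=
  LinearMap.mk₂'ₛₗ θ (RingHom.id K)
    (fun v w => ∑ t : StdTab l, D t.1 * θ (v t) * w (mapTab htr t))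
    (fun v v' w => by
      simp only [Finsupp.add_apply, map_add, mul_add, add_mul, Finset.sum_add_distrib])
    (fun c v w => by
      simp only [Finsupp.smul_apply, smul_eq_mul, map_mul, Finset.mul_sum]
      exact Finset.sum_congr rfl fun t _ => by ring)
    (fun v w w' => by
      simp only [Finsupp.add_apply, mul_add, Finset.sum_add_distrib])
    (fun c v w => by
      simp only [Finsupp.smul_apply, smul_eq_mul, Finset.mul_sum, RingHom.id_apply]
      exact Finset.sum_congr rfl fun t _ => by ring)

variable {θ : K →+* K} {D : (Fin n → Bool × ℕ × ℕ) → K} {l l' : DoublePartition n}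
  {tr : Bool × ℕ × ℕ → Bool × ℕ × ℕ} {htr : ∀ pos, IsStandard l pos → IsStandard l' (tr ∘ pos)}

theorem tabForm_apply (v : V K l) (w : V K l') :
    tabForm θ D htr v w = ∑ t : StdTab l, D t.1 * θ (v t) * w (mapTab htr t) :=
  rfl

theorem tabForm_vec_self {pos : Fin n → Bool × ℕ × ℕ} (h : IsStandard l pos) :
    tabForm θ D htr (vec K l pos) (vec K l' (tr ∘ pos)) = D pos := by
  obtain ⟨t, rfl⟩ : ∃ t : StdTab l, t.1 = pos := ⟨⟨pos, h⟩, rfl⟩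
  have h' : vec K l' (tr ∘ t.1) = Finsupp.single (mapTab htr t) 1 := vec_coe (mapTab htr t)
  rw [tabForm_apply, Finset.sum_eq_single t, vec_coe, h', Finsupp.single_eq_same,
    Finsupp.single_eq_same, map_one, mul_one, mul_one]
  · intro s _ hs
    rw [vec_coe, Finsupp.single_eq_of_ne hs, map_zero, mul_zero, zero_mul]
  · simp

theorem tabForm_vec_of_ne {pos pos' : Fin n → Bool × ℕ × ℕ} (h : pos' ≠ tr ∘ pos) :
    tabForm θ D htr (vec K l pos) (vec K l' pos') = 0 := by
  by_cases h1 : IsStandard l pos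
  · by_cases h3 : IsStandard l' pos'
    · obtain ⟨t, rfl⟩ : ∃ t : StdTab l, t.1 = pos := ⟨⟨pos, h1⟩, rfl⟩
      obtain ⟨t', rfl⟩ : ∃ t : StdTab l', t.1 = pos' := ⟨⟨pos', h3⟩, rfl⟩
      rw [tabForm_apply]
      refine Finset.sum_eq_zero fun s _ => ?_
      rw [vec_coe, vec_coe]
      by_cases hs : s = t
      · have : mapTab htr s ≠ t' := by
          rw [hs]
          exact fun he => h (congrArg Subtype.val he).symm
        rw [Finsupp.single_eq_of_ne this, mul_zero]
      · rw [Finsupp.single_eq_of_ne hs, map_zero, mul_zero, zero_mul]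
    · rw [vec_of_not h3, map_zero]
  · rw [vec_of_not h1, map_zero, LinearMap.zero_apply]

theorem tabForm_induction {A : Module.End K (V K l)} {A' : Module.End K (V K l')} {c : K}
    (h : ∀ pos pos', IsStandard l pos → IsStandard l' pos' →
      tabForm θ D htr (A (vec K l pos)) (A' (vec K l' pos')) =
        c * tabForm θ D htr (vec K l pos) (vec K l' pos')) (v : V K l) (w : V K l') :
    tabForm θ D htr (A v) (A' w) = c * tabForm θ D htr v w := by
  induction v using Finsupp.induction_linear with
  | zero => simp
  | add v v' hv hv' => simp only [map_add, LinearMap.add_apply, hv, hv', mul_add]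
  | single t a =>
    induction w using Finsupp.induction_linear with
    | zero => simp
    | add w w' hw hw' => simp only [map_add, hw, hw', mul_add]
    | single t' a' =>
      have e1 : (Finsupp.single t a : V K l) = a • vec K l t.1 := by simp [vec_coe]
      have e2 : (Finsupp.single t' a' : V K l') = a' • vec K l' t'.1 := by simp [vec_coe]
      rw [e1, e2]
      simp only [map_smul, map_smulₛₗ, LinearMap.smul_apply, smul_eq_mul]
      rw [h _ _ t.2 t'.2]
      ring

/-- `opS` mixes a tableau only with its exchange, so two conditions suffice: `hdiag` for the pairing
of `pos` with its own partner, `hoff` for that with the partner of its exchange. All other pairings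
vanish. -/
theorem tabForm_opS {c : K} (htr2 : ∀ b, tr (tr b) = b)
    (hdiag : ∀ pos i, IsStandard l pos →
      θ (mb α (pos (lo i)) (pos (hi i))) * mb α (tr (pos (lo i))) (tr (pos (hi i))) * D pos +
        θ (gb α (pos (lo i)) (pos (hi i))) * gb α (tr (pos (lo i))) (tr (pos (hi i))) *
          D (pos ∘ Equiv.swap (lo i) (hi i)) = c * D pos)
    (hoff : ∀ pos i, IsStandard l pos →
      θ (mb α (pos (lo i)) (pos (hi i))) * gb α (tr (pos (hi i))) (tr (pos (lo i))) * D pos +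
        θ (gb α (pos (lo i)) (pos (hi i))) * mb α (tr (pos (hi i))) (tr (pos (lo i))) *
          D (pos ∘ Equiv.swap (lo i) (hi i)) = 0)
    (i : Fin (n - 1)) (v : V K l) (w : V K l') :
    tabForm θ D htr (opS α 1 l i v) (opS α 1 l' i w) = c * tabForm θ D htr v w := by
  refine tabForm_induction (fun p p' h h' => ?_) v w
  set s := Equiv.swap (lo i) (hi i) with hs
  have hss : ∀ q : Fin n → Bool × ℕ × ℕ, (q ∘ s) ∘ s = q := fun q => swap_swap_comp q _ _
  have hne : p ∘ s ≠ p := comp_swap_ne h i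
  have htrinj : ∀ {q q' : Fin n → Bool × ℕ × ℕ}, tr ∘ q = tr ∘ q' → q = q' := by
    intro q q' hq
    funext j
    have := congrArg tr (congrFun hq j)
    simpa [htr2] using this
  have hg0 : ¬ IsStandard l (p ∘ s) → gb α (p (lo i)) (p (hi i)) = 0 := fun hn => by
    rw [hs, h.swap_iff, not_not] at hn
    rw [gb, if_pos hn]
  -- If the exchange is not standard, the value `D (p ∘ s)` is meaningless, but its coefficient `gb`
  -- is zero.
  have hself : θ (gb α (p (lo i)) (p (hi i))) *
      tabForm θ D htr (vec K l (p ∘ s)) (vec K l' (tr ∘ p ∘ s)) =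
        θ (gb α (p (lo i)) (p (hi i))) * D (p ∘ s) := by
    by_cases hps : IsStandard l (p ∘ s)
    · rw [tabForm_vec_self hps]
    · rw [hg0 hps, map_zero, zero_mul, zero_mul]
  rw [opS_vec, opS_vec]
  simp only [map_add, map_smul, map_smulₛₗ, LinearMap.add_apply, LinearMap.smul_apply, smul_eq_mul]
  by_cases h1 : p' = tr ∘ p
  · subst h1
    have hsf : (tr ∘ p) ∘ s = tr ∘ (p ∘ s) := rfl
    rw [← hs, hsf, hself, tabForm_vec_self h,
      tabForm_vec_of_ne (pos := p) (fun he => hne (htrinj he)),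
      tabForm_vec_of_ne (pos := p ∘ s) (pos' := tr ∘ p) (fun he => hne (htrinj he).symm)]
    simp only [Function.comp_apply]
    linear_combination hdiag p i h
  · rw [tabForm_vec_of_ne (pos := p) h1]
    by_cases h3 : p' = tr ∘ (p ∘ s)
    · have hsf : (tr ∘ (p ∘ s)) ∘ s = tr ∘ p := by
        rw [Function.comp_assoc, hss]
      subst h3
      rw [← hs, hsf, hself, tabForm_vec_self h,
        tabForm_vec_of_ne (pos := p ∘ s) (pos' := tr ∘ p) (fun he => hne (htrinj he).symm)]
      have v1 : s (lo i) = hi i := Equiv.swap_apply_left _ _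
      have v2 : s (hi i) = lo i := Equiv.swap_apply_right _ _
      simp only [Function.comp_apply, v1, v2]
      linear_combination hoff p i h
    · have h4 : p' ∘ s ≠ tr ∘ p := fun he => h3 (by
        rw [← hss p', he]; rfl)
      have h5 : p' ∘ s ≠ tr ∘ (p ∘ s) := fun he => h1 (by
        rw [← hss p', he, ← Function.comp_assoc, hss])
      rw [← hs, tabForm_vec_of_ne h3, tabForm_vec_of_ne h4, tabForm_vec_of_ne h5]
      ring

theorem tabForm_opT (hn : 0 < n)
    (hT : ∀ pos : Fin n → Bool × ℕ × ℕ, IsStandard l pos →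
      θ (ctb α (pos ⟨0, hn⟩)) * ctb α (tr (pos ⟨0, hn⟩)) = 1) (v : V K l) (w : V K l') :
    tabForm θ D htr (opT 1 hn l v) (opT 1 hn l' w) = tabForm θ D htr v w := by
  rw [← one_mul (tabForm θ D htr v w)]
  refine tabForm_induction (fun p p' h h' => ?_) v w
  rw [opT_eq_opD α, opT_eq_opD α, opD_vec, opD_vec, one_mul]
  simp only [map_smul, map_smulₛₗ, LinearMap.smul_apply, smul_eq_mul]
  by_cases h1 : p' = tr ∘ p
  · subst h1
    rw [Function.comp_apply]
    linear_combination tabForm θ D htr (vec K l p) (vec K l' (tr ∘ p)) * hT p h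
  · rw [tabForm_vec_of_ne h1, mul_zero, mul_zero]

/-- The compatibility conditions for the form `tabForm` to be multiplied by `c` by the generators of
the Artin group. -/
structure IsCompatible (α : K) (θ : K →+* K) (D : (Fin n → Bool × ℕ × ℕ) → K)
    (l : DoublePartition n) (tr : Bool × ℕ × ℕ → Bool × ℕ × ℕ) (c : K) : Prop where
  involutive : ∀ b, tr (tr b) = b
  diag : ∀ pos i, IsStandard l pos →
    θ (mb α (pos (lo i)) (pos (hi i))) * mb α (tr (pos (lo i))) (tr (pos (hi i))) * D pos +
      θ (gb α (pos (lo i)) (pos (hi i))) * gb α (tr (pos (lo i))) (tr (pos (hi i))) *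
        D (pos ∘ Equiv.swap (lo i) (hi i)) = c * D pos
  off : ∀ pos i, IsStandard l pos →
    θ (mb α (pos (lo i)) (pos (hi i))) * gb α (tr (pos (hi i))) (tr (pos (lo i))) * D pos +
      θ (gb α (pos (lo i)) (pos (hi i))) * mb α (tr (pos (hi i))) (tr (pos (lo i))) *
        D (pos ∘ Equiv.swap (lo i) (hi i)) = 0
  zero : ∀ (hn : 0 < n) pos, IsStandard l pos →
    θ (ctb α (pos ⟨0, hn⟩)) * ctb α (tr (pos ⟨0, hn⟩)) = 1
  ne_zero : ∀ pos, IsStandard l pos → D pos ≠ 0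

theorem IsCompatible.tabForm_gen {c : K} (h : IsCompatible α θ D l tr c) (h2 : (2 : K) ≠ 0)
    (hα : 2 * n < orderOf α) (hn : 1 < n) (x : ArtinGen n) (v : V K l) (w : V K l') :
    tabForm θ D htr (hoefsmit l h2 hα hn (gen x) v) (hoefsmit l' h2 hα hn (gen x) w) =
      c * tabForm θ D htr v w := by
  rw [hoefsmit_gen, hoefsmit_gen]
  cases x with
  | s i => exact tabForm_opS h.involutive h.diag h.off i v w
  | u =>
    simp only [opGen, opU_eq, Module.End.mul_apply]
    rw [tabForm_opT _ (h.zero (by omega)), tabForm_opS h.involutive h.diag h.off,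
      tabForm_opT _ (h.zero (by omega))]

theorem IsCompatible.bijective_tabForm {c : K} (h : IsCompatible α θ D l tr c)
    (hθ : Function.Bijective θ) (htr' : ∀ pos, IsStandard l' pos → IsStandard l (tr ∘ pos)) :
    Function.Bijective (tabForm θ D htr) := by
  have hcomp : ∀ p : Fin n → Bool × ℕ × ℕ, tr ∘ tr ∘ p = p := fun p =>
    funext fun j => h.involutive _
  let e : StdTab l ≃ StdTab l' :=
    { toFun := fun t => ⟨tr ∘ t.1, htr _ t.2⟩
      invFun := fun t => ⟨tr ∘ t.1, htr' _ t.2⟩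
      left_inv := fun t => Subtype.ext (hcomp t.1)
      right_inv := fun t => Subtype.ext (hcomp t.1) }
  refine bijective_of_diagonal hθ Finsupp.basisSingleOne Finsupp.basisSingleOne e
    (d := fun t => D t.1) (fun t => h.ne_zero _ t.2) (fun t => ?_) fun t t' ht => ?_
  · rw [basisSingleOne_eq_vec, basisSingleOne_eq_vec]
    exact tabForm_vec_self t.2
  · rw [basisSingleOne_eq_vec, basisSingleOne_eq_vec]
    exact tabForm_vec_of_ne fun he => ht (Subtype.ext he)

end TableauForm

/-! ### Forms on the symmetrized spaces -/

section SymmetrizedForm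

variable {K : Type*} [Field K] {n : ℕ} {α : K} {θ : K →+* K} {D : (Fin n → Bool × ℕ × ℕ) → K}
  {g g' : DoublePartition n} {tr : Bool × ℕ × ℕ → Bool × ℕ × ℕ}

/-- The restriction of `tabForm` to the symmetrized spaces. -/
def tabFormPM (θ : K →+* K) (D : (Fin n → Bool × ℕ × ℕ) → K)
    (htr : ∀ pos, IsStandard g pos → IsStandard g' (tr ∘ pos)) (hg : g.fst = g.snd)
    (hg' : g'.fst = g'.snd) (s s' : ℤˣ) :
    Vpm K g hg s →ₛₗ[θ] Module.Dual K (Vpm K g' hg' s') :=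
  (Vpm K g' hg' s').subtype.dualMap.comp ((tabForm θ D htr).comp (Vpm K g hg s).subtype)

theorem tabFormPM_apply {htr : ∀ pos, IsStandard g pos → IsStandard g' (tr ∘ pos)}
    {hg : g.fst = g.snd} {hg' : g'.fst = g'.snd} {s s' : ℤˣ} (v : Vpm K g hg s)
    (w : Vpm K g' hg' s') :
    tabFormPM θ D htr hg hg' s s' v w = tabForm θ D htr (v : V K g) (w : V K g') :=
  rfl

/-- Since `tr` keeps components, a left tableau pairs only with a left one and its flip with the
flip. `hD` makes the two contributions equal, so the diagonal value is `2 * D`, nonzero as 2 is. -/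
theorem bijective_tabFormPM {c : K} (h : IsCompatible α θ D g tr c) (hθ : Function.Bijective θ)
    (h2 : (2 : K) ≠ 0) (hn : 1 < n)
    (htr : ∀ pos, IsStandard g pos → IsStandard g' (tr ∘ pos))
    (htr' : ∀ pos, IsStandard g' pos → IsStandard g (tr ∘ pos)) (hg : g.fst = g.snd)
    (hg' : g'.fst = g'.snd) (s s' : ℤˣ) (hflip : ∀ b, tr (flip b) = flip (tr b))
    (hfst : ∀ b, (tr b).1 = b.1)
    (hD : ∀ pos, IsStandard g pos → D (flip ∘ pos) = (((s * s' : ℤˣ) : ℤ) : K) * D pos) :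
    Function.Bijective (tabFormPM θ D htr hg hg' s s') := by
  have hcomp : ∀ p : Fin n → Bool × ℕ × ℕ, tr ∘ tr ∘ p = p := fun p =>
    funext fun j => h.involutive _
  have htrinj : ∀ {q q' : Fin n → Bool × ℕ × ℕ}, tr ∘ q = tr ∘ q' → q = q' := by
    intro q q' hq
    rw [← hcomp q, hq, hcomp]
  have hfc : ∀ p : Fin n → Bool × ℕ × ℕ, tr ∘ flip ∘ p = flip ∘ tr ∘ p := fun p =>
    funext fun j => hflip _
  let e : LeftTab hn g ≃ LeftTab hn g' :=
    { toFun := fun t => ⟨mapTab htr t.1, (hfst _).trans t.2⟩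
      invFun := fun t => ⟨mapTab htr' t.1, (hfst _).trans t.2⟩
      left_inv := fun t => Subtype.ext (Subtype.ext (hcomp t.1.1))
      right_inv := fun t => Subtype.ext (Subtype.ext (hcomp t.1.1)) }
  have hval : ∀ (t : LeftTab hn g) (t' : LeftTab hn g'),
      tabFormPM θ D htr hg hg' s s' (basisVpm K hg hn s t) (basisVpm K hg' hn s' t') =
        tabForm θ D htr (vec K g t.1.1) (vec K g' t'.1.1) +
          ((s : ℤ) : K) * ((s' : ℤ) : K) *
            tabForm θ D htr (vec K g (flip ∘ t.1.1)) (vec K g' (flip ∘ t'.1.1)) := by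
    intro t t'
    rw [tabFormPM_apply, basisVpm_apply, basisVpm_apply, coe_toVpm, coe_toVpm, symmetrize_vec hg,
      symmetrize_vec hg']
    have n1 : flip ∘ t'.1.1 ≠ tr ∘ t.1.1 := fun he => by
      have h1 := congrArg Prod.fst (congrFun he ⟨0, by omega⟩)
      have h3 := t.2
      have h4 := t'.2
      simp [hfst, h3, flip, h4] at h1
    have n2 : t'.1.1 ≠ tr ∘ flip ∘ t.1.1 := fun he => n1 (by
      rw [he, hfc, flip_comp_flip_comp])
    simp only [map_add, map_zsmul, LinearMap.add_apply, LinearMap.smul_apply,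
      tabForm_vec_of_ne n1, tabForm_vec_of_ne n2, smul_zero, zero_add, add_zero]
    simp only [zsmul_eq_mul]
    ring
  refine bijective_of_diagonal hθ (basisVpm K hg hn s) (basisVpm K hg' hn s') e
    (d := fun t => 2 * D t.1.1) (fun t => mul_ne_zero h2 (h.ne_zero _ t.1.2)) (fun t => ?_)
    fun t t' ht => ?_
  · rw [hval]
    have e1 : (e t).1.1 = tr ∘ t.1.1 := rfl
    have hf := t.1.2.flip
    rw [DoublePartition.swap_eq_self hg] at hf
    rw [e1, ← hfc, tabForm_vec_self t.1.2, tabForm_vec_self hf, hD _ t.1.2, Units.val_mul,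
      Int.cast_mul]
    linear_combination D t.1.1 * (((s' : ℤ) : K) * ((s' : ℤ) : K) * unit_cast_mul_self (K := K) s +
      unit_cast_mul_self (K := K) s')
  · have n1 : t'.1.1 ≠ tr ∘ t.1.1 := fun he => ht (Subtype.ext (Subtype.ext he))
    rw [hval, tabForm_vec_of_ne n1, tabForm_vec_of_ne, mul_zero, add_zero]
    rw [hfc]
    intro he
    apply n1
    rw [← flip_comp_flip_comp t'.1.1, he, flip_comp_flip_comp]

end SymmetrizedForm

/-! ### Products over the pairs of entries of a tableau -/

section PairProd

variable {n : ℕ} {R : Type*} [CommRing R]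

/-- The product of the values of `h` at the pairs of boxes with entries `j < k`. -/
def pairProd (h : Bool × ℕ × ℕ → Bool × ℕ × ℕ → R) (pos : Fin n → Bool × ℕ × ℕ) : R :=
  ∏ j, ∏ k ∈ Finset.Ioi j, h (pos j) (pos k)

theorem pairProd_eq (h : Bool × ℕ × ℕ → Bool × ℕ × ℕ → R) (pos : Fin n → Bool × ℕ × ℕ) :
    pairProd h pos =
      ∏ x ∈ Finset.univ.filter fun x : Fin n × Fin n => x.1 < x.2, h (pos x.1) (pos x.2) := by
  rw [pairProd, Finset.prod_sigma']
  refine Finset.prod_bij' (fun x _ => (x.1, x.2)) (fun x _ => ⟨x.1, x.2⟩) ?_ ?_ ?_ ?_ ?_ <;> simp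

/-- The exchange of two consecutive entries permutes all ordered pairs except the pair of those two
entries, which it reverses. -/
theorem pairProd_swap (h : Bool × ℕ × ℕ → Bool × ℕ × ℕ → R) (pos : Fin n → Bool × ℕ × ℕ)
    (i : Fin (n - 1)) :
    pairProd h (pos ∘ Equiv.swap (lo i) (hi i)) * h (pos (lo i)) (pos (hi i)) =
      pairProd h pos * h (pos (hi i)) (pos (lo i)) := by
  set s := Equiv.swap (lo i) (hi i) with hs
  have hmem : (lo i, hi i) ∈ Finset.univ.filter fun x : Fin n × Fin n => x.1 < x.2 := by
    simp [lo_lt_hi]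
  rw [pairProd_eq, pairProd_eq, ← Finset.mul_prod_erase _ _ hmem, ← Finset.mul_prod_erase _ _ hmem]
  have key : ∏ x ∈ (Finset.univ.filter fun x : Fin n × Fin n => x.1 < x.2).erase (lo i, hi i),
      h ((pos ∘ s) x.1) ((pos ∘ s) x.2) =
      ∏ x ∈ (Finset.univ.filter fun x : Fin n × Fin n => x.1 < x.2).erase (lo i, hi i),
        h (pos x.1) (pos x.2) := by
    have hm : ∀ x ∈ (Finset.univ.filter fun x : Fin n × Fin n => x.1 < x.2).erase (lo i, hi i),
        (s x.1, s x.2) ∈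
          (Finset.univ.filter fun x : Fin n × Fin n => x.1 < x.2).erase (lo i, hi i) := by
      rintro ⟨j, k⟩ hx
      simp only [Finset.mem_erase, ne_eq, Prod.mk.injEq, Finset.mem_filter, Finset.mem_univ,
        true_and, not_and, hs, Equiv.swap_apply_def, Fin.lt_def, Fin.ext_iff, lo, hi] at hx ⊢
      split_ifs <;> simp <;> omega
    refine Finset.prod_bij' (fun x _ => (s x.1, s x.2)) (fun x _ => (s x.1, s x.2)) hm hm ?_ ?_ ?_
    · intro x _; simp [hs]
    · intro x _; simp [hs]
    · intro x _; rfl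
  rw [key]
  simp only [Function.comp_apply, hs, Equiv.swap_apply_left, Equiv.swap_apply_right]
  ring

theorem pairProd_ne_zero [IsDomain R] {h : Bool × ℕ × ℕ → Bool × ℕ × ℕ → R}
    (hh : ∀ x y, h x y ≠ 0) (pos : Fin n → Bool × ℕ × ℕ) : pairProd h pos ≠ 0 :=
  Finset.prod_ne_zero_iff.mpr fun _ _ => Finset.prod_ne_zero_iff.mpr fun _ _ => hh _ _

/-- Every index belongs to `n - 1` pairs. -/
theorem prod_Ioi_mul (e : Fin n → R) :
    ∏ j, ∏ k ∈ Finset.Ioi j, e j * e k = (∏ j, e j) ^ (n - 1) := by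
  simp only [Finset.prod_mul_distrib]
  have h1 : ∏ j, ∏ k ∈ Finset.Ioi j, e k = ∏ k, ∏ j ∈ Finset.Iio k, e k :=
    Finset.prod_comm' (by simp)
  rw [h1, ← Finset.prod_mul_distrib, ← Finset.prod_pow]
  refine Finset.prod_congr rfl fun j _ => ?_
  rw [Finset.prod_const, Finset.prod_const, ← pow_add, Fin.card_Ioi, Fin.card_Iio]
  congr 1
  omega

/-- The sign `1` for boxes in the left component and `-1` for boxes in the right component. -/
def compSign (R : Type*) [CommRing R] (b : Bool × ℕ × ℕ) : R := if b.1 = false then 1 else -1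

theorem IsStandard.prod_compSign {l : DoublePartition n} {pos : Fin n → Bool × ℕ × ℕ}
    (h : IsStandard l pos) : ∏ j, compSign R (pos j) = (-1) ^ l.snd.card := by
  have h1 : ∏ j, compSign R (pos j) = ∏ b ∈ l.boxFinset, compSign R b := by
    refine Finset.prod_bij (fun j _ => pos j) (fun j _ => ?_) (fun j _ k _ hjk => h.injective hjk)
      (fun b hb => ?_) (fun _ _ => rfl)
    · rw [← Finset.mem_coe, DoublePartition.coe_boxFinset]; exact h.mem j
    · rw [← Finset.mem_coe, DoublePartition.coe_boxFinset] at hb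
      obtain ⟨j, hj⟩ := h.exists_pos hb
      exact ⟨j, Finset.mem_univ _, hj⟩
  rw [h1, DoublePartition.boxFinset, Finset.prod_union, Finset.prod_product, Finset.prod_product]
  · simp [compSign]
  · rw [Finset.disjoint_left]
    rintro ⟨b, x⟩ h h'
    simp only [Finset.mem_product, Finset.mem_singleton] at h h'
    simp [h.1] at h'

end PairProd

/-! ### Duality and transposition -/

section Transpose

variable {K : Type*} [Field K] {n : ℕ} {α : K}

/-- The transposition of a box. -/
def trans (b : Bool × ℕ × ℕ) : Bool × ℕ × ℕ := (b.1, b.2.2, b.2.1)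

@[simp] theorem trans_trans (b : Bool × ℕ × ℕ) : trans (trans b) = b := rfl

theorem trans_flip (b : Bool × ℕ × ℕ) : trans (flip b) = flip (trans b) := rfl

theorem comparable_trans (b b' : Bool × ℕ × ℕ) :
    Comparable (trans b) (trans b') ↔ Comparable b b' := by
  simp only [Comparable, trans, Prod.le_def]
  tauto

theorem ctb_trans (b : Bool × ℕ × ℕ) : ctb α (trans b) = (ctb α b)⁻¹ := by
  have h : content (trans b) = -content b := by simp [content, trans]
  unfold ctb
  rw [h, zpow_neg]
  change (if b.1 = false then _ else _) = _
  split_ifs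
  · rfl
  · rw [inv_neg]

theorem mb_trans (b b' : Bool × ℕ × ℕ) : mb α (trans b) (trans b') = mb α b' b := by
  rw [mb, mb, ctb_trans, ctb_trans, inv_div_inv]

theorem gb_trans (b b' : Bool × ℕ × ℕ) : gb α (trans b) (trans b') = gb α b' b := by
  by_cases hc : Comparable b b'
  · rw [gb, gb, if_pos hc.symm, if_pos ((comparable_trans b b').mpr hc)]
  · rw [gb, if_neg (mt (comparable_trans b b').mp hc), gb, if_neg (mt Comparable.symm hc), mb_trans]

theorem DoublePartition.mem_boxes_conj {l : DoublePartition n} {b : Bool × ℕ × ℕ} :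
    b ∈ l.conj.boxes ↔ trans b ∈ l.boxes := by
  obtain ⟨x, r, c⟩ := b
  cases x <;> simp [boxes, comp, conj, trans, YoungDiagram.mem_transpose]

theorem DoublePartition.conj_conj (l : DoublePartition n) : l.conj.conj = l := by
  ext1 <;> simp [conj]

theorem IsStandard.trans {l : DoublePartition n} {pos : Fin n → Bool × ℕ × ℕ}
    (h : IsStandard l pos) : IsStandard l.conj (trans ∘ pos) := by
  refine ⟨⟨fun j _ => ?_, fun j _ k _ hjk => ?_, fun b hb => ?_⟩, fun j k h1 h2 => ?_⟩
  · exact DoublePartition.mem_boxes_conj.mpr (h.mem j)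
  · exact h.injective (by simpa using congrArg TypeD.trans hjk)
  · obtain ⟨j, hj⟩ := h.exists_pos (DoublePartition.mem_boxes_conj.mp hb)
    exact ⟨j, Set.mem_univ _, by rw [Function.comp_apply, hj, trans_trans]⟩
  · exact h.2 j k h1 ⟨h2.2, h2.1⟩

theorem IsStandard.trans_of_conj {l : DoublePartition n} {pos : Fin n → Bool × ℕ × ℕ}
    (h : IsStandard l.conj pos) : IsStandard l (TypeD.trans ∘ pos) := by
  have := h.trans
  rwa [DoublePartition.conj_conj] at this

/-- The lexicographic order on boxes. -/
def Precedes (x y : Bool × ℕ × ℕ) : Prop :=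
  x.1 < y.1 ∨ x.1 = y.1 ∧ (x.2.1 < y.2.1 ∨ x.2.1 = y.2.1 ∧ x.2.2 < y.2.2)

theorem precedes_or_precedes {x y : Bool × ℕ × ℕ} (h : x ≠ y) : Precedes x y ∨ Precedes y x := by
  obtain ⟨x, r, c⟩ := x
  obtain ⟨y, r', c'⟩ := y
  simp only [ne_eq, Prod.mk.injEq, Precedes] at *
  cases x <;> cases y <;> simp at * <;> omega

theorem Precedes.asymm {x y : Bool × ℕ × ℕ} (h : Precedes x y) : ¬ Precedes y x := by
  obtain ⟨x, r, c⟩ := x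
  obtain ⟨y, r', c'⟩ := y
  revert h
  simp only [Precedes]
  cases x <;> cases y <;> simp <;> omega

open Classical in
/-- The sign `1` for boxes in lexicographic order, and `-1` otherwise. -/
def lexSign (R : Type*) [CommRing R] (x y : Bool × ℕ × ℕ) : R := if Precedes x y then 1 else -1

theorem lexSign_mul_self (x y : Bool × ℕ × ℕ) : lexSign K x y * lexSign K x y = 1 := by
  unfold lexSign
  split_ifs <;> simp

theorem lexSign_comm {x y : Bool × ℕ × ℕ} (h : x ≠ y) : lexSign K y x = -lexSign K x y := by
  unfold lexSign
  rcases precedes_or_precedes h with h1 | h1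
  · rw [if_pos h1, if_neg h1.asymm]
  · rw [if_pos h1, if_neg h1.asymm, neg_neg]

/-- Inside a component `flip` preserves the lexicographic order; across components it reverses it,
and this is where the product of the component signs is -1. -/
theorem lexSign_flip {x y : Bool × ℕ × ℕ} : lexSign K (flip x) (flip y) =
    compSign K x * compSign K y * lexSign K x y := by
  obtain ⟨x, r, c⟩ := x
  obtain ⟨y, r', c'⟩ := y
  unfold lexSign compSign Precedes
  cases x <;> cases y <;> simp [flip]

/-- The sign of a tableau, as the parity of its inversions. -/
def tabSign (K : Type*) [Field K] (pos : Fin n → Bool × ℕ × ℕ) : K := pairProd (lexSign K) pos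

theorem tabSign_swap {l : DoublePartition n} {pos : Fin n → Bool × ℕ × ℕ} (h : IsStandard l pos)
    (i : Fin (n - 1)) : tabSign K (pos ∘ Equiv.swap (lo i) (hi i)) = -tabSign K pos := by
  have h1 := pairProd_swap (lexSign K) pos i
  rw [lexSign_comm (fun he => lo_ne_hi i (h.injective he))] at h1
  have h3 := lexSign_mul_self (K := K) (pos (lo i)) (pos (hi i))
  unfold tabSign
  linear_combination lexSign K (pos (lo i)) (pos (hi i)) * h1 +
    (-pairProd (lexSign K) (pos ∘ Equiv.swap (lo i) (hi i)) - pairProd (lexSign K) pos) * h3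

/-- Each of the (n/2)² pairs of boxes in different components contributes -1. In the computation
this appears as the exponent `(n / 2) * (n - 1)`, with `n - 1` odd. -/
theorem tabSign_flip {g : DoublePartition n} (hg : g.fst = g.snd) (hn : 0 < n)
    {pos : Fin n → Bool × ℕ × ℕ} (h : IsStandard g pos) :
    tabSign K (flip ∘ pos) = (-1) ^ (n / 2) * tabSign K pos := by
  have hc := g.card_add_card
  rw [hg] at hc
  have h1 : g.snd.card = n / 2 := by omega
  have hodd : Odd (n - 1) := ⟨n / 2 - 1, by omega⟩
  simp only [tabSign, pairProd, Function.comp_apply, lexSign_flip]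
  rw [← h1]
  simp only [Finset.prod_mul_distrib (f := fun k => compSign K _ * compSign K _)]
  rw [Finset.prod_mul_distrib, prod_Ioi_mul (fun j => compSign K (pos j)), h.prod_compSign,
    ← pow_mul, mul_comm g.snd.card, pow_mul, hodd.neg_one_pow]

variable (l : DoublePartition n)

/-- Transposition interchanges the two diagonal coefficients m and m' of a block, while the sign
changes under the exchange. The constant is m m' - (1 + m)(1 + m') = -1 - (α - 1) = -α. -/
theorem isCompatible_trans (h2 : (2 : K) ≠ 0) (hα : 2 * n < orderOf α) :
    IsCompatible α (RingHom.id K) (tabSign K) l trans (-α) where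
  involutive := trans_trans
  diag pos i h := by
    have h0 := ne_zero_of_orderOf hα
    have hm := mb_add_mb h0 (h.ctb_ne h2 hα (lo_lt_hi i) (by simp [lo, hi]))
    have hgg := gb_mul_gb h h2 hα (i := lo i) (k := hi i) (by simp [lo, hi])
    simp only [RingHom.id_apply, mb_trans, gb_trans, tabSign_swap h i]
    linear_combination -tabSign K pos * hgg - tabSign K pos * hm
  off pos i h := by
    simp only [RingHom.id_apply, mb_trans, gb_trans, tabSign_swap h i]
    ring
  zero hn pos h := by
    rw [RingHom.id_apply, ctb_trans, mul_inv_cancel₀]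
    rw [h.ctb_zero hn]
    split_ifs <;> simp
  ne_zero pos _ := pairProd_ne_zero (fun x y he => by
    have := lexSign_mul_self (K := K) x y
    simp [he] at this) _

theorem resIsoDual_conj (h2 : (2 : K) ≠ 0) (hα : 2 * n < orderOf α) (hn : 1 < n) :
    ResIsoDual (hoefsmit l h2 hα hn) (hoefsmit l.conj h2 hα hn) :=
  resIsoDual_of_form (Φ := tabForm (RingHom.id K) (tabSign K) fun _ => IsStandard.trans)
    ((isCompatible_trans l h2 hα).bijective_tabForm Function.bijective_id
      fun _ => IsStandard.trans_of_conj)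
    (neg_ne_zero.mpr (ne_zero_of_orderOf hα))
    ((isCompatible_trans l h2 hα).tabForm_gen h2 hα hn)

theorem DoublePartition.conj_fst_eq_snd {g : DoublePartition n} (hg : g.fst = g.snd) :
    g.conj.fst = g.conj.snd := congrArg YoungDiagram.transpose hg

/-- The condition on `s * s'` is the behaviour of the inversion sign under σ; it decides whether
duality preserves or exchanges the two halves. -/
theorem resIsoDual_conj_PM {g g' : DoublePartition n} (hg : g.fst = g.snd) (hg' : g'.fst = g'.snd)
    (hgg : g' = g.conj) (h2 : (2 : K) ≠ 0) (hα : 2 * n < orderOf α) (hn : 1 < n) (s s' : ℤˣ)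
    (hs : s * s' = (-1) ^ (n / 2)) :
    ResIsoDual (V := Vpm K g hg s) (W := Vpm K g' hg' s') (hoefsmitPM h2 hα hn g hg s)
      (hoefsmitPM h2 hα hn g' hg' s') := by
  subst hgg
  refine resIsoDual_of_form (M := Vpm K g hg s) (M' := Vpm K g.conj hg' s')
    (Φ := tabFormPM (RingHom.id K) (tabSign K) (fun _ => IsStandard.trans) hg hg' s s')
    (bijective_tabFormPM (isCompatible_trans g h2 hα) Function.bijective_id h2 hn _
      (fun _ => IsStandard.trans_of_conj) hg hg' s s' trans_flip (fun _ => rfl) fun pos h => ?_)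
    (neg_ne_zero.mpr (ne_zero_of_orderOf hα))
    fun x v w => (isCompatible_trans g h2 hα).tabForm_gen h2 hα hn x _ _
  rw [tabSign_flip hg (by omega) h, hs]
  simp

theorem resIso_swap (h2 : (2 : K) ≠ 0) (hα : 2 * n < orderOf α) (hn : 1 < n) :
    ResIso (hoefsmit l h2 hα hn) (hoefsmit l.swap h2 hα hn) := by
  have e : ∀ l l' : DoublePartition n, l' = l.swap → l = l'.swap →
      opFlip K l' l ∘ₗ opFlip K l l' = LinearMap.id := by
    intro l l' h h'
    refine linearMap_ext_vec fun pos _ => ?_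
    rw [LinearMap.comp_apply, opFlip_vec h, opFlip_vec h', flip_comp_flip_comp, LinearMap.id_apply]
  exact ⟨Representation.Equiv.mk (LinearEquiv.ofLinearMap (opFlip K l l.swap) (opFlip K l.swap l)
    (e _ _ rfl rfl) (e _ _ rfl rfl)) fun g => LinearMap.ext fun v =>
      opFlip_hoefsmit rfl h2 hα hn g v⟩

end Transpose

/-! ### Duality and the involution of the field -/

section Unitary

variable {K : Type*} [Field K] {n : ℕ} {α : K} {θ : K →+* K}

theorem map_ctb (hθ : θ α = α⁻¹) (b : Bool × ℕ × ℕ) : θ (ctb α b) = (ctb α b)⁻¹ := by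
  unfold ctb
  split_ifs
  · rw [map_zpow₀, hθ, inv_zpow]
  · rw [map_neg, map_zpow₀, hθ, inv_zpow, inv_neg]

theorem map_mb (h0 : α ≠ 0) (hθ : θ α = α⁻¹) (b b' : Bool × ℕ × ℕ) :
    θ (mb α b b') = -α⁻¹ * mb α b' b := by
  simp only [mb, map_div₀, map_sub, map_one, hθ, map_ctb hθ, inv_div_inv]
  rw [← mul_div_assoc]
  congr 1
  field_simp
  ring

theorem map_gb (h0 : α ≠ 0) (hθ : θ α = α⁻¹) {b b' : Bool × ℕ × ℕ} (h : ctb α b ≠ ctb α b') :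
    θ (gb α b b') = α⁻¹ * gb α b b' := by
  by_cases hc : Comparable b b'
  · rw [gb, if_pos hc, map_zero, mul_zero]
  · rw [gb, if_neg hc, map_add, map_one, map_mb h0 hθ]
    have h1 := mb_add_mb h0 h
    have h3 : α⁻¹ * α = 1 := inv_mul_cancel₀ h0
    linear_combination -α⁻¹ * h1 - h3

open Classical in
/-- The coefficient `gb`, with the value `0` replaced by `1`. -/
def gbUnit (α : K) (x y : Bool × ℕ × ℕ) : K := if gb α x y = 0 then 1 else gb α x y

theorem gbUnit_ne_zero (x y : Bool × ℕ × ℕ) : gbUnit α x y ≠ 0 := by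
  unfold gbUnit
  split_ifs with h
  · exact one_ne_zero
  · exact h

/-- The product is built so that an exchange multiplies it by the ratio of the two off-diagonal
coefficients, which makes the form invariant. For comparable boxes both sides are 0; the value 1 in
`gbUnit` only keeps the product nonzero. -/
theorem gb_mul_pairProd_swap {l : DoublePartition n} {pos : Fin n → Bool × ℕ × ℕ}
    (h : IsStandard l pos) (h2 : (2 : K) ≠ 0) (hα : 2 * n < orderOf α) (i : Fin (n - 1)) :
    gb α (pos (lo i)) (pos (hi i)) *
        pairProd (gbUnit α) (pos ∘ Equiv.swap (lo i) (hi i)) =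
      gb α (pos (hi i)) (pos (lo i)) * pairProd (gbUnit α) pos := by
  by_cases hs : IsStandard l (pos ∘ Equiv.swap (lo i) (hi i))
  · have h1 := pairProd_swap (gbUnit α) pos i
    have g1 := gb_ne_zero h h2 hα hs
    have g2 := gb_ne_zero hs h2 hα (i := i) (by rw [swap_swap_comp]; exact h)
    simp only [Function.comp_apply, Equiv.swap_apply_left, Equiv.swap_apply_right] at g2
    rw [gbUnit, if_neg g1, gbUnit, if_neg g2] at h1
    rw [mul_comm, h1, mul_comm]
  · rw [h.swap_iff, not_not] at hs
    rw [gb, if_pos hs, gb, if_pos hs.symm, zero_mul, zero_mul]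

/-- As `θ` inverts `α`, it sends m to -α⁻¹ m' and multiplies off-diagonal coefficients by α⁻¹. The
block then gives α⁻¹ ((1 + m)(1 + m') - m m') = 1. -/
theorem isCompatible_id (l : DoublePartition n) (h2 : (2 : K) ≠ 0) (hα : 2 * n < orderOf α)
    (hθ : θ α = α⁻¹) : IsCompatible α θ (pairProd (gbUnit α)) l id 1 where
  involutive _ := rfl
  diag pos i h := by
    have h0 := ne_zero_of_orderOf hα
    have hne := h.ctb_ne h2 hα (lo_lt_hi i) (by simp [lo, hi])
    have hm := mb_add_mb h0 hne
    have hgg := gb_mul_gb h h2 hα (i := lo i) (k := hi i) (by simp [lo, hi])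
    have hs := gb_mul_pairProd_swap h h2 hα i
    have h3 : α⁻¹ * α = 1 := inv_mul_cancel₀ h0
    simp only [id_eq, map_mb h0 hθ, map_gb h0 hθ hne]
    linear_combination α⁻¹ * gb α (pos (lo i)) (pos (hi i)) * hs +
      α⁻¹ * pairProd (gbUnit α) pos * hgg + α⁻¹ * pairProd (gbUnit α) pos * hm +
      pairProd (gbUnit α) pos * h3
  off pos i h := by
    have h0 := ne_zero_of_orderOf hα
    have hne := h.ctb_ne h2 hα (lo_lt_hi i) (by simp [lo, hi])
    have hs := gb_mul_pairProd_swap h h2 hα i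
    simp only [id_eq, map_mb h0 hθ, map_gb h0 hθ hne]
    linear_combination α⁻¹ * mb α (pos (hi i)) (pos (lo i)) * hs
  zero hn pos h := by
    rw [map_ctb hθ, id_eq, inv_mul_cancel₀ (ctb_ne_zero (ne_zero_of_orderOf hα) _)]
  ne_zero pos _ := pairProd_ne_zero gbUnit_ne_zero _

theorem resIsoTwistDual_self (l : DoublePartition n) (h2 : (2 : K) ≠ 0) (hα : 2 * n < orderOf α)
    (hn : 1 < n) {ε : K ≃+* K} (hε : ε.symm α = α⁻¹) :
    ResIsoTwistDual ε (hoefsmit l h2 hα hn) (hoefsmit l h2 hα hn) :=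
  resIsoTwistDual_of_form
    (Φ := tabForm (ε.symm : K →+* K) (pairProd (gbUnit α)) (tr := id) fun _ h => h)
    ((isCompatible_id l h2 hα hε).bijective_tabForm ε.symm.bijective fun _ h => h) one_ne_zero
    ((isCompatible_id l h2 hα hε).tabForm_gen h2 hα hn)

theorem resIsoTwistDual_self_PM {g : DoublePartition n} (hg : g.fst = g.snd) (h2 : (2 : K) ≠ 0)
    (hα : 2 * n < orderOf α) (hn : 1 < n) (s : ℤˣ) {ε : K ≃+* K} (hε : ε.symm α = α⁻¹) :
    ResIsoTwistDual (V := Vpm K g hg s) (W := Vpm K g hg s) ε (hoefsmitPM h2 hα hn g hg s)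
      (hoefsmitPM h2 hα hn g hg s) := by
  refine resIsoTwistDual_of_form (M := Vpm K g hg s) (M' := Vpm K g hg s)
    (Φ := tabFormPM (ε.symm : K →+* K) (pairProd (gbUnit α)) (tr := id) (fun _ h => h) hg hg s s)
    (bijective_tabFormPM (isCompatible_id g h2 hα hε) ε.symm.bijective h2 hn _
      (fun _ h => h) hg hg s s (fun _ => rfl) (fun _ => rfl) fun pos h => ?_) one_ne_zero
    fun x v w => (isCompatible_id g h2 hα hε).tabForm_gen h2 hα hn x _ _
  have hu : s * s = 1 := Int.units_mul_self s
  have hf : ∀ x y, gbUnit α (flip x) (flip y) = gbUnit α x y := fun x y => by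
    rw [gbUnit, gbUnit, gb_flip]
  simp only [hu, Units.val_one, Int.cast_one, one_mul, pairProd, Function.comp_apply, hf]

end Unitary

/-! ### The involution of the field -/

section Field

variable {p : ℕ} [Fact p.Prime] {K : Type*} [Field K] [Algebra (ZMod p) K] {α : K}

theorem algEquiv_eq_one (hK : (ZMod p)⟮α⟯ = ⊤) {τ : Gal(K/ZMod p)} (h : τ α = α) : τ = 1 := by
  ext x
  have hx : x ∈ (ZMod p)⟮α⟯ := by rw [hK]; trivial
  rw [AlgEquiv.one_apply]
  induction hx using IntermediateField.adjoin_induction with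
  | mem x hx => rw [Set.mem_singleton_iff.mp hx, h]
  | algebraMap x => exact τ.commutes x
  | add x y _ _ hx hy => rw [map_add, hx, hy]
  | inv x _ hx => rw [map_inv₀, hx]
  | mul x y _ _ hx hy => rw [map_mul, hx, hy]

theorem finite_of_orderOf_pos (hK : (ZMod p)⟮α⟯ = ⊤) (h : 0 < orderOf α) : Finite K := by
  have hi : IsIntegral (ZMod p) α :=
    IsIntegral.of_pow h (by rw [pow_orderOf_eq_one]; exact isIntegral_one)
  have h1 := IntermediateField.adjoin.finiteDimensional hi
  rw [hK] at h1
  have h3 : FiniteDimensional (ZMod p) K :=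
    Module.Finite.equiv IntermediateField.topEquiv.toLinearEquiv
  exact Module.finite_of_finite (ZMod p)

/-- A nontrivial automorphism fixing `α + α⁻¹` permutes the roots `α` and `α⁻¹` of a quadratic, so
it inverts `α` and has square 1. The Galois group of a finite field is cyclic, so it has only one
element of order 2. -/
theorem ringEquiv_apply_eq_inv (hK : (ZMod p)⟮α⟯ = ⊤) (h : 0 < orderOf α)
    (hne : (ZMod p)⟮α⟯ ≠ (ZMod p)⟮α + α⁻¹⟯) {ε : K ≃+* K} (hε : orderOf ε = 2) : ε α = α⁻¹ := by
  have := finite_of_orderOf_pos hK h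
  have h0 : α ≠ 0 := by
    rintro rfl
    have h1 := pow_orderOf_eq_one (0 : K)
    rw [zero_pow h.ne'] at h1
    exact zero_ne_one h1
  have hinv : ∀ τ : Gal(K/ZMod p), τ ≠ 1 → τ (α + α⁻¹) = α + α⁻¹ → τ α = α⁻¹ := by
    intro τ hτ hfix
    rw [map_add, map_inv₀] at hfix
    have hτ0 : τ α ≠ 0 := by simpa using h0
    have hmul : (τ α - α) * (τ α - α⁻¹) = 0 := by
      have e1 : τ α * (τ α)⁻¹ = 1 := mul_inv_cancel₀ hτ0
      have e2 : α * α⁻¹ = 1 := mul_inv_cancel₀ h0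
      linear_combination τ α * hfix - e1 + e2
    rcases mul_eq_zero.mp hmul with h1 | h1
    · exact absurd (algEquiv_eq_one hK (sub_eq_zero.mp h1)) hτ
    · exact sub_eq_zero.mp h1
  obtain ⟨τ, hτ, hτ1⟩ : ∃ τ ∈ (ZMod p)⟮α + α⁻¹⟯.fixingSubgroup, τ ≠ 1 := by
    by_contra! hall
    have hbot : (ZMod p)⟮α + α⁻¹⟯.fixingSubgroup = ⊥ := (Subgroup.eq_bot_iff_forall _).mpr hall
    have h1 := IsGalois.fixedField_fixingSubgroup (ZMod p)⟮α + α⁻¹⟯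
    rw [hbot, IntermediateField.fixedField_bot] at h1
    exact hne (hK.trans h1)
  have hτα : τ α = α⁻¹ := hinv τ hτ1 ((IntermediateField.mem_fixingSubgroup_iff _ _).mp hτ _
    (IntermediateField.mem_adjoin_simple_self _ _))
  have hτ2 : τ ^ 2 = 1 := algEquiv_eq_one hK (by
    rw [pow_two, AlgEquiv.mul_apply, hτα, map_inv₀, hτα, inv_inv])
  let ε' : Gal(K/ZMod p) := AlgEquiv.ofRingEquiv (f := ε) fun x =>
    RingHom.congr_fun (Subsingleton.elim ((ε : K →+* K).comp (algebraMap (ZMod p) K))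
      (algebraMap (ZMod p) K)) x
  have hε2 : ε' ^ 2 = 1 := by
    ext x
    have h1 := congrArg (fun f : K ≃+* K => f x) (pow_orderOf_eq_one ε)
    rw [hε] at h1
    exact h1
  have hε1 : ε' ≠ 1 := by
    intro he
    have h1 : ε = 1 := RingEquiv.ext fun x => DFunLike.congr_fun he x
    rw [h1, orderOf_one] at hε
    omega
  have heq : ε' = τ := by
    classical
    have := Fintype.ofFinite Gal(K/ZMod p)
    -- Otherwise `1`, `ε'` and `τ` would be three solutions of `a ^ 2 = 1` in a cyclic group.
    by_contra hετ
    have h3 : ({1, ε', τ} : Finset Gal(K/ZMod p)).card = 3 :=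
      Finset.card_eq_three.mpr ⟨1, ε', τ, hε1.symm, hτ1.symm, hετ, rfl⟩
    have hsub : ({1, ε', τ} : Finset Gal(K/ZMod p)) ⊆ Finset.univ.filter fun a => a ^ 2 = 1 := by
      intro a ha
      simp only [Finset.mem_insert, Finset.mem_singleton] at ha
      rw [Finset.mem_filter]
      rcases ha with rfl | rfl | rfl
      · exact ⟨Finset.mem_univ _, one_pow 2⟩
      · exact ⟨Finset.mem_univ _, hε2⟩
      · exact ⟨Finset.mem_univ _, hτ2⟩
    have h4 := (Finset.card_le_card hsub).trans
      (IsCyclic.card_pow_eq_one_le (n := 2) (by norm_num))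
    omega
  rw [← hτα, ← heq]
  rfl

end Field

/-! ### Isomorphisms -/

section Iso

variable {K G V W X : Type*} [Field K] [Group G] [AddCommMonoid V] [Module K V] [AddCommMonoid W]
  [Module K W] [AddCommMonoid X] [Module K X] {ρ : Representation K G V}
  {τ : Representation K G W} {σ : Representation K G X}

theorem Iso.symm (h : Iso ρ τ) : Iso τ ρ := h.map Representation.Equiv.symm

theorem Iso.trans (h : Iso ρ τ) (h' : Iso τ σ) : Iso ρ σ := ⟨h.some.trans h'.some⟩

theorem Iso.congr_right (h : Iso τ σ) : Iso ρ τ ↔ Iso ρ σ :=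
  ⟨fun h' => h'.trans h, fun h' => h'.trans h.symm⟩

theorem Iso.twist (ε : K ≃+* K) (h : Iso ρ τ) : Iso (twist ε ρ) (twist ε τ) := by
  obtain ⟨f⟩ := h
  let F : Twist ε V ≃ₗ[K] Twist ε W :=
    { toFun := fun v => f.toLinearEquiv v
      invFun := fun v => f.toLinearEquiv.symm v
      map_add' := fun v w => f.toLinearEquiv.map_add v w
      map_smul' := fun c v => f.toLinearEquiv.map_smul (ε.symm c) v
      left_inv := f.toLinearEquiv.left_inv
      right_inv := f.toLinearEquiv.right_inv }
  exact ⟨Representation.Equiv.mk F fun g => LinearMap.ext fun v =>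
    LinearMap.congr_fun (f.isIntertwining' g) v⟩

end Iso

/-! ### The map `φ` -/

section Phi

variable {n : ℕ} {lt : YoungDiagram → YoungDiagram → Prop} [IsStrictTotalOrder YoungDiagram lt]

namespace DoublePartition

theorem phi_eq_conj {g : DoublePartition n} (hg : g.fst = g.snd) : g.phi lt = g.conj := by
  rw [phi, if_neg]
  rw [hg]
  exact fun h => irrefl_of lt _ h.2

/-- Transposition keeps sizes, so the order of the components can be reversed only when the sizes
agree. This is the case in which `phi` exchanges the components. -/
theorem eq_conj_or_iff_eq_phi (hlt : ∀ d e : YoungDiagram, d.card < e.card → lt d e)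
    {l m : DoublePartition n} (hl : lt l.snd l.fst) (hm : lt m.snd m.fst) :
    l = m.conj ∨ l = m.conj.swap ↔ m = l.phi lt := by
  have hle : ∀ {d e : YoungDiagram}, lt d e → d.card ≤ e.card := fun h =>
    not_lt.mp fun h' => asymm_of lt h (hlt _ _ h')
  constructor
  · rintro (rfl | rfl)
    · rw [phi, if_neg, conj_conj]
      intro h
      have h1 := h.2
      simp only [conj, YoungDiagram.transpose_transpose] at h1
      exact asymm_of lt hm h1
    · have h1 := hle hl
      have h3 := hle hm
      simp only [conj, swap, card_transpose] at h1
      rw [phi, if_pos]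
      · ext1 <;> simp [transpose, conj, swap]
      · simp only [conj, swap, card_transpose, YoungDiagram.transpose_transpose]
        exact ⟨by omega, hm⟩
  · rintro rfl
    by_cases h : l.fst.card = l.snd.card ∧ lt l.fst.transpose l.snd.transpose
    · right
      rw [phi, if_pos h]
      ext1 <;> simp [transpose, conj, swap]
    · left
      rw [phi, if_neg h, conj_conj]

theorem fst_ne_snd {l : DoublePartition n} (h : lt l.snd l.fst) : l.fst ≠ l.snd := fun he => by
  rw [he] at h
  exact irrefl_of lt _ h

end DoublePartition

end Phi

/-! ### Comparison of the representations and their duals -/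

section Comparison

variable {K : Type*} [Field K] {n : ℕ} {α : K} (h2 : (2 : K) ≠ 0) (hα : 2 * n < orderOf α)
  (hn1 : 1 < n)

/-- The dual of the representation of shape `m` has shape `m.conj`, so questions on duals become
questions on isomorphisms. The next lemmas do the same for the other cases. -/
theorem resIsoDual_iff (m : DoublePartition n) {M : Type*} [AddCommMonoid M] [Module K M]
    {ρ : Representation K (ArtinD n) M} :
    ResIsoDual ρ (hoefsmit m h2 hα hn1) ↔ ResIso ρ (hoefsmit m.conj h2 hα hn1) := by
  have h := resIsoDual_conj m.conj h2 hα hn1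
  rw [DoublePartition.conj_conj] at h
  exact (Iso.congr_right h).symm

theorem resIsoDual_PM_iff {d : DoublePartition n} (hd : d.fst = d.snd) (s : ℤˣ) {M : Type*}
    [AddCommMonoid M] [Module K M] {ρ : Representation K (ArtinD n) M} :
    ResIsoDual (W := Vpm K d hd s) ρ (hoefsmitPM h2 hα hn1 d hd s) ↔
      ResIso (W := Vpm K d.conj (DoublePartition.conj_fst_eq_snd hd) ((-1) ^ (n / 2) * s)) ρ
        (hoefsmitPM h2 hα hn1 d.conj (DoublePartition.conj_fst_eq_snd hd) ((-1) ^ (n / 2) * s)) :=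
  (Iso.congr_right (resIsoDual_conj_PM (DoublePartition.conj_fst_eq_snd hd) hd
    d.conj_conj.symm h2 hα hn1 _ _ (by rw [mul_assoc, Int.units_mul_self, mul_one]))).symm

theorem resIso_PM_iff (hn : 4 ≤ n) {g d : DoublePartition n} (hg : g.fst = g.snd)
    (hd : d.fst = d.snd) (s s' : ℤˣ) :
    ResIso (V := Vpm K g hg s) (W := Vpm K d hd s') (hoefsmitPM h2 hα hn1 g hg s)
      (hoefsmitPM h2 hα hn1 d hd s') ↔ g = d ∧ s = s' := by
  constructor
  · intro h
    refine ⟨eq_of_resIso_hoefsmitPM h2 hα hn1 hn hg hd s s' h, ?_⟩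
    by_contra hs
    obtain rfl : s' = -s := (Int.units_ne_iff_eq_neg.mp (Ne.symm hs))
    exact not_resIso_hoefsmitPM_neg h2 hα hn1 hn hg hd s h
  · rintro ⟨rfl, rfl⟩
    exact ⟨Representation.Equiv.refl _⟩

theorem resIsoTwistDual_iff (m : DoublePartition n) {ε : K ≃+* K} (hε : ε.symm α = α⁻¹)
    {M : Type*} [AddCommMonoid M] [Module K M] {ρ : Representation K (ArtinD n) M} :
    ResIsoTwistDual ε ρ (hoefsmit m h2 hα hn1) ↔ ResIso ρ (hoefsmit m h2 hα hn1) :=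
  (Iso.congr_right (resIsoTwistDual_self m h2 hα hn1 hε)).symm

theorem resIsoTwistDual_PM_iff {d : DoublePartition n} (hd : d.fst = d.snd) (s : ℤˣ)
    {ε : K ≃+* K} (hε : ε.symm α = α⁻¹) {M : Type*} [AddCommMonoid M] [Module K M]
    {ρ : Representation K (ArtinD n) M} :
    ResIsoTwistDual (W := Vpm K d hd s) ε ρ (hoefsmitPM h2 hα hn1 d hd s) ↔
      ResIso (W := Vpm K d hd s) ρ (hoefsmitPM h2 hα hn1 d hd s) :=
  (Iso.congr_right (resIsoTwistDual_self_PM hd h2 hα hn1 s hε)).symm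

/-- Twisting by `ε` equals dualizing up to isomorphism: the transposed representation is dual to the
given one, and its twisted dual is itself. -/
theorem resIsoTwist_PM_iff {d : DoublePartition n} (hd : d.fst = d.snd) (s : ℤˣ)
    {ε : K ≃+* K} (hε : ε.symm α = α⁻¹) {M : Type*} [AddCommMonoid M] [Module K M]
    {ρ : Representation K (ArtinD n) M} :
    ResIsoTwist (W := Vpm K d hd s) ε ρ (hoefsmitPM h2 hα hn1 d hd s) ↔
      ResIso (W := Vpm K d.conj (DoublePartition.conj_fst_eq_snd hd) ((-1) ^ (n / 2) * s)) ρ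
        (hoefsmitPM h2 hα hn1 d.conj (DoublePartition.conj_fst_eq_snd hd)
          ((-1) ^ (n / 2) * s)) := by
  have h := resIsoDual_conj_PM hd (DoublePartition.conj_fst_eq_snd hd) rfl h2 hα hn1 s
    ((-1) ^ (n / 2) * s) (by rw [mul_left_comm, Int.units_mul_self, mul_one])
  refine (Iso.congr_right (Iso.trans (Iso.twist ε h) ?_))
  exact (resIsoTwistDual_self_PM (DoublePartition.conj_fst_eq_snd hd) h2 hα hn1 _ hε).symm

end Comparison

end TypeD

end

/-! ### Assembly of the ten statements -/

open TypeD in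
theorem mainTheorem10 {p : ℕ} [Fact p.Prime] (hp : p ≠ 2) {n : ℕ} (hn : 4 ≤ n)
    {K : Type*} [Field K] [Algebra (ZMod p) K] (α : K) (hK : (ZMod p)⟮α⟯ = ⊤)
    (hα : 2 * n < orderOf α)
    (lt : YoungDiagram → YoungDiagram → Prop) [IsStrictTotalOrder YoungDiagram lt]
    (hlt : ∀ d e : YoungDiagram, d.card < e.card → lt d e) :
    -- the representations `R_λ` and `R_{γ,±}` of the Artin group, given by the Hoefsmit model
    ∃ (R : ∀ l : DoublePartition n, Representation K (ArtinD n) (V K l))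
      (Rpm : ∀ (g : DoublePartition n) (hg : g.fst = g.snd) (s : ℤˣ),
        Representation K (ArtinD n) (Vpm K g hg s)),
      (∀ l i, R l (gen (.s i)) = opS α 1 l i) ∧
      (∀ l, R l (gen .u) = opU α 1 (by omega) l) ∧
      (∀ g hg s x v, (Rpm g hg s x v : V K g) = R g x (v : V K g)) ∧
      -- 1
      (∀ l : DoublePartition n, lt l.snd l.fst → 1 < Module.finrank K (V K l) →
        IsAbsolutelyIrreducible (res (R l))) ∧
      (∀ (g : DoublePartition n) (hg : g.fst = g.snd) (s : ℤˣ),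
        IsAbsolutelyIrreducible (res (Rpm g hg s))) ∧
      -- 2
      (∀ l m : DoublePartition n, lt l.snd l.fst → lt m.snd m.fst →
        1 < Module.finrank K (V K l) → (ResIso (R l) (R m) ↔ l = m)) ∧
      -- 3
      (∀ l : DoublePartition n, lt l.snd l.fst → 1 < Module.finrank K (V K l) →
        ∀ (g : DoublePartition n) (hg : g.fst = g.snd) (s : ℤˣ), ¬ ResIso (R l) (Rpm g hg s)) ∧
      -- 4
      (∀ (g : DoublePartition n) (hg : g.fst = g.snd) (d : DoublePartition n) (hd : d.fst = d.snd)
          (s : ℤˣ), ResIso (Rpm g hg s) (Rpm d hd s) ↔ g = d) ∧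
      -- 5
      (∀ (g : DoublePartition n) (hg : g.fst = g.snd) (d : DoublePartition n) (hd : d.fst = d.snd)
          (s : ℤˣ), ¬ ResIso (Rpm g hg s) (Rpm d hd (-s))) ∧
      -- 6
      (∀ l m : DoublePartition n, lt l.snd l.fst → lt m.snd m.fst →
        1 < Module.finrank K (V K l) → (ResIsoDual (R l) (R m) ↔ m = l.phi lt)) ∧
      -- 7
      (∀ l : DoublePartition n, lt l.snd l.fst → 1 < Module.finrank K (V K l) →
        ∀ (g : DoublePartition n) (hg : g.fst = g.snd) (s : ℤˣ), ¬ ResIsoDual (R l) (Rpm g hg s)) ∧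
      -- 8
      (n % 4 = 0 →
        (∀ (g : DoublePartition n) (hg : g.fst = g.snd) (d : DoublePartition n) (hd : d.fst = d.snd)
          (s : ℤˣ), ResIsoDual (Rpm g hg s) (Rpm d hd s) ↔ g = d.phi lt) ∧
        (∀ (g : DoublePartition n) (hg : g.fst = g.snd) (d : DoublePartition n) (hd : d.fst = d.snd)
          (s : ℤˣ), ¬ ResIsoDual (Rpm g hg s) (Rpm d hd (-s)))) ∧
      -- 9
      (n % 4 = 2 →
        (∀ (g : DoublePartition n) (hg : g.fst = g.snd) (d : DoublePartition n) (hd : d.fst = d.snd)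
          (s : ℤˣ), ¬ ResIsoDual (Rpm g hg s) (Rpm d hd s)) ∧
        (∀ (g : DoublePartition n) (hg : g.fst = g.snd) (d : DoublePartition n) (hd : d.fst = d.snd)
          (s : ℤˣ), ResIsoDual (Rpm g hg s) (Rpm d hd (-s)) ↔ g = d.phi lt)) ∧
      -- 10
      ((ZMod p)⟮α⟯ ≠ (ZMod p)⟮α + α⁻¹⟯ → ∀ ε : K ≃+* K, orderOf ε = 2 →
        (∀ l m : DoublePartition n, lt l.snd l.fst → lt m.snd m.fst →
          1 < Module.finrank K (V K l) →
          (ResIsoTwistDual ε (R l) (R m) ↔ l = m)) ∧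
        (∀ l : DoublePartition n, lt l.snd l.fst → 1 < Module.finrank K (V K l) →
          ∀ (g : DoublePartition n) (hg : g.fst = g.snd) (s : ℤˣ),
            ¬ ResIsoTwist ε (R l) (Rpm g hg s) ∧
            ¬ ResIsoTwistDual ε (R l) (Rpm g hg s)) ∧
        (∀ (g : DoublePartition n) (hg : g.fst = g.snd) (d : DoublePartition n) (hd : d.fst = d.snd)
          (s : ℤˣ), ResIsoTwistDual ε (Rpm g hg s) (Rpm d hd s) ↔ g = d) ∧
        (∀ (g : DoublePartition n) (hg : g.fst = g.snd) (d : DoublePartition n) (hd : d.fst = d.snd)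
          (s : ℤˣ), ¬ ResIsoTwistDual ε (Rpm g hg s) (Rpm d hd (-s)))) := by
  have hn1 : 1 < n := by omega
  have h2 : (2 : K) ≠ 0 := by
    have h : (2 : ZMod p) ≠ 0 := by
      have h1 : ((2 : ℕ) : ZMod p) ≠ 0 := by
        rw [Ne, ZMod.natCast_eq_zero_iff]
        exact fun hd => hp ((Nat.prime_dvd_prime_iff_eq Fact.out Nat.prime_two).mp hd)
      exact_mod_cast h1
    intro h0
    apply h
    apply (algebraMap (ZMod p) K).injective
    rw [map_ofNat, map_zero, h0]
  have h0 : α ≠ 0 := ne_zero_of_orderOf hα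
  have h1 : α ≠ 1 := ne_one_of_orderOf hα hn
  -- One criterion covers statements 8 and 9; the parity of `n / 2` then gives the sign.
  have hdual : ∀ (g : DoublePartition n) (hg : g.fst = g.snd) (d : DoublePartition n)
      (hd : d.fst = d.snd) (s s' : ℤˣ),
      ResIsoDual (V := Vpm K g hg s) (W := Vpm K d hd s') (hoefsmitPM h2 hα hn1 g hg s)
        (hoefsmitPM h2 hα hn1 d hd s') ↔ g = d.phi lt ∧ s = (-1) ^ (n / 2) * s' :=
    fun g hg d hd s s' => by
      rw [resIsoDual_PM_iff, resIso_PM_iff h2 hα hn1 hn, DoublePartition.phi_eq_conj hd]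
  have hresIso : ∀ l m : DoublePartition n, lt l.snd l.fst → lt m.snd m.fst →
      1 < Module.finrank K (V K l) →
      (ResIso (hoefsmit l h2 hα hn1) (hoefsmit m h2 hα hn1) ↔ l = m) := by
    intro l m hl hm hd
    constructor
    · intro h
      rcases eq_or_eq_swap_of_resIso h2 hα hn1 hn (DoublePartition.fst_ne_snd hl)
        (DoublePartition.fst_ne_snd hm) hd h with rfl | rfl
      · rfl
      · exact absurd hl (asymm_of lt hm)
    · rintro rfl
      exact ⟨Representation.Equiv.refl _⟩
  have hneg : ∀ s : ℤˣ, s ≠ -s := by decide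
  refine ⟨fun l => hoefsmit l h2 hα hn1, fun g hg s => hoefsmitPM h2 hα hn1 g hg s,
    fun l i => hoefsmit_gen l h2 hα hn1 _, fun l => hoefsmit_gen l h2 hα hn1 _,
    fun g hg s x v => rfl, fun l hl hd => ?_, fun g hg s => ?_, fun l m hl hm hd => ?_,
    fun l hl hd g hg s => ?_, fun g hg d hd s => ?_, fun g hg d hd s => ?_,
    fun l m hl hm hd => ?_, fun l hl hd g hg s => ?_, fun h4 => ⟨?_, ?_⟩, fun h4 => ⟨?_, ?_⟩,
    fun hne ε hε => ?_⟩
  · exact (isWeightBasis_hoefsmit (DoublePartition.fst_ne_snd hl) h2 hα hn1).isAbsolutelyIrreducible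
      (isHecke_hoefsmit l h2 hα hn1) hn h0 h1
  · obtain ⟨t, -⟩ := exists_ne_leftTab hg hn1 (by omega)
    have : Nonempty (LeftTab hn1 g) := ⟨t⟩
    exact (isWeightBasis_hoefsmitPM hg s h2 hα hn1 (by omega)).isAbsolutelyIrreducible
      (M := Vpm K g hg s) (isHecke_hoefsmitPM hg s h2 hα hn1) hn h0 h1
  · exact hresIso l m hl hm hd
  · exact not_resIso_hoefsmitPM h2 hα hn1 hn (DoublePartition.fst_ne_snd hl) hg s hd
  · rw [resIso_PM_iff h2 hα hn1 hn]
    simp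
  · rw [resIso_PM_iff h2 hα hn1 hn]
    exact fun h => hneg s h.2
  -- The components of `m.conj` may be in the wrong order, so both it and its swap are possible; the
  -- swap gives an isomorphic representation by `resIso_swap`.
  · rw [resIsoDual_iff, ← DoublePartition.eq_conj_or_iff_eq_phi hlt hl hm]
    refine ⟨eq_or_eq_swap_of_resIso h2 hα hn1 hn (DoublePartition.fst_ne_snd hl)
      (fun he => DoublePartition.fst_ne_snd hm ?_) hd, ?_⟩
    · exact YoungDiagram.transpose_eq_iff.mp he
    · rintro (rfl | rfl)
      · exact ⟨Representation.Equiv.refl _⟩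
      · exact (resIso_swap _ h2 hα hn1).symm
  · rw [resIsoDual_PM_iff]
    exact not_resIso_hoefsmitPM h2 hα hn1 hn (DoublePartition.fst_ne_snd hl) _ _ hd
  · intro g hg d hd s
    rw [hdual, (show Even (n / 2) from ⟨n / 4, by omega⟩).neg_one_pow]
    simp
  · intro g hg d hd s
    rw [hdual, (show Even (n / 2) from ⟨n / 4, by omega⟩).neg_one_pow, one_mul]
    exact fun h => hneg s h.2
  · intro g hg d hd s
    rw [hdual, (show Odd (n / 2) from ⟨n / 4, by omega⟩).neg_one_pow, neg_one_mul]
    exact fun h => hneg s h.2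
  · intro g hg d hd s
    rw [hdual, (show Odd (n / 2) from ⟨n / 4, by omega⟩).neg_one_pow, neg_one_mul, neg_neg]
    simp
  · have hεα : ε.symm α = α⁻¹ := by
      have h := ringEquiv_apply_eq_inv hK (by omega) hne hε
      rw [RingEquiv.symm_apply_eq, map_inv₀, h, inv_inv]
    refine ⟨fun l m hl hm hd => ?_, fun l hl hd g hg s => ⟨?_, ?_⟩, fun g hg d hd s => ?_,
      fun g hg d hd s => ?_⟩
    · rw [resIsoTwistDual_iff h2 hα hn1 m hεα]
      exact hresIso l m hl hm hd
    · rw [resIsoTwist_PM_iff h2 hα hn1 hg s hεα]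
      exact not_resIso_hoefsmitPM h2 hα hn1 hn (DoublePartition.fst_ne_snd hl) _ _ hd
    · rw [resIsoTwistDual_PM_iff h2 hα hn1 hg s hεα]
      exact not_resIso_hoefsmitPM h2 hα hn1 hn (DoublePartition.fst_ne_snd hl) _ _ hd
    · rw [resIsoTwistDual_PM_iff h2 hα hn1 hd s hεα, resIso_PM_iff h2 hα hn1 hn]
      simp
    · rw [resIsoTwistDual_PM_iff h2 hα hn1 hd (-s) hεα, resIso_PM_iff h2 hα hn1 hn]
      exact fun h => hneg s h.2
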